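/- Let $F$ be a field of characteristic not $2$ that is finite (with the discrete topology), or $\mathbb R$, $\mathbb C$, or a non-archimedean local field. Let $\psi\colon F\to\mathbb C^\times$ be a non-trivial continuous unitary additive character, and let $V$ be a finite-dimensional vector space over $F$ with a symplectic form $\langle-,-\rangle$. **Notation.** For a non-degenerate symmetric bilinear form $q$ on a finite-dimensional space $A$, the Weil index $\gamma(q)\in\mathbb C^\times$ is the number with $(f_q\,dq)^\wedge=\gamma(q)f_{-q^*}$ as generalized functions on $A^*$. Here $f_q(x)=\psi(\tfrac12q(x,x))$, $dq$ is the self-dual measure on $A$, and $q^*$ is the dual form on $A^*$. For degenerate $q$, $\gamma(q)$ is the Weil index of the form induced on $A/\ker q$. For $a\in F^\times$, $\gamma(a)$ is the Weil index of $(x,y)\mapsto axy$ on $F$. For a symplectic space $U$, let $\mathrm{Gr}(U)$ be the set of Lagrangian subspaces. For $\ell_1,\dots,\ell_n\in \mathrm{Gr}(U)$, the Maslov index $\tau(\ell_1,\dots,\ell_n)$ is the Witt class of the (possibly degenerate) symmetric form $q(v,w)=\sum_{i>j}\langle v_i,w_j\rangle$ on $\{v\in\ell_1\times\dots\times\ell_n: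 \sum_i v_i=0\}$, and $\gamma(\tau(\ell_1,\dots,\ell_n))=\gamma(q)$. For $g\in Sp(U)$ and $\ell\in\mathrm{Gr}(U)$ put $m_g(\ell)=\gamma(1)^{\frac12\dim U-\dim (g\ell\cap\ell)-1}\gamma(O_{g\ell,\ell})$. Here $O_{g\ell,\ell}\in F^\times/(F^\times)^2$ is defined as follows. Choose an orientation of $\ell$ (a non-zero element of $\det\ell$ modulo $(F^\times)^2$), give $g\ell$ the orientation transported by $g$, and choose an orientation of $g\ell\cap\ell$. These induce orientations of $g\ell/(g\ell\cap\ell)$ and $\ell/(g\ell\cap\ell)$, and $O_{g\ell,\ell}$ is the pairing of these two orientations under the perfect pairing given by the symplectic form. It does not depend on the choices. The metaplectic group $Mp(U)$ is the set of pairs $(g,t)$ with $g\in Sp(U)$ and $t\colon\mathrm{Gr}(U)\to\mathbb C$ such that $t(\ell)^2=m_g(\ell)^2$ and $t(\ell')=\gamma(\tau(\ell,g\ell,g\ell',\ell'))\,t(\ell)$ for all $\ell,\ell'\in\mathrm{Gr}(U)$. Its multiplication is $(g,s)(h,t)=(gh,\,s\,t\,c_{g,h})$, where $c_{g,h}(\ell)=\gamma(\tau(\ell,g\ell,gh\ell))$.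 Let $\overline V$ be $V$ with the form $-\langle-,-\rangle$. For $g\in Sp(V)$ let $\Gamma_g=\{(x,gx):x\in V\}\in\mathrm{Gr}(\overline V\oplus V)$. For $\ell\in\mathrm{Gr}(V)$ and $(g,t)\in Mp(V)$ put $$\Theta_\ell(g,t)=t(\ell)\cdot\gamma(\tau(\Gamma_g,\Gamma_1,\ell\oplus\ell)).$$ Let $\mathrm{ev}_{\Gamma_1}\colon Mp(\overline V\oplus V)\to\mathbb C$ be $(g',t')\mapsto t'(\Gamma_1)$. **Proposition.** There is exactly one injective group homomorphism $\tilde f\colon Mp(V)\to Mp(\overline V\oplus V)$ covering $f\colon Sp(V)\to Sp(\overline V\oplus V)$, $f(g)=(1,g)$. If $\tilde f(g,t)=((1,g),f_g(t))$, then $f_g(t)(\ell\oplus\ell)=t(\ell)$ for all $\ell\in\mathrm{Gr}(V)$ and $(g,t)\in Mp(V)$. For every $\ell\in\mathrm{Gr}(V)$, $$\Theta_\ell=\mathrm{ev}_{\Gamma_1}\circ\tilde f .$$ -/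

import Mathlib

open MeasureTheory

noncomputable section

namespace WeilCharacter

/-! ### The ground field -/

/-- `F`, with its topology, is a finite field, the real field, the complex field, or a
non-archimedean local field. -/
def IsFiniteOrLocalField (F : Type*) [Field F] [TopologicalSpace F] : Prop :=
  (Finite F ∧ DiscreteTopology F) ∨
  (∃ e : F ≃+* ℝ, Continuous e ∧ Continuous e.symm) ∨
  (∃ e : F ≃+* ℂ, Continuous e ∧ Continuous e.symm) ∨
  (∃ _ : ValuativeRel F, IsNonarchimedeanLocalField F)

/-! ### The Weil index -/

section WeilIndex

variable {F : Type*} [Field F] [TopologicalSpace F]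

/-- The Fourier transform on `A` identified with its dual through `ψ ∘ q`:
`φ^(y) = ∫ ψ(-q(x, y)) φ(x) dμ(x)`. -/
def fourier {A : Type*} [AddCommGroup A] [Module F A] [MeasurableSpace A]
    (ψ : AddChar F Circle) (q : LinearMap.BilinForm F A) (μ : Measure A) (φ : A → ℂ) : A → ℂ :=
  VectorFourier.fourierIntegral ψ μ q φ

/-- Test functions: continuous integrable functions with integrable Fourier transform. They
contain the Schwartz(-Bruhat) functions. -/
structure IsTestFunction {A : Type*} [AddCommGroup A] [Module F A] [TopologicalSpace A]
    [MeasurableSpace A] (ψ : AddChar F Circle) (q : LinearMap.BilinForm F A) (μ : Measure A)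
    (φ : A → ℂ) : Prop where
  continuous : Continuous φ
  integrable : Integrable φ μ
  integrable_fourier : Integrable (fourier ψ q μ φ) μ

/-- `μ` is the self-dual Haar measure `dq` on the quadratic space `(A, q)`: Fourier inversion
holds without a constant. -/
structure IsSelfDualMeasure {A : Type*} [AddCommGroup A] [Module F A] [TopologicalSpace A]
    [MeasurableSpace A] (ψ : AddChar F Circle) (q : LinearMap.BilinForm F A)
    (μ : Measure A) : Prop where
  isAddHaarMeasure : μ.IsAddHaarMeasure
  inversion : ∀ φ : A → ℂ, IsTestFunction ψ q μ φ →
    ∀ x, fourier ψ q μ (fourier ψ q μ φ) x = φ (-x)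

/-- The function `f_q : x ↦ ψ(q(x, x) / 2)`. -/
def quadChar {A : Type*} [AddCommGroup A] [Module F A]
    (ψ : AddChar F Circle) (q : LinearMap.BilinForm F A) (x : A) : ℂ :=
  (ψ ((2 : F)⁻¹ * q x x) : ℂ)

/-- `(f_q dq)^ = c • f_{-q*}` as generalized functions, where `A` is identified with its dual by
`a ↦ q(a, -)`, which carries `q` to the dual form `q*`: both sides agree when they are
paired with test functions. -/
def IsWeilConstant {A : Type*} [AddCommGroup A] [Module F A] [TopologicalSpace A]
    [MeasurableSpace A] (ψ : AddChar F Circle) (q : LinearMap.BilinForm F A) (c : ℂ) : Prop :=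
  ∃ μ : Measure A, IsSelfDualMeasure ψ q μ ∧
    ∀ φ : A → ℂ, IsTestFunction ψ q μ φ →
      ∫ x, quadChar ψ q x * fourier ψ q μ φ x ∂μ = c * ∫ y, quadChar ψ (-q) y * φ y ∂μ

/-- `c` is the Weil index of the symmetric, possibly degenerate form `q` on the finite-dimensional
space `A`, that is, the Weil index of the nondegenerate form induced on `A / ker q`. The map `p`
identifies `A / ker q` with some `F ^ n`, which carries the product topology and its Borel sets. -/
def HasWeilIndex {A : Type*} [AddCommGroup A] [Module F A]
    (ψ : AddChar F Circle) (q : LinearMap.BilinForm F A) (c : ℂ) : Prop :=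
  ∃ (n : ℕ) (p : A →ₗ[F] (Fin n → F)) (q' : LinearMap.BilinForm F (Fin n → F)),
    Function.Surjective p ∧ q'.Nondegenerate ∧ (∀ x y, q x y = q' (p x) (p y)) ∧
    letI : MeasurableSpace (Fin n → F) := borel (Fin n → F)
    IsWeilConstant ψ q' c

/-- The Weil index `γ(q)` of a symmetric, possibly degenerate form. -/
def weilIndex {A : Type*} [AddCommGroup A] [Module F A]
    (ψ : AddChar F Circle) (q : LinearMap.BilinForm F A) : ℂ :=
  Classical.epsilon (HasWeilIndex ψ q)

/-- `γ(a)`, the Weil index of the one-dimensional form `x ↦ a x ^ 2`. -/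
def weilIndexScalar (ψ : AddChar F Circle) (a : F) : ℂ :=
  weilIndex ψ (a • LinearMap.mul F F : LinearMap.BilinForm F F)

end WeilIndex

/-! ### Symplectic groups and Lagrangian subspaces -/

section Symplectic

variable {F : Type*} [Field F] {V : Type*} [AddCommGroup V] [Module F V]

/-- The symplectic group `Sp(V)`. -/
def Sp (ω : LinearMap.BilinForm F V) : Subgroup (V ≃ₗ[F] V) where
  carrier := {g | ∀ x y, ω (g x) (g y) = ω x y}
  mul_mem' := fun {a b} ha hb x y => by
    rw [LinearEquiv.mul_apply, LinearEquiv.mul_apply, ha, hb]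
  one_mem' := fun _ _ => rfl
  inv_mem' := fun {a} ha x y => by
    have h := ha (a⁻¹ x) (a⁻¹ y)
    rw [← LinearEquiv.mul_apply, ← LinearEquiv.mul_apply, mul_inv_cancel] at h
    exact h.symm

/-- A Lagrangian subspace is one that equals its own orthogonal. -/
def IsLagrangian (ω : LinearMap.BilinForm F V) (l : Submodule F V) : Prop :=
  ω.orthogonal l = l

/-- The set `Gr(V)` of Lagrangian subspaces. -/
def Gr (ω : LinearMap.BilinForm F V) : Type _ := {l : Submodule F V // IsLagrangian ω l}

/-- The image `g l` of a subspace. -/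
def act {ω : LinearMap.BilinForm F V} (g : Sp ω) (l : Submodule F V) : Submodule F V :=
  l.map (g.1 : V →ₗ[F] V)

/-- The symplectic form of `V̄ ⊕ V`, where `V̄` is `V` with minus the given form. -/
def barSum (ω : LinearMap.BilinForm F V) : LinearMap.BilinForm F (V × V) :=
  ω.compl₁₂ (LinearMap.snd F V V) (LinearMap.snd F V V) -
    ω.compl₁₂ (LinearMap.fst F V V) (LinearMap.fst F V V)

theorem barSum_apply (ω : LinearMap.BilinForm F V) (x y : V × V) :
    barSum ω x y = -ω x.1 y.1 + ω x.2 y.2 := by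
  simp [barSum, sub_eq_neg_add]

/-- The embedding `Sp(V) → Sp(V̄ ⊕ V)`, `g ↦ (1, g)`. -/
def inr (ω : LinearMap.BilinForm F V) : Sp ω →* Sp (barSum ω) where
  toFun g := ⟨(LinearEquiv.refl F V).prodCongr g.1, fun x y => by
    simp [barSum_apply, g.2 x.2 y.2]⟩
  map_one' := rfl
  map_mul' _ _ := rfl

/-- The graph `Γ_g = {(x, g x)}`, as a Lagrangian subspace of `V̄ ⊕ V`. -/
def graph {ω : LinearMap.BilinForm F V} (hω : ω.Nondegenerate) (g : Sp ω) : Gr (barSum ω) :=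
  ⟨(g.1 : V →ₗ[F] V).graph, by
    ext ⟨x, y⟩
    simp only [LinearMap.BilinForm.mem_orthogonal_iff,
      LinearMap.mem_graph_iff, barSum_apply]
    constructor
    · intro h
      have key : ∀ v, ω v (y - g.1 x) = 0 := fun v => by
        obtain ⟨u, rfl⟩ := g.1.surjective v
        have := h (u, g.1 u) rfl
        rw [map_sub, g.2 u x]
        simpa [sub_eq_neg_add] using this
      exact sub_eq_zero.mp (hω.2 _ key)
    · rintro h ⟨u, v⟩ h'
      have hy : y = g.1 x := h
      have hv : v = g.1 u := h'
      subst hy hv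
      simp [g.2 u x]⟩

/-- `l ⊕ l` as a Lagrangian subspace of `V̄ ⊕ V`. -/
def double {ω : LinearMap.BilinForm F V} (l : Gr ω) : Gr (barSum ω) :=
  ⟨l.1.prod l.1, by
    have hl : ∀ x, x ∈ l.1 ↔ ∀ n ∈ l.1, ω n x = 0 := fun x => by
      conv_lhs => rw [← l.2]
      rfl
    ext ⟨x, y⟩
    simp only [LinearMap.BilinForm.mem_orthogonal_iff,
      Submodule.mem_prod, barSum_apply]
    constructor
    · intro h
      refine ⟨(hl x).2 fun n hn => ?_, (hl y).2 fun n hn => ?_⟩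
      · simpa using h (n, 0) ⟨hn, l.1.zero_mem⟩
      · simpa using h (0, n) ⟨l.1.zero_mem, hn⟩
    · rintro ⟨hx, hy⟩ ⟨u, v⟩ ⟨hu, hv⟩
      simp [(hl x).1 hx u hu, (hl y).1 hy v hv]⟩

/-! ### The Maslov index -/

/-- The space `{(v_1, …, v_n) ∈ l_1 × ⋯ × l_n | v_1 + ⋯ + v_n = 0}`. -/
def maslovSpace {n : ℕ} (l : Fin n → Submodule F V) : Submodule F (Fin n → V) where
  carrier := {v | (∀ i, v i ∈ l i) ∧ ∑ i, v i = 0}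
  add_mem' := fun {a b} ha hb =>
    ⟨fun i => (l i).add_mem (ha.1 i) (hb.1 i), by
      simp [Finset.sum_add_distrib, ha.2, hb.2]⟩
  zero_mem' := ⟨fun i => (l i).zero_mem, by simp⟩
  smul_mem' := fun c v hv =>
    ⟨fun i => (l i).smul_mem c (hv.1 i), by simp [← Finset.smul_sum, hv.2]⟩

/-- The symmetric form `q(v, w) = ∑_{j < i} ⟨v_i, w_j⟩` on `maslovSpace l`; its nondegenerate
quotient is the canonical quadratic space whose Witt class is `τ(l_1, …, l_n)`. For `n = 3` it is
`q(v, w) = ⟨v_1, w_3⟩`. -/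
def maslovForm (ω : LinearMap.BilinForm F V) {n : ℕ} (l : Fin n → Submodule F V) :
    LinearMap.BilinForm F (maslovSpace l) :=
  (∑ i : Fin n, ∑ j ∈ Finset.Iio i,
    ω.compl₁₂ (LinearMap.proj (φ := fun _ : Fin n => V) i)
      (LinearMap.proj (φ := fun _ : Fin n => V) j)).compl₁₂
    (maslovSpace l).subtype (maslovSpace l).subtype

variable [TopologicalSpace F]

/-- `γ(τ(l_1, …, l_n))`. -/
def maslovWeil (ψ : AddChar F Circle) (ω : LinearMap.BilinForm F V) {n : ℕ}
    (l : Fin n → Submodule F V) : ℂ :=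
  weilIndex ψ (maslovForm ω l)

end Symplectic

/-! ### Oriented Lagrangians -/

section Orientation

variable {F : Type*} [Field F] {V : Type*} [AddCommGroup V] [Module F V]

/-- `d` represents `O_{l₁, l₂} ∈ Fˣ / (Fˣ)²`, where `l₁` and `l₂` carry the orientations
`⋀ b₁` and `⋀ b₂`. One takes bases `c₁`, `c₂` of `l₁`, `l₂` that share a basis of `l₁ ∩ l₂`,
indexed by `s`. Modulo squares, the orientation `⋀ b_k` is `b_k.det c_k` times `⋀ c_k`, and the
remaining vectors contribute the determinant of their pairing. -/
def IsOrientedDisc (ω : LinearMap.BilinForm F V) {ι : Type*} [Fintype ι] [DecidableEq ι]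
    {l₁ l₂ : Submodule F V} (b₁ : Module.Basis ι F l₁) (b₂ : Module.Basis ι F l₂) (d : F) :
    Prop :=
  ∃ (s : Finset ι) (c₁ : Module.Basis ι F l₁) (c₂ : Module.Basis ι F l₂),
    (∀ i ∈ s, (c₁ i : V) = c₂ i) ∧
    Submodule.span F ((fun i => (c₁ i : V)) '' (s : Set ι)) = l₁ ⊓ l₂ ∧
    d = b₁.det c₁ * b₂.det c₂ *
      (Matrix.of fun i j : {i // i ∉ s} => ω (c₁ i) (c₂ j)).det

/-- A representative of `O_{l₁, l₂}`. -/
def orientedDisc (ω : LinearMap.BilinForm F V) {ι : Type*} [Fintype ι] [DecidableEq ι]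
    {l₁ l₂ : Submodule F V} (b₁ : Module.Basis ι F l₁) (b₂ : Module.Basis ι F l₂) : F :=
  Classical.epsilon (IsOrientedDisc ω b₁ b₂)

variable [TopologicalSpace F]

/-- `m(l₁, l₂) = γ(1) ^ (dim V / 2 - dim (l₁ ∩ l₂) - 1) * γ(O_{l₁, l₂})`, for the orientations
given by `b₁` and `b₂`. -/
def mIndex (ψ : AddChar F Circle) (ω : LinearMap.BilinForm F V) {ι : Type*} [Fintype ι]
    [DecidableEq ι] {l₁ l₂ : Submodule F V} (b₁ : Module.Basis ι F l₁)
    (b₂ : Module.Basis ι F l₂) : ℂ :=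
  weilIndexScalar ψ (1 : F) ^
      (((Module.finrank F V / 2 : ℕ) : ℤ) - (Module.finrank F ↥(l₁ ⊓ l₂) : ℤ) - 1) *
    weilIndexScalar ψ (orientedDisc ω b₁ b₂)

/-- `m_g(l) = m(g l, l)`, where `g l` has the orientation of `l` transported by `g`. -/
def mSelf (ψ : AddChar F Circle) {ω : LinearMap.BilinForm F V} [FiniteDimensional F V]
    (g : Sp ω) (l : Submodule F V) : ℂ :=
  mIndex ψ ω (l₁ := act g l) (l₂ := l)
    ((Module.finBasis F l).map (g.1.submoduleMap l)) (Module.finBasis F l)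

end Orientation

/-! ### The metaplectic group -/

section Metaplectic

variable {F : Type*} [Field F] [TopologicalSpace F]
  {V : Type*} [AddCommGroup V] [Module F V]

/-- The metaplectic group `Mp(V)`, as a set of pairs `(g, t)` with `t : Gr(V) → ℂ`. -/
def Mp [FiniteDimensional F V] (ψ : AddChar F Circle) (ω : LinearMap.BilinForm F V) :
    Set (Sp ω × (Gr ω → ℂ)) :=
  {x | (∀ l : Gr ω, x.2 l ^ 2 = mSelf ψ x.1 l.1 ^ 2) ∧
    ∀ l l' : Gr ω,
      x.2 l' = maslovWeil ψ ω ![l.1, act x.1 l.1, act x.1 l'.1, l'.1] * x.2 l}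

/-- The multiplication `(g, s) (h, t) = (g h, s t c_{g,h})` with
`c_{g,h}(l) = γ(τ(l, g l, g h l))`. -/
def mpMul (ψ : AddChar F Circle) {ω : LinearMap.BilinForm F V} (x y : Sp ω × (Gr ω → ℂ)) :
    Sp ω × (Gr ω → ℂ) :=
  (x.1 * y.1, fun l =>
    x.2 l * y.2 l * maslovWeil ψ ω ![l.1, act x.1 l.1, act (x.1 * y.1) l.1])

/-- `f'` is an injective group homomorphism `Mp(V) → Mp(W)` that covers `f : Sp(V) → Sp(W)`. The
group laws are those of `mpMul`; that the product of two elements of `Mp(V)` lies in `Mp(V)` is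
part of the assertion. -/
structure IsHomomorphicEmbeddingOver [FiniteDimensional F V]
    {W : Type*} [AddCommGroup W] [Module F W] [FiniteDimensional F W]
    (ψ : AddChar F Circle) {ω : LinearMap.BilinForm F V} {η : LinearMap.BilinForm F W}
    (f : Sp ω →* Sp η) (f' : Mp ψ ω → Mp ψ η) : Prop where
  map_mul : ∀ x y : Mp ψ ω, ∃ z : Mp ψ ω,
    z.1 = mpMul ψ x.1 y.1 ∧ (f' z).1 = mpMul ψ (f' x).1 (f' y).1
  injective : Function.Injective f'
  covers : ∀ x : Mp ψ ω, (f' x).1.1 = f x.1.1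

/-- The evaluation `ev_l : (g, t) ↦ t(l)` on `Mp(V)`. -/
def ev [FiniteDimensional F V] (ψ : AddChar F Circle) {ω : LinearMap.BilinForm F V} (l : Gr ω)
    (x : Mp ψ ω) : ℂ :=
  x.1.2 l

/-- `Θ_l(g, t) = t(l) γ(τ(Γ_g, Γ_1, l ⊕ l))`. -/
def theta [FiniteDimensional F V] (ψ : AddChar F Circle) {ω : LinearMap.BilinForm F V}
    (hω : ω.Nondegenerate) (l : Gr ω) (x : Mp ψ ω) : ℂ :=
  x.1.2 l *
    maslovWeil ψ (barSum ω) ![(graph hω x.1.1).1, (graph hω 1).1, (double l).1]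

end Metaplectic

end WeilCharacter

end

/-! The engine is the Weil index as an invariant of Witt classes. It is multiplicative on orthogonal
sums, equals 1 on the hyperbolic plane, and hence does not change when a form is restricted to I^⊥
with I isotropic (`weilIndex_of_range`). The forms of τ(a,b,c) and τ(a,c,d) together map onto such
an I^⊥ inside the form of τ(a,b,c,d), so a quadrilateral splits into two triangles
(`maslovWeil_four`). Consequently γ(τ) is a coboundary: γ(τ(a,b,c)) = γ(τ(o,a,b)) γ(τ(o,b,c))
γ(τ(o,c,a)) for any Lagrangian o. Every identity between Maslov factors below is a cancellation in
this form.

An element (g,t) of Mp is determined by g and one value of t, and that value may be either square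
root of m_g(l)² (`mp_extend`). For this, and for Mp to be closed under products, m² must satisfy the
same rules as γ(τ)². They follow from one formula: for a common complement k of a and b, m(a,b)² is
χ of the determinant that compares the orientations along k, times γ(τ(a,b,k))², where χ(a) =
(γ(a)/γ(1))² (`mIndex_sq`). It requires χ to be a quadratic character of Fˣ. This holds because the
non-zero sums of two squares have index at most 2 in Fˣ and γ(1)⁸ = 1.

Existence: place t(l) at l ⊕ l and spread it by the transformation rule. This is allowed since
m_{(1,g)}(l ⊕ l)² = m_g(l)². The value at Γ_1 is t(l) γ(τ(l ⊕ l, l ⊕ gl, Γ_g, Γ_1)). The triangle (l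
⊕ l, l ⊕ gl, Γ_g) has zero form and the remaining one is a rotation of the triangle in Θ, which
gives the formula for Θ (`theta_aux`). Uniqueness: two lifts differ by a sign that depends only on g
and is multiplicative, and Sp(V) is generated by squares, because transvections are squares when 2
is invertible.

The inputs `HasWeilTheory` and `HasNormTheory` are then proved for each kind of field. Weil
constants come from Gauss sums over lattices in the ultrametric and finite cases and from Gaussian
integrals in the archimedean ones. The index bound comes from a Herbrand quotient on a finite
quotient of F(i)ˣ. -/

set_option linter.unusedSectionVars false

open MeasureTheory

noncomputable section

namespace WeilCharacter

/-! ### Weil constants: uniqueness and transport between pairings. -/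

section GenericWeil

variable {F : Type*} [Field F] [TopologicalSpace F] {ψ : AddChar F Circle}

theorem fourier_apply {A : Type*} [AddCommGroup A] [Module F A] [MeasurableSpace A]
    (ψ : AddChar F Circle) (q : LinearMap.BilinForm F A) (μ : Measure A) (φ : A → ℂ) (y : A) :
    fourier ψ q μ φ y = ∫ x, (ψ (-q x y) : ℂ) * φ x ∂μ := by
  simp [fourier, VectorFourier.fourierIntegral, Circle.smul_def]

theorem norm_quadChar {A : Type*} [AddCommGroup A] [Module F A]
    (q : LinearMap.BilinForm F A) (x : A) : ‖quadChar ψ q x‖ = 1 := by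
  exact Circle.norm_coe _

/-- There is a test function, for a self-dual measure, on which `f_{-q}` does not vanish. -/
def HasTestFunction {A : Type*} [AddCommGroup A] [Module F A] [TopologicalSpace A]
    [MeasurableSpace A] (ψ : AddChar F Circle) (q : LinearMap.BilinForm F A) : Prop :=
  ∃ (μ : Measure A) (φ : A → ℂ), IsSelfDualMeasure ψ q μ ∧ IsTestFunction ψ q μ φ ∧
    ∫ y, quadChar ψ (-q) y * φ y ∂μ ≠ 0

section Unique

variable {A : Type*} [AddCommGroup A] [Module F A] [TopologicalSpace A] [IsTopologicalAddGroup A]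
  [MeasurableSpace A] [BorelSpace A] [LocallyCompactSpace A] [SecondCountableTopology A]
  {q : LinearMap.BilinForm F A}

theorem fourier_smul_measure (s : NNReal) (μ : Measure A) (φ : A → ℂ) :
    fourier ψ q (s • μ) φ = fun y => (s : ℂ) * fourier ψ q μ φ y := by
  ext y
  simp only [fourier_apply]
  rw [integral_smul_nnreal_measure, NNReal.smul_def, Complex.real_smul]

theorem IsTestFunction.smul_measure {μ : Measure A} {φ : A → ℂ} (h : IsTestFunction ψ q μ φ)
    (s : NNReal) : IsTestFunction ψ q (s • μ) φ where
  continuous := h.continuous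
  integrable := h.integrable.smul_measure_nnreal
  integrable_fourier := by
    rw [fourier_smul_measure]
    exact (h.integrable_fourier.const_mul _).smul_measure_nnreal

/-- Haar measures differ by a scalar `s`, and the double transform scales by s², so inversion at a
single point where `φ` is non-zero forces s = 1. Full self-duality of `μ` is not assumed, so the
lemma can identify product measures. -/
theorem IsSelfDualMeasure.eq_of_inversion {μ ν : Measure A} [μ.IsAddHaarMeasure]
    (hν : IsSelfDualMeasure ψ q ν) {φ : A → ℂ} (hφ : IsTestFunction ψ q μ φ) {x : A}
    (h2 : fourier ψ q μ (fourier ψ q μ φ) (-x) = φ (- -x)) (hx : φ x ≠ 0) : ν = μ := by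
  have := hν.isAddHaarMeasure
  obtain ⟨s, hs⟩ : ∃ s : NNReal, ν = s • μ := ⟨_, Measure.isAddLeftInvariant_eq_smul ν μ⟩
  subst hs
  have h1 := hν.inversion φ (hφ.smul_measure s) (-x)
  have h3 : fourier ψ q μ (fun y => (s : ℂ) * fourier ψ q μ φ y) (-x)
      = s * fourier ψ q μ (fourier ψ q μ φ) (-x) := by
    rw [fourier_apply, fourier_apply, ← integral_const_mul]
    exact integral_congr_ae (.of_forall fun _ => mul_left_comm _ _ _)
  rw [fourier_smul_measure, fourier_smul_measure] at h1
  simp only [h3, h2, neg_neg] at h1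
  have h4 : ((s * s : NNReal) : ℂ) = 1 := by
    have : ((s : ℂ) * s - 1) * φ x = 0 := by linear_combination h1
    rcases mul_eq_zero.1 this with h | h
    · push_cast; linear_combination h
    · exact absurd h hx
  have h5 : s * s = 1 := by exact_mod_cast h4
  have h6 : s = 1 := (pow_eq_one_iff_of_nonneg zero_le two_ne_zero).1 (by rw [sq]; exact h5)
  simp [h6]

theorem IsSelfDualMeasure.unique {μ ν : Measure A} (hμ : IsSelfDualMeasure ψ q μ)
    (hν : IsSelfDualMeasure ψ q ν) {φ : A → ℂ} (hφ : IsTestFunction ψ q μ φ) {x : A}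
    (hx : φ x ≠ 0) : ν = μ :=
  have := hμ.isAddHaarMeasure
  hν.eq_of_inversion hφ (hμ.inversion φ hφ (-x)) hx

/-- The test function both pins down the self-dual measure and has non-zero pairing with f_{-q}, so
the constant can be cancelled. -/
theorem IsWeilConstant.unique {c d : ℂ} (ht : HasTestFunction ψ q) (hc : IsWeilConstant ψ q c)
    (hd : IsWeilConstant ψ q d) : c = d := by
  obtain ⟨ρ, φ, hρ, hφ, h0⟩ := ht
  obtain ⟨μ, hμ, h1⟩ := hc
  obtain ⟨ν, hν, h2⟩ := hd
  obtain ⟨x, hx⟩ : ∃ x, φ x ≠ 0 := by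
    by_contra! h
    simp [h] at h0
  obtain rfl := hρ.unique hμ hφ hx
  obtain rfl := hρ.unique hν hφ hx
  exact mul_right_cancel₀ h0 ((h1 φ hφ).symm.trans (h2 φ hφ))

end Unique

section Transport

variable {K : Type*} [Field K] [TopologicalSpace K] {χ : AddChar K Circle}
  {A : Type*} [AddCommGroup A] [Module K A] [TopologicalSpace A] [IsTopologicalAddGroup A]
  [MeasurableSpace A] [BorelSpace A]
  {B : Type*} [AddCommGroup B] [Module F B] [TopologicalSpace B] [IsTopologicalAddGroup B]
  [MeasurableSpace B] [BorelSpace B]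
  {qA : LinearMap.BilinForm K A} {qB : LinearMap.BilinForm F B} {E : A ≃ₜ B}

/-- An additive homeomorphism that identifies the pairing `χ ∘ qA` with `ψ ∘ qB`, and `f_qA` with
`f_qB`. The ground fields may differ. -/
structure IsCharIsometry (χ : AddChar K Circle) (qA : LinearMap.BilinForm K A)
    (ψ : AddChar F Circle) (qB : LinearMap.BilinForm F B) (E : A ≃ₜ B) : Prop where
  map_add : ∀ x y, E (x + y) = E x + E y
  pairing : ∀ x y, ψ (qB (E x) (E y)) = χ (qA x y)
  quadChar : ∀ x, quadChar ψ qB (E x) = quadChar χ qA x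

theorem IsCharIsometry.of_isometry {A : Type*} [AddCommGroup A] [Module F A] [TopologicalSpace A]
    {qA : LinearMap.BilinForm F A} {E : A ≃ₜ B} (hadd : ∀ x y, E (x + y) = E x + E y)
    (hE : ∀ x y, qB (E x) (E y) = qA x y) : IsCharIsometry ψ qA ψ qB E where
  map_add := hadd
  pairing x y := by rw [hE]
  quadChar x := by rw [WeilCharacter.quadChar, WeilCharacter.quadChar, hE]

theorem IsCharIsometry.symm (h : IsCharIsometry χ qA ψ qB E) :
    IsCharIsometry ψ qB χ qA E.symm where
  map_add x y := by
    rw [E.symm_apply_eq, h.map_add, E.apply_symm_apply, E.apply_symm_apply]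
  pairing x y := by rw [← h.pairing, E.apply_symm_apply, E.apply_symm_apply]
  quadChar x := by rw [← h.quadChar, E.apply_symm_apply]

theorem IsCharIsometry.quadChar_neg (h : IsCharIsometry χ qA ψ qB E) (x : A) :
    WeilCharacter.quadChar ψ (-qB) (E x) = WeilCharacter.quadChar χ (-qA) x := by
  have h1 := h.quadChar x
  simp only [WeilCharacter.quadChar, LinearMap.neg_apply, mul_neg, AddChar.map_neg_eq_inv,
    Circle.coe_inv] at h1 ⊢
  rw [h1]

theorem fourier_map (h : IsCharIsometry χ qA ψ qB E) (μ : Measure A) (φ : B → ℂ) (x : A) :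
    fourier ψ qB (μ.map E) φ (E x) = fourier χ qA μ (φ ∘ E) x := by
  simp only [fourier_apply]
  have := integral_map_equiv (μ := μ) E.toMeasurableEquiv
    (fun z => (ψ (-qB z (E x)) : ℂ) * φ z)
  simp only [Homeomorph.toMeasurableEquiv_coe] at this
  rw [this]
  simp [AddChar.map_neg_eq_inv, h.pairing]

theorem isTestFunction_map (h : IsCharIsometry χ qA ψ qB E) {μ : Measure A} {φ : B → ℂ} :
    IsTestFunction ψ qB (μ.map E) φ ↔ IsTestFunction χ qA μ (φ ∘ E) := by
  have hi : ∀ f : B → ℂ, Integrable f (μ.map E) ↔ Integrable (f ∘ E) μ := fun f => by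
    simpa using integrable_map_equiv (μ := μ) E.toMeasurableEquiv f
  have hf : fourier ψ qB (μ.map E) φ ∘ E = fourier χ qA μ (φ ∘ E) :=
    funext fun x => fourier_map h μ φ x
  constructor
  · intro h
    exact ⟨h.continuous.comp E.continuous, (hi _).1 h.integrable,
      hf ▸ (hi _).1 h.integrable_fourier⟩
  · intro h
    exact ⟨E.comp_continuous_iff'.1 h.continuous, (hi _).2 h.integrable,
      (hi _).2 (hf ▸ h.integrable_fourier)⟩

theorem IsSelfDualMeasure.map (h : IsCharIsometry χ qA ψ qB E) {μ : Measure A}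
    (hμ : IsSelfDualMeasure χ qA μ) : IsSelfDualMeasure ψ qB (μ.map E) := by
  have := hμ.isAddHaarMeasure
  refine ⟨?_, fun φ hφ => ?_⟩
  · exact AddEquiv.isAddHaarMeasure_map μ (AddEquiv.mk' E.toEquiv h.map_add) E.continuous
      E.symm.continuous
  · intro y
    obtain ⟨x, rfl⟩ := E.surjective y
    have hneg : E (-x) = - E x := (AddEquiv.mk' E.toEquiv h.map_add).map_neg x
    have hf : fourier ψ qB (μ.map E) φ ∘ E = fourier χ qA μ (φ ∘ E) :=
      funext fun x => fourier_map h μ φ x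
    rw [fourier_map h, hf, hμ.inversion _ ((isTestFunction_map h).1 hφ), Function.comp, hneg]

theorem integral_comp_homeomorph (E : A ≃ₜ B) (μ : Measure A) (f : B → ℂ) :
    ∫ y, f y ∂(μ.map E) = ∫ x, f (E x) ∂μ := by
  simpa using integral_map_equiv (μ := μ) E.toMeasurableEquiv f

/-- Only ψ ∘ q and f_q enter a Weil constant, so the ground fields may differ. This is how a complex
form of rank n is treated as a real form of rank 2n. -/
theorem IsWeilConstant.map {c : ℂ} (hc : IsWeilConstant χ qA c)
    (h : IsCharIsometry χ qA ψ qB E) : IsWeilConstant ψ qB c := by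
  obtain ⟨μ, hμ, hc⟩ := hc
  refine ⟨μ.map E, hμ.map h, fun φ hφ => ?_⟩
  have := hc _ ((isTestFunction_map h).1 hφ)
  rw [integral_comp_homeomorph, integral_comp_homeomorph]
  simp only [fourier_map h, h.quadChar, h.quadChar_neg]
  exact this

theorem HasTestFunction.map (ht : HasTestFunction χ qA) (h : IsCharIsometry χ qA ψ qB E) :
    HasTestFunction ψ qB := by
  obtain ⟨μ, φ, hμ, hφ, h0⟩ := ht
  refine ⟨μ.map E, φ ∘ E.symm, hμ.map h, (isTestFunction_map h).2 ?_, ?_⟩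
  · convert hφ
    ext; simp
  · rw [integral_comp_homeomorph]
    simpa [h.quadChar_neg] using h0

end Transport

section Conj

variable {A : Type*} [AddCommGroup A] [Module F A] [TopologicalSpace A]
  [MeasurableSpace A] {q : LinearMap.BilinForm F A}

theorem conj_addChar (x : F) : (starRingEnd ℂ) (ψ x : ℂ) = ψ (-x) := by
  rw [AddChar.map_neg_eq_inv, Circle.coe_inv_eq_conj]

theorem integrable_conj_iff {μ : Measure A} {f : A → ℂ} :
    Integrable (fun x => (starRingEnd ℂ) (f x)) μ ↔ Integrable f μ := by
  constructor
  · intro h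
    simpa using (Complex.conjLIE.toLinearIsometry.toContinuousLinearMap.integrable_comp h)
  · intro h
    exact (Complex.conjLIE.toLinearIsometry.toContinuousLinearMap.integrable_comp h)

end Conj

end GenericWeil

/-! ### Orthogonal sums. -/

section Tensor

variable {F : Type*} [Field F] [TopologicalSpace F] {ψ : AddChar F Circle}

/-- The orthogonal sum of two bilinear forms. -/
def orthoSum {A B : Type*} [AddCommGroup A] [Module F A] [AddCommGroup B] [Module F B]
    (p : LinearMap.BilinForm F A) (q : LinearMap.BilinForm F B) : LinearMap.BilinForm F (A × B) :=
  p.compl₁₂ (LinearMap.fst F A B) (LinearMap.fst F A B) +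
    q.compl₁₂ (LinearMap.snd F A B) (LinearMap.snd F A B)

@[simp] theorem orthoSum_apply {A B : Type*} [AddCommGroup A] [Module F A] [AddCommGroup B]
    [Module F B] (p : LinearMap.BilinForm F A) (q : LinearMap.BilinForm F B) (x y : A × B) :
    orthoSum p q x y = p x.1 y.1 + q x.2 y.2 := rfl

variable {A : Type*} [AddCommGroup A] [Module F A] [TopologicalSpace A] [IsTopologicalAddGroup A]
  [MeasurableSpace A] [BorelSpace A] [LocallyCompactSpace A] [SecondCountableTopology A]
  {p : LinearMap.BilinForm F A}
  {B : Type*} [AddCommGroup B] [Module F B] [TopologicalSpace B] [IsTopologicalAddGroup B]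
  [MeasurableSpace B] [BorelSpace B] [LocallyCompactSpace B] [SecondCountableTopology B]
  {q : LinearMap.BilinForm F B}

theorem fourier_orthoSum {μ : Measure A} {ν : Measure B} [SFinite μ] [SFinite ν]
    (φ : A → ℂ) (χ : B → ℂ) (z : A × B) :
    fourier ψ (orthoSum p q) (μ.prod ν) (fun w => φ w.1 * χ w.2) z =
      fourier ψ p μ φ z.1 * fourier ψ q ν χ z.2 := by
  simp only [fourier_apply]
  rw [← integral_prod_mul]
  congr 1
  ext w
  rw [orthoSum_apply, neg_add, AddChar.map_add_eq_mul, Circle.coe_mul]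
  ring

theorem quadChar_orthoSum (z : A × B) :
    quadChar ψ (orthoSum p q) z = quadChar ψ p z.1 * quadChar ψ q z.2 := by
  simp [quadChar, mul_add, AddChar.map_add_eq_mul]

theorem neg_orthoSum : -orthoSum p q = orthoSum (-p) (-q) := by
  ext <;> simp

theorem IsTestFunction.prod {μ : Measure A} {ν : Measure B} [SFinite μ] [SFinite ν]
    {φ : A → ℂ} {χ : B → ℂ}
    (hφ : IsTestFunction ψ p μ φ) (hχ : IsTestFunction ψ q ν χ) :
    IsTestFunction ψ (orthoSum p q) (μ.prod ν) (fun w => φ w.1 * χ w.2) where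
  continuous := (hφ.continuous.comp continuous_fst).mul (hχ.continuous.comp continuous_snd)
  integrable := hφ.integrable.mul_prod hχ.integrable
  integrable_fourier := by
    rw [funext (fourier_orthoSum φ χ)]
    exact hφ.integrable_fourier.mul_prod hχ.integrable_fourier

/-- The Weil constant of an orthogonal sum. -/
theorem IsWeilConstant.orthoSum_eq {c d e : ℂ} (hc : IsWeilConstant ψ p c)
    (hd : IsWeilConstant ψ q d) (he : IsWeilConstant ψ (orthoSum p q) e)
    (hp : HasTestFunction ψ p) (hq : HasTestFunction ψ q) : e = c * d := by
  obtain ⟨μ', φ, hμ', hφ, h0⟩ := hp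
  obtain ⟨ν', χ, hν', hχ, h0'⟩ := hq
  obtain ⟨x, hx⟩ : ∃ x, φ x ≠ 0 := by
    by_contra! h
    simp [h] at h0
  obtain ⟨y, hy⟩ : ∃ x, χ x ≠ 0 := by
    by_contra! h
    simp [h] at h0'
  obtain ⟨μ, hμ, h1⟩ := hc
  obtain ⟨ν, hν, h2⟩ := hd
  obtain ⟨ρ, hρ, h3⟩ := he
  obtain rfl := hμ'.unique hμ hφ hx
  obtain rfl := hν'.unique hν hχ hy
  have := hμ.isAddHaarMeasure
  have := hν.isAddHaarMeasure
  have := hρ.isAddHaarMeasure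
  have ht := hφ.prod hχ
  -- Inversion for the product measure is checked on the product test function alone, which is
  -- enough to identify it with `ρ`.
  obtain rfl : ρ = μ.prod ν := by
    refine hρ.eq_of_inversion ht (x := (x, y)) ?_ (mul_ne_zero hx hy)
    rw [funext (fourier_orthoSum φ χ), fourier_orthoSum, hμ.inversion φ hφ, hν.inversion χ hχ]
    rfl
  have h4 := h3 _ ht
  rw [funext (fourier_orthoSum φ χ)] at h4
  have e1 : ∫ z, quadChar ψ (orthoSum p q) z * (fourier ψ p μ φ z.1 * fourier ψ q ν χ z.2)
      ∂(μ.prod ν) = (∫ a, quadChar ψ p a * fourier ψ p μ φ a ∂μ) *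
      ∫ b, quadChar ψ q b * fourier ψ q ν χ b ∂ν := by
    rw [← integral_prod_mul]
    congr 1
    ext z
    rw [quadChar_orthoSum]
    ring
  have e2 : ∫ z : A × B, quadChar ψ (-orthoSum p q) z * (φ z.1 * χ z.2)
      ∂(μ.prod ν) = (∫ a, quadChar ψ (-p) a * φ a ∂μ) * ∫ b, quadChar ψ (-q) b * χ b ∂ν := by
    rw [← integral_prod_mul]
    congr 1
    ext z
    rw [neg_orthoSum, quadChar_orthoSum]
    ring
  rw [e1, e2, h1 _ hφ, h2 _ hχ] at h4
  have h5 : (e - c * d) * ((∫ a, quadChar ψ (-p) a * φ a ∂μ) *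
      ∫ b, quadChar ψ (-q) b * χ b ∂ν) = 0 := by
    linear_combination -h4
  rcases mul_eq_zero.1 h5 with h | h
  · exact sub_eq_zero.1 h
  · exact absurd h (mul_ne_zero h0 h0')

end Tensor

/-! ### The hyperbolic plane has Weil index 1. -/

section Hyperbolic

/-- The hyperbolic plane. -/
def hyperbolicPlane (F : Type*) [Field F] : LinearMap.BilinForm F (F × F) :=
  (LinearMap.mul F F).compl₁₂ (LinearMap.fst F F F) (LinearMap.snd F F F) +
    (LinearMap.mul F F).compl₁₂ (LinearMap.snd F F F) (LinearMap.fst F F F)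

@[simp] theorem hyperbolicPlane_apply {F : Type*} [Field F] (x y : F × F) :
    hyperbolicPlane F x y = x.1 * y.2 + x.2 * y.1 := rfl

variable {F : Type*} [Field F] [TopologicalSpace F] [IsTopologicalRing F] [T2Space F]
  [LocallyCompactSpace F] [SecondCountableTopology F] [MeasurableSpace F] [BorelSpace F]
  {ψ : AddChar F Circle}

theorem fourier_hyperbolicPlane {μ : Measure F} [SFinite μ] (φ χ : F → ℂ) (z : F × F) :
    fourier ψ (hyperbolicPlane F) (μ.prod μ) (fun w => φ w.1 * χ w.2) z =
      fourier ψ (LinearMap.mul F F) μ φ z.2 * fourier ψ (LinearMap.mul F F) μ χ z.1 := by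
  simp only [fourier_apply]
  rw [← integral_prod_mul]
  congr 1
  ext w
  rw [hyperbolicPlane_apply, neg_add, AddChar.map_add_eq_mul, Circle.coe_mul,
    LinearMap.mul_apply', LinearMap.mul_apply']
  ring

theorem quadChar_hyperbolicPlane (h2 : (2 : F) ≠ 0) (z : F × F) :
    quadChar ψ (hyperbolicPlane F) z = ψ (z.1 * z.2) := by
  rw [quadChar, hyperbolicPlane_apply]
  congr 2
  field_simp
  ring

theorem continuous_fourier (hψ : Continuous ψ) {μ : Measure F} {φ : F → ℂ}
    (hφ : Integrable φ μ) : Continuous (fourier ψ (LinearMap.mul F F) μ φ) :=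
  VectorFourier.fourierIntegral_continuous hψ
    (show Continuous fun p : F × F => p.1 * p.2 from continuous_mul) hφ

/-- Conjugating the inversion formula shows that φ ↦ conj(φ^) is an involution on test functions. -/
theorem IsTestFunction.fourier_conj (hψ : Continuous ψ) {μ : Measure F} {φ : F → ℂ}
    (hμ : IsSelfDualMeasure ψ (LinearMap.mul F F) μ)
    (hφ : IsTestFunction ψ (LinearMap.mul F F) μ φ) :
    fourier ψ (LinearMap.mul F F) μ
        (fun x => (starRingEnd ℂ) (fourier ψ (LinearMap.mul F F) μ φ x)) =
      (fun x => (starRingEnd ℂ) (φ x)) ∧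
    IsTestFunction ψ (LinearMap.mul F F) μ
      (fun x => (starRingEnd ℂ) (fourier ψ (LinearMap.mul F F) μ φ x)) := by
  have h1 : fourier ψ (LinearMap.mul F F) μ
        (fun x => (starRingEnd ℂ) (fourier ψ (LinearMap.mul F F) μ φ x)) =
      fun x => (starRingEnd ℂ) (φ x) := by
    ext x
    have h := hμ.inversion φ hφ (-x)
    rw [fourier_apply] at h
    rw [neg_neg] at h
    rw [← h, ← integral_conj, fourier_apply]
    congr 1
    ext y
    rw [map_mul, conj_addChar]
    simp
  refine ⟨h1, Complex.continuous_conj.comp (continuous_fourier hψ hφ.integrable),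
    integrable_conj_iff.2 hφ.integrable_fourier, ?_⟩
  rw [h1]
  exact integrable_conj_iff.2 hφ.integrable

/-- Fubini: integrating out the second coordinate leaves a Fourier transform at a·x. Both sides of
the Weil identity of the hyperbolic plane have this shape, with a = -1 and a = 1. -/
theorem integral_prod_mul_fourier (hψ : Continuous ψ) {μ : Measure F} [SFinite μ] {f g : F → ℂ}
    (hf : Integrable f μ) (hg : Integrable g μ) (a : F) :
    ∫ z : F × F, (ψ (-(z.1 * z.2 * a)) : ℂ) * (f z.1 * g z.2) ∂(μ.prod μ) =
      ∫ x, f x * fourier ψ (LinearMap.mul F F) μ g (a * x) ∂μ := by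
  have hint : Integrable (fun z : F × F => (ψ (-(z.1 * z.2 * a)) : ℂ) * (f z.1 * g z.2))
      (μ.prod μ) := by
    refine (hf.mul_prod hg).bdd_mul (c := 1) ?_ (.of_forall fun z => (Circle.norm_coe _).le)
    exact (Continuous.aestronglyMeasurable (by fun_prop))
  rw [integral_prod _ hint]
  congr 1
  ext x
  rw [fourier_apply, ← integral_const_mul]
  congr 1
  ext y
  rw [LinearMap.mul_apply', show y * (a * x) = x * y * a by ring]
  ring

/-- On φ ⊗ χ with χ = conj(φ^), Fubini and inversion turn both sides of the defining identity into ∫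
|φ|², which is positive. -/
theorem IsWeilConstant.hyperbolicPlane_eq_one (h2 : (2 : F) ≠ 0) (hψ : Continuous ψ) {e : ℂ}
    (he : IsWeilConstant ψ (hyperbolicPlane F) e)
    (hp : HasTestFunction ψ (LinearMap.mul F F : LinearMap.BilinForm F F)) : e = 1 := by
  obtain ⟨μ, φ, hμ, hφ, h0⟩ := hp
  obtain ⟨x, hx⟩ : ∃ x, φ x ≠ 0 := by
    by_contra! h
    simp [h] at h0
  obtain ⟨ρ, hρ, h3⟩ := he
  have := hμ.isAddHaarMeasure
  have := hρ.isAddHaarMeasure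
  obtain ⟨hχ', hχ⟩ := hφ.fourier_conj hψ hμ
  set χ : F → ℂ := fun x => (starRingEnd ℂ) (fourier ψ (LinearMap.mul F F) μ φ x) with hχdef
  -- By inversion `φ` is bounded by the L¹ norm of its transform, so |φ|² is integrable.
  have hb : ∀ x, ‖φ x‖ ≤ ∫ y, ‖fourier ψ (LinearMap.mul F F) μ φ y‖ ∂μ := fun x => by
    have h := hμ.inversion φ hφ (-x)
    rw [neg_neg] at h
    rw [← h]
    exact VectorFourier.norm_fourierIntegral_le_integral_norm _ _ _ _ _
  have hpos : ∫ x, φ x * (starRingEnd ℂ) (φ x) ∂μ ≠ 0 := by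
    have h1 : (fun x => φ x * (starRingEnd ℂ) (φ x)) = fun x => ((‖φ x‖ ^ 2 : ℝ) : ℂ) := by
      ext x
      rw [Complex.mul_conj, Complex.normSq_eq_norm_sq]
    have hi : Integrable (fun x => ‖φ x‖ ^ 2) μ := by
      simp only [sq]
      exact hφ.integrable.norm.bdd_mul (c := ∫ y, ‖fourier ψ (LinearMap.mul F F) μ φ y‖ ∂μ)
        hφ.continuous.norm.aestronglyMeasurable (.of_forall fun x => by simpa using hb x)
    rw [h1, integral_complex_ofReal]
    have h4 : 0 < ∫ x, ‖φ x‖ ^ 2 ∂μ := by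
      rw [integral_pos_iff_support_of_nonneg (fun x => by positivity) hi]
      refine IsOpen.measure_pos μ ?_ ⟨x, by simpa using hx⟩
      exact (hφ.continuous.norm.pow 2).isOpen_support
    exact_mod_cast h4.ne'
  have hχ0 : ∃ y, χ y ≠ 0 := by
    by_contra! h
    apply hpos
    simp only [← funext_iff.1 hχ', fourier_apply, h]
    simp
  obtain ⟨y, hy⟩ := hχ0
  have ht : IsTestFunction ψ (hyperbolicPlane F) (μ.prod μ) (fun w => φ w.1 * χ w.2) := by
    refine ⟨(hφ.continuous.comp continuous_fst).mul (hχ.continuous.comp continuous_snd),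
      hφ.integrable.mul_prod hχ.integrable, ?_⟩
    rw [funext (fourier_hyperbolicPlane φ χ)]
    simpa only [mul_comm] using hχ.integrable_fourier.mul_prod hφ.integrable_fourier
  obtain rfl : ρ = μ.prod μ := by
    refine hρ.eq_of_inversion ht (x := (x, y)) ?_ (mul_ne_zero hx hy)
    rw [funext (fourier_hyperbolicPlane φ χ)]
    simp only [mul_comm (fourier ψ (LinearMap.mul F F) μ φ _)]
    rw [fourier_hyperbolicPlane, hμ.inversion φ hφ, hμ.inversion χ hχ]
    exact mul_comm _ _
  have h4 := h3 _ ht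
  have e1 : ∫ z, quadChar ψ (hyperbolicPlane F) z *
      fourier ψ (hyperbolicPlane F) (μ.prod μ) (fun w => φ w.1 * χ w.2) z ∂(μ.prod μ) =
      ∫ x, φ x * (starRingEnd ℂ) (φ x) ∂μ := by
    have := integral_prod_mul_fourier hψ hχ.integrable_fourier hφ.integrable_fourier (-1)
    rw [hχ'] at this
    simp only [neg_one_mul, hμ.inversion φ hφ, neg_neg] at this
    rw [← (funext fun x => mul_comm _ _ : (fun x => (starRingEnd ℂ) (φ x) * φ x) = _), ← this]
    congr 1
    ext z
    rw [quadChar_hyperbolicPlane h2, fourier_hyperbolicPlane, hχ']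
    ring_nf
  have e2 : ∫ z : F × F, quadChar ψ (-hyperbolicPlane F) z * (φ z.1 * χ z.2)
      ∂(μ.prod μ) = ∫ x, φ x * (starRingEnd ℂ) (φ x) ∂μ := by
    have := integral_prod_mul_fourier hψ hφ.integrable hχ.integrable 1
    rw [hχ'] at this
    simp only [one_mul, mul_one] at this
    rw [← this]
    congr 1
    ext z
    have hz := quadChar_hyperbolicPlane (ψ := ψ) h2 z
    rw [quadChar] at hz ⊢
    rw [LinearMap.neg_apply, LinearMap.neg_apply, mul_neg, ← conj_addChar, hz, conj_addChar]
  rw [e1, e2] at h4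
  exact (mul_eq_right₀ hpos).1 h4.symm

end Hyperbolic

/-! ### The Weil index of symmetric forms, degenerate ones included. -/

section Index

variable {F : Type*} [Field F]

/-- The form `∑ i, a i * x i * y i`. -/
def diagForm {ι : Type*} [Fintype ι] (a : ι → F) : LinearMap.BilinForm F (ι → F) :=
  ∑ i, a i • (LinearMap.mul F F).compl₁₂ (LinearMap.proj (φ := fun _ : ι => F) i)
    (LinearMap.proj (φ := fun _ : ι => F) i)

@[simp] theorem diagForm_apply {ι : Type*} [Fintype ι] (a : ι → F) (x y : ι → F) :
    diagForm a x y = ∑ i, a i * (x i * y i) := by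
  simp [diagForm, LinearMap.sum_apply]

theorem diagForm_nondegenerate {ι : Type*} [Fintype ι] {a : ι → F} (ha : ∀ i, a i ≠ 0) :
    (diagForm a).Nondegenerate := by
  classical
  have key : ∀ x : ι → F, ∀ i, diagForm a x (Pi.single i 1) = a i * x i := fun x i => by
    rw [diagForm_apply, Finset.sum_eq_single i]
    · simp
    · intro j _ hj
      simp [hj]
    · simp
  have symm : ∀ x y, diagForm a x y = diagForm a y x := fun x y => by
    simp [mul_comm]
  constructor
  · intro x hx
    ext i
    have := key x i
    rw [hx] at this
    simpa [ha i] using this.symm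
  · intro x hx
    ext i
    have := key x i
    rw [symm, hx] at this
    simpa [ha i] using this.symm

/-- Every symmetric form is, modulo its kernel, a nondegenerate diagonal form. -/
theorem exists_diagForm (h2 : (2 : F) ≠ 0) {A : Type*} [AddCommGroup A] [Module F A]
    [FiniteDimensional F A] {q : LinearMap.BilinForm F A} (hq : q.IsSymm) :
    ∃ (n : ℕ) (p : A →ₗ[F] (Fin n → F)) (a : Fin n → F), Function.Surjective p ∧
      (∀ i, a i ≠ 0) ∧ ∀ x y, q x y = diagForm a (p x) (p y) := by
  classical
  have := invertibleOfNonzero h2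
  obtain ⟨v, hv⟩ := LinearMap.BilinForm.exists_orthogonal_basis (LinearMap.isSymm_def.2 hq.eq)
  let s := {i // q (v i) (v i) ≠ 0}
  let e : Fin (Fintype.card s) ≃ s := (Fintype.equivFin s).symm
  let p : A →ₗ[F] (Fin (Fintype.card s) → F) :=
    LinearMap.pi fun i => v.coord (e i).1
  refine ⟨Fintype.card s, p, fun i => q (v (e i)) (v (e i)), ?_, fun i => (e i).2, ?_⟩
  · intro y
    refine ⟨∑ i, y i • v (e i).1, ?_⟩
    ext j
    simp only [p, LinearMap.pi_apply, map_sum, map_smul, Module.Basis.coord_apply,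
      Module.Basis.repr_self, smul_eq_mul]
    rw [Finset.sum_eq_single j]
    · simp
    · intro i _ hij
      have : (e i).1 ≠ (e j).1 := fun h => hij (e.injective (Subtype.ext h))
      simp [this]
    · simp
  · intro x y
    have h1 : q x y = ∑ i, q (v i) (v i) * (v.repr x i * v.repr y i) := by
      conv_lhs => rw [← v.sum_repr x, ← v.sum_repr y]
      simp only [map_sum, LinearMap.sum_apply, map_smul, LinearMap.smul_apply, smul_eq_mul]
      refine Finset.sum_congr rfl fun i _ => ?_
      rw [Finset.sum_eq_single i]
      · ring
      · intro j _ hj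
        rw [hv hj]; simp
      · simp
    rw [h1, diagForm_apply]
    simp only [p, LinearMap.pi_apply, Module.Basis.coord_apply]
    rw [Equiv.sum_comp e (fun i : s => q (v i.1) (v i.1) * (v.repr x i.1 * v.repr y i.1))]
    rw [← Finset.sum_filter_add_sum_filter_not Finset.univ
      (fun i => q (v i) (v i) ≠ 0), Finset.sum_subtype (p := fun i => q (v i) (v i) ≠ 0)]
    · rw [add_eq_left]
      refine Finset.sum_eq_zero fun i hi => ?_
      have : q (v i) (v i) = 0 := by simpa using hi
      simp [this]
    · simp

/-- Non-degeneracy makes the kernel of either surjection the radical of `q`. This gives independence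
of the Weil index from the chosen model F^n of A / ker q. -/
theorem exists_equiv_of_comp_eq {A B C : Type*} [AddCommGroup A] [Module F A] [AddCommGroup B]
    [Module F B] [AddCommGroup C] [Module F C] {q : LinearMap.BilinForm F A}
    {qB : LinearMap.BilinForm F B} {qC : LinearMap.BilinForm F C} {p : A →ₗ[F] B} {r : A →ₗ[F] C}
    (hp : Function.Surjective p) (hr : Function.Surjective r)
    (hB : qB.Nondegenerate) (hC : qC.Nondegenerate) (h1 : ∀ x y, q x y = qB (p x) (p y))
    (h2 : ∀ x y, q x y = qC (r x) (r y)) :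
    ∃ T : B ≃ₗ[F] C, (∀ x, T (p x) = r x) ∧ ∀ x y, qC (T x) (T y) = qB x y := by
  have hk : LinearMap.ker p = LinearMap.ker r := by
    ext x
    simp only [LinearMap.mem_ker]
    constructor
    · intro h
      refine hC.1 _ fun y => ?_
      obtain ⟨y, rfl⟩ := hr y
      rw [← h2, h1, h]
      simp
    · intro h
      refine hB.1 _ fun y => ?_
      obtain ⟨y, rfl⟩ := hp y
      rw [← h1, h2, h]
      simp
  let T := (p.quotKerEquivOfSurjective hp).symm.trans
    ((Submodule.quotEquivOfEq _ _ hk).trans (r.quotKerEquivOfSurjective hr))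
  have hT : ∀ x, T (p x) = r x := fun x => by
    have : (p.quotKerEquivOfSurjective hp).symm (p x) = Submodule.Quotient.mk x := by
      rw [LinearEquiv.symm_apply_eq]; rfl
    simp only [T, LinearEquiv.trans_apply, this]
    rfl
  refine ⟨T, hT, fun x y => ?_⟩
  obtain ⟨x, rfl⟩ := hp x
  obtain ⟨y, rfl⟩ := hp y
  rw [hT, hT, ← h1, ← h2]

theorem hyperbolicPlane_isSymm : (hyperbolicPlane F).IsSymm :=
  ⟨fun x y => by simp only [hyperbolicPlane_apply]; ring⟩

variable [TopologicalSpace F]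

/-- The analytic input: nondegenerate diagonal forms have Weil constants and test functions. -/
structure HasWeilTheory (ψ : AddChar F Circle) : Prop where
  two_ne_zero : (2 : F) ≠ 0
  continuous : Continuous ψ
  exists_const : ∀ (n : ℕ) (a : Fin n → F), (∀ i, a i ≠ 0) →
    letI : MeasurableSpace (Fin n → F) := borel (Fin n → F)
    (∃ c, IsWeilConstant ψ (diagForm a) c) ∧ HasTestFunction ψ (diagForm a)

variable [IsTopologicalRing F] [LocallyCompactSpace F] [SecondCountableTopology F] [T2Space F]
  {ψ : AddChar F Circle}

/-- A linear equivalence out of `F ^ n` whose inverse has continuous coordinates. -/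
def homeomorphOfEquiv {ι : Type*} [Finite ι] {A : Type*} [AddCommGroup A] [Module F A]
    [TopologicalSpace A] [ContinuousAdd A] [ContinuousSMul F A] (T : (ι → F) ≃ₗ[F] A)
    (hA : ∀ f : A →ₗ[F] F, Continuous f) : (ι → F) ≃ₜ A where
  toEquiv := T.toEquiv
  continuous_toFun := LinearMap.continuous_on_pi T.toLinearMap
  continuous_invFun := continuous_pi fun i => hA (LinearMap.proj i ∘ₗ T.symm.toLinearMap)

/-- If a nondegenerate form on a topological module is isometric to one on `F ^ n`, then its
Weil index is a Weil constant. -/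
theorem HasWeilIndex.isWeilConstant {A : Type*} [AddCommGroup A] [Module F A]
    [TopologicalSpace A] [IsTopologicalAddGroup A] [ContinuousSMul F A] [MeasurableSpace A]
    [BorelSpace A] (hA : ∀ f : A →ₗ[F] F, Continuous f) {q : LinearMap.BilinForm F A}
    (hq : q.Nondegenerate) {c : ℂ} (h : HasWeilIndex ψ q c) : IsWeilConstant ψ q c := by
  obtain ⟨n, p, q', hp, hq', h1, h⟩ := h
  obtain ⟨T, hT, hT'⟩ := exists_equiv_of_comp_eq (q := q) (qC := q) (r := LinearMap.id) hp
    Function.surjective_id hq' hq h1 fun _ _ => rfl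
  let _ : MeasurableSpace (Fin n → F) := borel (Fin n → F)
  have : BorelSpace (Fin n → F) := ⟨rfl⟩
  exact h.map (.of_isometry (E := homeomorphOfEquiv T hA) (fun x y => T.map_add x y) hT')

theorem continuous_linearMap_pi {ι : Type*} [Finite ι] (f : (ι → F) →ₗ[F] F) : Continuous f :=
  LinearMap.continuous_on_pi f

theorem continuous_linearMap_prod {A B : Type*} [AddCommGroup A] [Module F A]
    [TopologicalSpace A] [AddCommGroup B] [Module F B]
    [TopologicalSpace B] (hA : ∀ f : A →ₗ[F] F, Continuous f) (hB : ∀ f : B →ₗ[F] F, Continuous f)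
    (f : A × B →ₗ[F] F) : Continuous f := by
  have : ⇑f = fun x => (f ∘ₗ LinearMap.inl F A B) x.1 + (f ∘ₗ LinearMap.inr F A B) x.2 := by
    ext x
    simp [← map_add]
  rw [this]
  exact ((hA _).comp continuous_fst).add ((hB _).comp continuous_snd)

theorem continuous_linearMap_self (f : F →ₗ[F] F) : Continuous f := by
  have : ⇑f = fun x => x * f 1 := by
    ext x
    rw [← smul_eq_mul, ← map_smul, smul_eq_mul, mul_one]
  rw [this]
  fun_prop

variable (hW : HasWeilTheory ψ)
  {A : Type*} [AddCommGroup A] [Module F A] [FiniteDimensional F A]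
  {B : Type*} [AddCommGroup B] [Module F B] [FiniteDimensional F B]

theorem HasWeilIndex.comp {q : LinearMap.BilinForm F A} {q' : LinearMap.BilinForm F B}
    {c : ℂ} (h : HasWeilIndex ψ q c) (p : B →ₗ[F] A) (hp : Function.Surjective p)
    (hq : ∀ x y, q' x y = q (p x) (p y)) : HasWeilIndex ψ q' c := by
  obtain ⟨n, r, s, hr, hs, h1, h⟩ := h
  exact ⟨n, r ∘ₗ p, s, hr.comp hp, hs, fun x y => by rw [hq, h1]; rfl, h⟩

include hW

theorem HasWeilTheory.hasWeilIndex_diag {n : ℕ} {a : Fin n → F} (ha : ∀ i, a i ≠ 0) :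
    ∃ c, HasWeilIndex ψ (diagForm a) c := by
  obtain ⟨⟨c, hc⟩, -⟩ := hW.exists_const n a ha
  exact ⟨c, n, LinearMap.id, diagForm a, Function.surjective_id, diagForm_nondegenerate ha,
    fun _ _ => rfl, hc⟩

theorem HasWeilTheory.hasTestFunction [TopologicalSpace A] [IsTopologicalAddGroup A]
    [ContinuousSMul F A] [MeasurableSpace A]
    [BorelSpace A] (hA : ∀ f : A →ₗ[F] F, Continuous f) {q : LinearMap.BilinForm F A}
    (hs : q.IsSymm) (hq : q.Nondegenerate) : HasTestFunction ψ q := by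
  obtain ⟨n, p, a, hp, ha, h1⟩ := exists_diagForm hW.two_ne_zero hs
  obtain ⟨T, hT, hT'⟩ := exists_equiv_of_comp_eq (q := q) (qC := q) (r := LinearMap.id) hp
    Function.surjective_id (diagForm_nondegenerate ha) hq h1 fun _ _ => rfl
  let _ : MeasurableSpace (Fin n → F) := borel (Fin n → F)
  have : BorelSpace (Fin n → F) := ⟨rfl⟩
  exact (hW.exists_const n a ha).2.map
    (.of_isometry (E := homeomorphOfEquiv T hA) (fun x y => T.map_add x y) hT')

theorem HasWeilTheory.unique {q : LinearMap.BilinForm F A} (hs : q.IsSymm) {c d : ℂ}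
    (hc : HasWeilIndex ψ q c) (hd : HasWeilIndex ψ q d) : c = d := by
  obtain ⟨n, p, q', hp, hq', h1, h⟩ := hc
  obtain ⟨m, r, s, hr, hs', h2, h'⟩ := hd
  obtain ⟨T, hT, hT'⟩ := exists_equiv_of_comp_eq hp hr hq' hs' h1 h2
  let _ : MeasurableSpace (Fin n → F) := borel (Fin n → F)
  have : BorelSpace (Fin n → F) := ⟨rfl⟩
  let _ : MeasurableSpace (Fin m → F) := borel (Fin m → F)
  have : BorelSpace (Fin m → F) := ⟨rfl⟩
  have h3 : IsWeilConstant ψ s c :=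
    h.map (.of_isometry (E := homeomorphOfEquiv T continuous_linearMap_pi)
      (fun x y => T.map_add x y) hT')
  have hs2 : s.IsSymm := ⟨fun x y => by
    obtain ⟨x, rfl⟩ := hr x
    obtain ⟨y, rfl⟩ := hr y
    rw [← h2, ← h2]
    exact hs.eq x y⟩
  exact h3.unique (hW.hasTestFunction continuous_linearMap_pi hs2 hs') h'

/-- Diagonalisation shows that `Classical.epsilon` chooses from a non-empty set. -/
theorem HasWeilTheory.hasWeilIndex {q : LinearMap.BilinForm F A} (hs : q.IsSymm) :
    HasWeilIndex ψ q (weilIndex ψ q) := by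
  obtain ⟨n, p, a, hp, ha, h1⟩ := exists_diagForm hW.two_ne_zero hs
  obtain ⟨c, hc⟩ := hW.hasWeilIndex_diag ha
  exact Classical.epsilon_spec ⟨c, hc.comp p hp h1⟩

theorem HasWeilTheory.weilIndex_eq {q : LinearMap.BilinForm F A} (hs : q.IsSymm) {c : ℂ}
    (h : HasWeilIndex ψ q c) : weilIndex ψ q = c :=
  hW.unique hs (hW.hasWeilIndex hs) h

/-- The Weil index does not change under pull-back by a surjective linear map. -/
theorem HasWeilTheory.weilIndex_comp {q : LinearMap.BilinForm F A} {q' : LinearMap.BilinForm F B}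
    (hs : q.IsSymm) (p : B →ₗ[F] A) (hp : Function.Surjective p)
    (hq : ∀ x y, q' x y = q (p x) (p y)) : weilIndex ψ q' = weilIndex ψ q :=
  hW.weilIndex_eq ⟨fun x y => by rw [hq, hq]; exact hs.eq _ _⟩
    ((hW.hasWeilIndex hs).comp p hp hq)

theorem HasWeilTheory.weilIndex_orthoSum {p : LinearMap.BilinForm F A}
    {q : LinearMap.BilinForm F B} (hp : p.IsSymm) (hq : q.IsSymm) :
    weilIndex ψ (orthoSum p q) = weilIndex ψ p * weilIndex ψ q := by
  obtain ⟨n, f, a, hf, ha, h1⟩ := exists_diagForm hW.two_ne_zero hp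
  obtain ⟨m, g, b, hg, hb, h2⟩ := exists_diagForm hW.two_ne_zero hq
  have sd : ∀ {k : ℕ} (a : Fin k → F), (diagForm a).IsSymm := fun a =>
    ⟨fun x y => by simp [mul_comm]⟩
  have so : (orthoSum (diagForm a) (diagForm b)).IsSymm :=
    ⟨fun x y => by rw [orthoSum_apply, orthoSum_apply, (sd a).eq, (sd b).eq]⟩
  have no : (orthoSum (diagForm a) (diagForm b)).Nondegenerate := by
    have n1 := diagForm_nondegenerate ha
    have n2 := diagForm_nondegenerate hb
    constructor
    · intro x hx
      exact Prod.ext (n1.1 _ fun y => by simpa using hx (y, 0))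
        (n2.1 _ fun y => by simpa using hx (0, y))
    · intro x hx
      exact Prod.ext (n1.2 _ fun y => by simpa using hx (y, 0))
        (n2.2 _ fun y => by simpa using hx (0, y))
  rw [hW.weilIndex_comp (sd a) f hf h1, hW.weilIndex_comp (sd b) g hg h2,
    hW.weilIndex_comp so (f.prodMap g) (hf.prodMap hg) (fun x y => by simp [h1, h2])]
  let _ : MeasurableSpace (Fin n → F) := borel (Fin n → F)
  have : BorelSpace (Fin n → F) := ⟨rfl⟩
  let _ : MeasurableSpace (Fin m → F) := borel (Fin m → F)
  have : BorelSpace (Fin m → F) := ⟨rfl⟩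
  exact IsWeilConstant.orthoSum_eq
    ((hW.hasWeilIndex (sd a)).isWeilConstant continuous_linearMap_pi (diagForm_nondegenerate ha))
    ((hW.hasWeilIndex (sd b)).isWeilConstant continuous_linearMap_pi (diagForm_nondegenerate hb))
    ((hW.hasWeilIndex so).isWeilConstant
      (continuous_linearMap_prod continuous_linearMap_pi continuous_linearMap_pi) no)
    (hW.hasTestFunction continuous_linearMap_pi (sd a) (diagForm_nondegenerate ha))
    (hW.hasTestFunction continuous_linearMap_pi (sd b) (diagForm_nondegenerate hb))

theorem HasWeilTheory.weilIndex_hyperbolicPlane : weilIndex ψ (hyperbolicPlane F) = 1 := by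
  borelize F
  have hn : (hyperbolicPlane F).Nondegenerate :=
    ⟨fun x hx => Prod.ext (by simpa using hx (0, 1)) (by simpa using hx (1, 0)),
      fun x hx => Prod.ext (by simpa using hx (0, 1)) (by simpa using hx (1, 0))⟩
  refine IsWeilConstant.hyperbolicPlane_eq_one hW.two_ne_zero hW.continuous
    ((hW.hasWeilIndex hyperbolicPlane_isSymm).isWeilConstant (continuous_linearMap_prod
      continuous_linearMap_self continuous_linearMap_self) hn)
    (hW.hasTestFunction continuous_linearMap_self ⟨fun x y => mul_comm _ _⟩ ⟨?_, ?_⟩)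
  · intro x hx
    simpa using hx 1
  · intro x hx
    simpa using hx 1

end Index

/-! ### Invariance of the Weil index in the Witt group. -/

section Witt

variable {F : Type*} [Field F] [TopologicalSpace F]
  [IsTopologicalRing F] [LocallyCompactSpace F] [SecondCountableTopology F] [T2Space F]
  {ψ : AddChar F Circle} (hW : HasWeilTheory ψ)
  {A : Type*} [AddCommGroup A] [Module F A] [FiniteDimensional F A]
  {B : Type*} [AddCommGroup B] [Module F B] [FiniteDimensional F B]

theorem smul_mul_isSymm (a : F) :
    LinearMap.BilinForm.IsSymm (a • LinearMap.mul F F : LinearMap.BilinForm F F) :=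
  ⟨fun x y => by simp [mul_comm]⟩

theorem orthoSum_isSymm {p : LinearMap.BilinForm F A} {q : LinearMap.BilinForm F B}
    (hp : p.IsSymm) (hq : q.IsSymm) : (orthoSum p q).IsSymm :=
  ⟨fun x y => by rw [orthoSum_apply, orthoSum_apply, hp.eq, hq.eq]⟩

theorem diagForm_isSymm {ι : Type*} [Fintype ι] (a : ι → F) : (diagForm a).IsSymm :=
  ⟨fun x y => by simp [mul_comm]⟩

theorem restrict_isSymm {q : LinearMap.BilinForm F A} (hq : q.IsSymm) (W : Submodule F A) :
    (q.restrict W).IsSymm :=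
  ⟨fun x y => hq.eq x y⟩

include hW

/-- For a hyperbolic plane H, γ(H ⊕ 0) is γ(H) because the zero summand is the radical, and it is
also γ(H) γ(0). -/
theorem HasWeilTheory.weilIndex_zero : weilIndex ψ (0 : LinearMap.BilinForm F A) = 1 := by
  have h0 : (0 : LinearMap.BilinForm F A).IsSymm := ⟨fun _ _ => rfl⟩
  have h1 := hW.weilIndex_orthoSum hyperbolicPlane_isSymm h0
  rw [hW.weilIndex_comp (q' := orthoSum (hyperbolicPlane F) (0 : LinearMap.BilinForm F A))
    hyperbolicPlane_isSymm (LinearMap.fst F (F × F) A) Prod.fst_surjective (fun x y => by simp),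
    hW.weilIndex_hyperbolicPlane, one_mul] at h1
  exact h1.symm

theorem HasWeilTheory.scalar_mul_sq (a : F) {c : F} (hc : c ≠ 0) :
    weilIndexScalar ψ (a * c ^ 2) = weilIndexScalar ψ a := by
  refine hW.weilIndex_comp (smul_mul_isSymm a) (LinearMap.mulLeft F c)
    (fun y => ⟨c⁻¹ * y, by simp [hc]⟩) fun x y => ?_
  simp
  ring

/-- ⟨a⟩ ⊕ ⟨-a⟩ is a hyperbolic plane in the coordinates (a/2)(x - y) and x + y. -/
theorem HasWeilTheory.scalar_mul_neg {a : F} (ha : a ≠ 0) :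
    weilIndexScalar ψ a * weilIndexScalar ψ (-a) = 1 := by
  have h2 := hW.two_ne_zero
  rw [weilIndexScalar, weilIndexScalar,
    ← hW.weilIndex_orthoSum (smul_mul_isSymm _) (smul_mul_isSymm _)]
  refine (hW.weilIndex_comp hyperbolicPlane_isSymm
    (((a / 2) • (LinearMap.fst F F F - LinearMap.snd F F F)).prod
      (LinearMap.fst F F F + LinearMap.snd F F F)) ?_ ?_).trans hW.weilIndex_hyperbolicPlane
  · rintro ⟨u, v⟩
    refine ⟨(v / 2 + u / a, v / 2 - u / a), ?_⟩
    ext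
    · simp; field_simp; ring
    · simp; field_simp; ring
  · intro x y
    simp
    field_simp
    ring

theorem HasWeilTheory.scalar_ne_zero {a : F} (ha : a ≠ 0) : weilIndexScalar ψ a ≠ 0 :=
  left_ne_zero_of_mul_eq_one (hW.scalar_mul_neg ha)

/-- ⟨a⟩ ⊕ ⟨b⟩ takes the value a + b at (1, 1), and the orthogonal vector (b, -a) has value ab(a +
b). -/
theorem HasWeilTheory.scalar_mul_scalar {a b : F} (hab : a + b ≠ 0) :
    weilIndexScalar ψ a * weilIndexScalar ψ b =
      weilIndexScalar ψ (a + b) * weilIndexScalar ψ (a * b * (a + b)) := by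
  simp only [weilIndexScalar]
  rw [← hW.weilIndex_orthoSum (smul_mul_isSymm _) (smul_mul_isSymm _),
    ← hW.weilIndex_orthoSum (smul_mul_isSymm _) (smul_mul_isSymm _)]
  refine (hW.weilIndex_comp (orthoSum_isSymm (smul_mul_isSymm _) (smul_mul_isSymm _))
    ((LinearMap.fst F F F + b • LinearMap.snd F F F).prod
      (LinearMap.fst F F F - a • LinearMap.snd F F F)) ?_ ?_).symm
  · rintro ⟨u, v⟩
    refine ⟨((a * u + b * v) / (a + b), (u - v) / (a + b)), ?_⟩
    ext
    · simp; field_simp; ring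
    · simp; field_simp; ring
  · intro x y
    simp
    ring

theorem HasWeilTheory.weilIndex_diagForm {n : ℕ} (a : Fin n → F) :
    weilIndex ψ (diagForm a) = ∏ i, weilIndexScalar ψ (a i) := by
  induction n with
  | zero =>
    rw [show diagForm a = 0 by ext x y; simp, hW.weilIndex_zero]
    simp
  | succ n ih =>
    rw [Fin.prod_univ_succ, ← ih, weilIndexScalar,
      ← hW.weilIndex_orthoSum (smul_mul_isSymm _) (diagForm_isSymm _)]
    refine hW.weilIndex_comp (orthoSum_isSymm (smul_mul_isSymm _) (diagForm_isSymm _))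
      ((LinearMap.proj 0).prod (LinearMap.pi fun i => LinearMap.proj i.succ)) ?_ ?_
    · rintro ⟨u, v⟩
      exact ⟨Fin.cons u v, by ext <;> simp⟩
    · intro x y
      simp [Fin.sum_univ_succ]

theorem HasWeilTheory.weilIndex_mul_weilIndex_neg {q q' : LinearMap.BilinForm F A}
    (hq : q.IsSymm) (h : ∀ x y, q' x y = -q x y) : weilIndex ψ q * weilIndex ψ q' = 1 := by
  obtain ⟨n, p, a, hp, ha, h1⟩ := exists_diagForm hW.two_ne_zero hq
  rw [hW.weilIndex_comp (diagForm_isSymm a) p hp h1,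
    hW.weilIndex_comp (q' := q') (diagForm_isSymm (-a)) p hp
    (fun x y => by simp [h, h1]), hW.weilIndex_diagForm, hW.weilIndex_diagForm,
    ← Finset.prod_mul_distrib]
  exact Finset.prod_eq_one fun i _ => hW.scalar_mul_neg (ha i)

theorem HasWeilTheory.weilIndex_ne_zero {q : LinearMap.BilinForm F A}
    (hq : q.IsSymm) : weilIndex ψ q ≠ 0 :=
  left_ne_zero_of_mul_eq_one (hW.weilIndex_mul_weilIndex_neg hq (q' := -q) fun _ _ => rfl)

/-- Outside the radical, the isotropic `v` has an isotropic partner `w` with q(v, w) = 1. Their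
hyperbolic plane splits off with index 1, and both `A` and v^⊥ project onto the same complement `K`.
-/
theorem HasWeilTheory.weilIndex_restrict_ker {q : LinearMap.BilinForm F A}
    (hq : q.IsSymm) {v : A} (hv : q v v = 0) :
    weilIndex ψ (q.restrict (LinearMap.ker (q v))) = weilIndex ψ q := by
  by_cases h0 : q v = 0
  · refine hW.weilIndex_comp hq (LinearMap.ker (q v)).subtype (fun y => ?_) fun _ _ => rfl
    exact ⟨⟨y, by simp [h0]⟩, rfl⟩
  · obtain ⟨u, hu⟩ : ∃ u, q v u ≠ 0 := by
      by_contra! h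
      exact h0 (LinearMap.ext h)
    obtain ⟨w, hvw, hww⟩ : ∃ w, q v w = 1 ∧ q w w = 0 := by
      have h2 := hW.two_ne_zero
      -- Normalise `u`, then subtract the multiple of `v` that kills q(w, w).
      refine ⟨(q v u)⁻¹ • u - ((q v u)⁻¹ ^ 2 * q u u / 2) • v, ?_, ?_⟩
      · simp [hv, hu]
      · simp only [map_sub, map_smul, LinearMap.sub_apply, LinearMap.smul_apply, smul_eq_mul,
          hv, hq.eq u v]
        field_simp
        ring
    have hwv : q w v = 1 := by rw [hq.eq]; exact hvw
    let K : Submodule F A := LinearMap.ker (q v) ⊓ LinearMap.ker (q w)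
    let r : A →ₗ[F] K := (LinearMap.id - (q w).smulRight v - (q v).smulRight w).codRestrict K
      fun x => by
        simp [K, hv, hvw, hww, hwv]
    have hr : ∀ x, (r x : A) = x - q w x • v - q v x • w := fun x => rfl
    have hrK : ∀ k : K, r k = k := fun k => by
      ext
      rw [hr]
      have h1 : q v k = 0 := k.2.1
      have h2 : q w k = 0 := k.2.2
      simp [h1, h2]
    have hrq : ∀ x y, q (r x) (r y) = q x y - (q v x * q w y + q w x * q v y) := fun x y => by
      simp only [hr, map_sub, map_smul, LinearMap.sub_apply, LinearMap.smul_apply, smul_eq_mul,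
        hv, hvw, hww, hwv, hq.eq x v, hq.eq x w]
      ring
    have hK := restrict_isSymm hq K
    have e1 : weilIndex ψ q = weilIndex ψ (orthoSum (hyperbolicPlane F) (q.restrict K)) := by
      refine hW.weilIndex_comp (orthoSum_isSymm hyperbolicPlane_isSymm hK)
        (((q v).prod (q w)).prod r) ?_ fun x y => ?_
      · rintro ⟨⟨s, t⟩, k⟩
        have h1 : q v k = 0 := k.2.1
        have h2 : q w k = 0 := k.2.2
        refine ⟨k + t • v + s • w, ?_⟩
        refine Prod.ext (Prod.ext ?_ ?_) ?_
        · simp [hv, hvw, h1]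
        · simp [hwv, hww, h2]
        · ext
          simp [hr, hv, hvw, hww, hwv, h1, h2]
      · change q x y = (q v x * q w y + q w x * q v y) + q (r x) (r y)
        rw [hrq]
        ring
    rw [e1, hW.weilIndex_orthoSum hyperbolicPlane_isSymm hK, hW.weilIndex_hyperbolicPlane, one_mul]
    refine hW.weilIndex_comp hK (r ∘ₗ (LinearMap.ker (q v)).subtype) (fun k => ?_) fun x y => ?_
    · exact ⟨⟨k, k.2.1⟩, hrK k⟩
    · have h1 : q v x = 0 := x.2
      have h2 : q v y = 0 := y.2
      change q x y = q (r x) (r y)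
      rw [hrq, h1, h2]
      ring

theorem HasWeilTheory.weilIndex_of_range_ker {q : LinearMap.BilinForm F A}
    {q' : LinearMap.BilinForm F B} (hq : q.IsSymm) {v : A} (hv : q v v = 0) (f : B →ₗ[F] A)
    (hf : ∀ x, x ∈ LinearMap.range f ↔ q v x = 0)
    (hq' : ∀ x y, q' x y = q (f x) (f y)) : weilIndex ψ q' = weilIndex ψ q := by
  rw [← hW.weilIndex_restrict_ker hq hv]
  refine hW.weilIndex_comp (restrict_isSymm hq _)
    (f.codRestrict _ fun x => (hf _).1 ⟨x, rfl⟩) (fun y => ?_) fun x y => ?_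
  · obtain ⟨x, hx⟩ := (hf _).2 y.2
    exact ⟨x, Subtype.ext hx⟩
  · rw [hq', LinearMap.BilinForm.restrict_apply]
    rfl

/-- The vectors of `s` are imposed one at a time; mutual orthogonality keeps each new one inside the
space cut out by the others. `W` and `q'` are given only by membership and values, so that the
induction never has to identify nested subtypes. -/
theorem HasWeilTheory.weilIndex_orthogonal_finset {q : LinearMap.BilinForm F A} (hq : q.IsSymm)
    (s : Finset A) : (∀ x ∈ s, ∀ y ∈ s, q x y = 0) →
    ∀ (W : Submodule F A), (∀ x, x ∈ W ↔ ∀ v ∈ s, q v x = 0) →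
    ∀ (q' : LinearMap.BilinForm F W), (∀ x y, q' x y = q x y) →
    weilIndex ψ q' = weilIndex ψ q := by
  classical
  induction s using Finset.induction_on with
  | empty =>
    intro _ W hW' q' hq'
    refine hW.weilIndex_comp hq W.subtype (fun y => ⟨⟨y, ?_⟩, rfl⟩) hq'
    rw [hW']
    simp
  | insert v s hv ih =>
    intro hs W hWs q' hq'
    obtain ⟨W₀, hW₀⟩ : ∃ W₀ : Submodule F A, ∀ x, x ∈ W₀ ↔ ∀ v ∈ s, q v x = 0 :=
      ⟨⨅ v ∈ s, LinearMap.ker (q v), fun x => by simp⟩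
    obtain ⟨q₀, hq₀⟩ : ∃ q₀ : LinearMap.BilinForm F W₀, ∀ x y, q₀ x y = q x y :=
      ⟨q.compl₁₂ W₀.subtype W₀.subtype, fun _ _ => rfl⟩
    rw [← ih (fun x hx y hy => hs x (Finset.mem_insert_of_mem hx) y (Finset.mem_insert_of_mem hy))
      W₀ hW₀ q₀ hq₀]
    have hvW : v ∈ W₀ := (hW₀ v).2 fun x hx =>
      hs x (Finset.mem_insert_of_mem hx) v (Finset.mem_insert_self _ _)
    have hWW : ∀ x, x ∈ W ↔ q v x = 0 ∧ x ∈ W₀ := fun x => by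
      rw [hWs, hW₀, Finset.forall_mem_insert]
    refine hW.weilIndex_of_range_ker (v := ⟨v, hvW⟩)
      ⟨fun x y => by rw [hq₀, hq₀]; exact hq.eq _ _⟩ ?_
      (Submodule.inclusion fun x hx => ((hWW x).1 hx).2) (fun x => ?_) fun x y => ?_
    · rw [hq₀]
      exact hs v (Finset.mem_insert_self _ _) v (Finset.mem_insert_self _ _)
    · rw [hq₀, Submodule.range_inclusion, Submodule.mem_comap, hWW]
      exact ⟨fun h => h.1, fun h => ⟨h, x.2⟩⟩
    · rw [hq', hq₀]
      rfl

/-- The Weil index of the form induced on `I^⊥`, for `I` isotropic. -/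
theorem HasWeilTheory.weilIndex_of_range {q : LinearMap.BilinForm F A}
    {q' : LinearMap.BilinForm F B} (hq : q.IsSymm) (I : Submodule F A)
    (hI : ∀ x ∈ I, ∀ y ∈ I, q x y = 0) (f : B →ₗ[F] A)
    (hf : ∀ x, x ∈ LinearMap.range f ↔ ∀ y ∈ I, q y x = 0)
    (hq' : ∀ x y, q' x y = q (f x) (f y)) : weilIndex ψ q' = weilIndex ψ q := by
  obtain ⟨s, rfl⟩ : I.FG := IsNoetherian.noetherian I
  obtain ⟨q₀, hq₀⟩ : ∃ q₀ : LinearMap.BilinForm F (LinearMap.range f), ∀ x y, q₀ x y = q x y :=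
    ⟨q.compl₁₂ (LinearMap.range f).subtype (LinearMap.range f).subtype, fun _ _ => rfl⟩
  rw [← hW.weilIndex_orthogonal_finset hq s (fun x hx y hy =>
    hI x (Submodule.subset_span hx) y (Submodule.subset_span hy)) (LinearMap.range f) (fun x => ?_)
    q₀ hq₀]
  · exact hW.weilIndex_comp ⟨fun x y => by rw [hq₀, hq₀]; exact hq.eq _ _⟩ f.rangeRestrict
      f.surjective_rangeRestrict fun x y => by rw [hq', hq₀]; rfl
  · rw [hf]
    refine ⟨fun h y hy => h y (Submodule.subset_span hy), fun h y hy => ?_⟩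
    induction hy using Submodule.span_induction with
    | mem y hy => exact h y hy
    | zero => simp
    | add a b _ _ ha hb => simp [ha, hb]
    | smul c a _ ha => simp [ha]

end Witt

/-! ### The square of the Weil index in terms of rank and discriminant. -/

section Discriminant

variable {F : Type*} [Field F] [TopologicalSpace F]
  {ψ : AddChar F Circle}

/-- A nonzero sum of two squares. -/
def IsSumTwoSq (x : F) : Prop := x ≠ 0 ∧ ∃ c d, x = c ^ 2 + d ^ 2

theorem IsSumTwoSq.mul {x y : F} (hx : IsSumTwoSq x) (hy : IsSumTwoSq y) : IsSumTwoSq (x * y) := by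
  obtain ⟨hx, a, b, rfl⟩ := hx
  obtain ⟨hy, c, d, rfl⟩ := hy
  exact ⟨mul_ne_zero hx hy, a * c - b * d, a * d + b * c, by ring⟩

theorem isSumTwoSq_sq {c : F} (hc : c ≠ 0) : IsSumTwoSq (c ^ 2) :=
  ⟨pow_ne_zero 2 hc, c, 0, by ring⟩

/-- The square of the ratio of the Weil indices of `a` and `1`. -/
def scalarRatio (ψ : AddChar F Circle) (a : F) : ℂ :=
  (weilIndexScalar ψ a / weilIndexScalar ψ 1) ^ 2

/-- Arithmetic input: the nonzero sums of two squares have index at most two, and `γ(1)` is an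
eighth root of unity. -/
structure HasNormTheory (ψ : AddChar F Circle) : Prop where
  index_le_two : ∃ b : F, b ≠ 0 ∧ ∀ a, a ≠ 0 → IsSumTwoSq a ∨ IsSumTwoSq (a * b)
  scalar_one_pow : weilIndexScalar ψ (1 : F) ^ 8 = 1

theorem toBilin_isSymm {κ : Type*} [Fintype κ] [DecidableEq κ] {G : Matrix κ κ F}
    (hG : G.IsSymm) : LinearMap.BilinForm.IsSymm (Matrix.toBilin' G) := ⟨fun x y => by
  rw [Matrix.toBilin'_apply', Matrix.toBilin'_apply', Matrix.dotProduct_mulVec,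
    ← Matrix.mulVec_transpose, hG.eq, dotProduct_comm]⟩

variable [IsTopologicalRing F] [LocallyCompactSpace F] [SecondCountableTopology F] [T2Space F]
  (hW : HasWeilTheory ψ) (hN : HasNormTheory ψ)
  {A : Type*} [AddCommGroup A] [Module F A] [FiniteDimensional F A]

include hW

/-- If h = c² + d² with `c`, `d` non-zero, then ⟨ac²⟩ ⊕ ⟨ad²⟩ is, up to squares, both two copies of
⟨a⟩ and two copies of ⟨ah⟩. -/
theorem HasWeilTheory.scalar_sq_mul {a h : F} (hh : IsSumTwoSq h) :
    weilIndexScalar ψ (a * h) ^ 2 = weilIndexScalar ψ a ^ 2 := by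
  obtain ⟨h0, c, d, rfl⟩ := hh
  by_cases ha : a = 0
  · simp [ha]
  by_cases hc : c = 0
  · have hd : d ≠ 0 := by rintro rfl; simp [hc] at h0
    rw [hc, zero_pow (by norm_num : (2 : ℕ) ≠ 0), zero_add, hW.scalar_mul_sq _ hd]
  by_cases hd : d = 0
  · rw [hd, zero_pow (by norm_num : (2 : ℕ) ≠ 0), add_zero, hW.scalar_mul_sq _ hc]
  have h1 := hW.scalar_mul_scalar (a := a * c ^ 2) (b := a * d ^ 2)
    (by rw [← mul_add]; exact mul_ne_zero ha h0)
  rw [hW.scalar_mul_sq _ hc, hW.scalar_mul_sq _ hd,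
    show a * c ^ 2 * (a * d ^ 2) * (a * c ^ 2 + a * d ^ 2) = a * (c ^ 2 + d ^ 2) * (a * c * d) ^ 2
      by ring, hW.scalar_mul_sq _ (by simp [ha, hc, hd]), ← mul_add] at h1
  rw [sq (weilIndexScalar ψ _), sq (weilIndexScalar ψ _), h1]

theorem HasWeilTheory.scalarRatio_mul_sumTwoSq {a h : F} (hh : IsSumTwoSq h) :
    scalarRatio ψ (a * h) = scalarRatio ψ a := by
  rw [scalarRatio, scalarRatio, div_pow, div_pow, hW.scalar_sq_mul hh]

theorem HasWeilTheory.scalarRatio_one : scalarRatio ψ (1 : F) = 1 := by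
  rw [scalarRatio, div_self (hW.scalar_ne_zero one_ne_zero), one_pow]

theorem HasWeilTheory.scalarRatio_sumTwoSq {h : F} (hh : IsSumTwoSq h) :
    scalarRatio ψ h = 1 := by
  rw [← one_mul h, hW.scalarRatio_mul_sumTwoSq hh, hW.scalarRatio_one]

theorem HasWeilTheory.scalar_sq_eq (a : F) :
    weilIndexScalar ψ a ^ 2 = weilIndexScalar ψ 1 ^ 2 * scalarRatio ψ a := by
  have := hW.scalar_ne_zero (one_ne_zero (α := F))
  rw [scalarRatio]
  field_simp

include hN

/-- If -1 is a sum of two squares, then γ(b)² = γ(-b)² and γ(b) γ(-b) = 1 give γ(b)⁴ = 1 for all b ≠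
0. Otherwise -1 represents the only other class, and γ(-1) = γ(1)⁻¹ with γ(1)⁸ = 1 settles it. -/
theorem HasWeilTheory.scalarRatio_sq {a : F} (ha : a ≠ 0) : scalarRatio ψ a ^ 2 = 1 := by
  have h1 := hW.scalar_ne_zero (one_ne_zero (α := F))
  have h2 := hW.scalar_mul_neg (one_ne_zero (α := F))
  by_cases hm : IsSumTwoSq (-1 : F)
  · have key : ∀ b : F, b ≠ 0 → weilIndexScalar ψ b ^ 4 = 1 := fun b hb => by
      have h3 := hW.scalar_mul_neg hb
      have h4 := hW.scalar_sq_mul (a := b) hm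
      rw [mul_neg_one] at h4
      calc weilIndexScalar ψ b ^ 4 = weilIndexScalar ψ b ^ 2 * weilIndexScalar ψ b ^ 2 := by ring
        _ = (weilIndexScalar ψ b * weilIndexScalar ψ (-b)) ^ 2 := by rw [mul_pow, h4]
        _ = 1 := by rw [h3, one_pow]
    rw [scalarRatio, ← pow_mul, div_pow, key a ha, key 1 one_ne_zero, div_one]
  · obtain ⟨b, hb, hab⟩ := hN.index_le_two
    have hb1 : IsSumTwoSq (-1 * b) := (hab (-1) (by simp)).resolve_left hm
    rcases hab a ha with h | h
    · rw [hW.scalarRatio_sumTwoSq h, one_pow]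
    · have h3 : scalarRatio ψ a = scalarRatio ψ (-1) := by
        rw [← hW.scalarRatio_mul_sumTwoSq (a := a) (isSumTwoSq_sq hb),
          ← hW.scalarRatio_mul_sumTwoSq (a := -1) (h.mul hb1)]
        congr 1
        ring
      rw [h3, scalarRatio, ← pow_mul, div_pow, div_eq_one_iff_eq (pow_ne_zero _ h1)]
      have h5 : weilIndexScalar ψ (1 : F) ^ 4 * weilIndexScalar ψ (-1 : F) ^ 4 = 1 := by
        rw [← mul_pow, h2, one_pow]
      have h8 := hN.scalar_one_pow
      have : weilIndexScalar ψ (1 : F) ^ 4 * weilIndexScalar ψ (1 : F) ^ 4 = 1 := by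
        rw [← pow_add]; exact h8
      exact mul_left_cancel₀ (pow_ne_zero 4 h1) (h5.trans this.symm)

theorem HasWeilTheory.scalarRatio_ne_zero {a : F} (ha : a ≠ 0) : scalarRatio ψ a ≠ 0 := by
  intro h
  have := hW.scalarRatio_sq hN ha
  simp [h] at this

/-- The ratio depends only on the class modulo sums of two squares. There are at most two classes,
and a function on a group of order at most two with value 1 at the identity and ±1 elsewhere is a
character. -/
theorem HasWeilTheory.scalarRatio_mul {a b : F} (ha : a ≠ 0) (hb : b ≠ 0) :
    scalarRatio ψ (a * b) = scalarRatio ψ a * scalarRatio ψ b := by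
  obtain ⟨e, he, hab⟩ := hN.index_le_two
  rcases hab a ha with h | h
  · rw [hW.scalarRatio_sumTwoSq h, one_mul, mul_comm, hW.scalarRatio_mul_sumTwoSq h]
  rcases hab b hb with h' | h'
  · rw [hW.scalarRatio_sumTwoSq h', mul_one, hW.scalarRatio_mul_sumTwoSq h']
  have key : ∀ c : F, IsSumTwoSq (c * e) → scalarRatio ψ c = scalarRatio ψ e := fun c hc => by
    rw [← hW.scalarRatio_mul_sumTwoSq (a := c) (isSumTwoSq_sq he),
      ← hW.scalarRatio_mul_sumTwoSq (a := e) hc]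
    congr 1
    ring
  rw [key a h, key b h', ← sq, hW.scalarRatio_sq hN he,
    ← hW.scalarRatio_mul_sumTwoSq (isSumTwoSq_sq he),
    show a * b * e ^ 2 = a * e * (b * e) by ring, hW.scalarRatio_sumTwoSq (h.mul h')]

theorem HasWeilTheory.scalarRatio_mul_square {a c : F} (hc : c ≠ 0) :
    scalarRatio ψ (a * (c * c)) = scalarRatio ψ a := by
  rw [← sq]
  exact hW.scalarRatio_mul_sumTwoSq (isSumTwoSq_sq hc)

theorem HasWeilTheory.scalarRatio_prod {ι : Type*} (s : Finset ι) (a : ι → F)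
    (ha : ∀ i ∈ s, a i ≠ 0) : scalarRatio ψ (∏ i ∈ s, a i) = ∏ i ∈ s, scalarRatio ψ (a i) := by
  classical
  induction s using Finset.induction_on with
  | empty => simp [hW.scalarRatio_one]
  | insert i s hi ih =>
    rw [Finset.prod_insert hi, Finset.prod_insert hi, hW.scalarRatio_mul hN
      (ha i (Finset.mem_insert_self _ _))
      (Finset.prod_ne_zero_iff.2 fun j hj => ha j (Finset.mem_insert_of_mem hj)),
      ih fun j hj => ha j (Finset.mem_insert_of_mem hj)]

/-- The square of the Weil index in terms of rank and discriminant. -/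
theorem HasWeilTheory.weilIndex_sq_toBilin {κ : Type*} [Fintype κ] [DecidableEq κ]
    {G : Matrix κ κ F} (hG : G.IsSymm) (hd : G.det ≠ 0) :
    weilIndex ψ (Matrix.toBilin' G) ^ 2 =
      weilIndexScalar ψ 1 ^ (2 * Fintype.card κ) * scalarRatio ψ G.det := by
  have hs : LinearMap.BilinForm.IsSymm (Matrix.toBilin' G) := toBilin_isSymm hG
  obtain ⟨n, p, a, hp, ha, h⟩ := exists_diagForm hW.two_ne_zero hs
  have hn : (Matrix.toBilin' G).Nondegenerate :=
    LinearMap.BilinForm.nondegenerate_toBilin'_of_det_ne_zero' G hd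
  have hpi : Function.Injective p := by
    rw [← LinearMap.ker_eq_bot, LinearMap.ker_eq_bot']
    intro x hx
    refine hn.1 _ fun y => ?_
    rw [h, hx]
    simp
  have hcard : Fintype.card κ = n := by
    have := (LinearEquiv.ofBijective p ⟨hpi, hp⟩).finrank_eq
    simpa using this
  obtain ⟨e⟩ : Nonempty (κ ≃ Fin n) := ⟨Fintype.equivFinOfCardEq hcard⟩
  -- The matrix of `p`: it exhibits `G` as Pᵀ diag(a) P, so det G is the product of the a_i up to a
  -- non-zero square.
  let P : Matrix κ κ F := Matrix.of fun i j => p (Pi.single j 1) (e i)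
  have hGP : G = P.transpose * Matrix.diagonal (a ∘ e) * P := by
    ext i j
    have h1 := h (Pi.single i 1) (Pi.single j 1)
    rw [Matrix.toBilin'_single, diagForm_apply, ← e.sum_comp] at h1
    rw [h1, Matrix.mul_apply]
    refine Finset.sum_congr rfl fun k _ => ?_
    rw [Matrix.mul_diagonal, Matrix.transpose_apply]
    simp only [P, Matrix.of_apply, Function.comp]
    ring
  have hdet : G.det = (∏ i, a i) * (P.det * P.det) := by
    conv_lhs => rw [hGP, Matrix.det_mul, Matrix.det_mul, Matrix.det_transpose, Matrix.det_diagonal]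
    rw [← e.prod_comp a]
    simp only [Function.comp]
    ring
  have hP : P.det ≠ 0 := by
    intro h0
    rw [hdet, h0] at hd
    simp at hd
  rw [hW.weilIndex_comp (diagForm_isSymm a) p hp h, hW.weilIndex_diagForm, hdet,
    hW.scalarRatio_mul_square hN hP, hW.scalarRatio_prod hN _ _ (fun i _ => ha i), hcard,
    ← Finset.prod_pow]
  rw [Finset.prod_congr rfl fun i _ => hW.scalar_sq_eq (a i), Finset.prod_mul_distrib,
    Finset.prod_const, Finset.card_univ, Fintype.card_fin, pow_mul]

/-- The basis vectors indexed by `s` lie in the radical, so the form is pulled back from its Gram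
matrix on the other coordinates. -/
theorem HasWeilTheory.weilIndex_sq_basis {ι : Type*} [Fintype ι] [DecidableEq ι]
    {q : LinearMap.BilinForm F A} (hq : q.IsSymm) (c : Module.Basis ι F A) (s : Finset ι)
    (hs : ∀ i ∈ s, ∀ x, q (c i) x = 0)
    (hd : (Matrix.of fun i j : {i // i ∉ s} => q (c i) (c j)).det ≠ 0) :
    weilIndex ψ q ^ 2 = weilIndexScalar ψ 1 ^ (2 * Fintype.card {i // i ∉ s}) *
      scalarRatio ψ (Matrix.of fun i j : {i // i ∉ s} => q (c i) (c j)).det := by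
  set G := Matrix.of fun i j : {i // i ∉ s} => q (c i) (c j) with hGdef
  have hG : G.IsSymm := by
    ext i j
    exact hq.eq _ _
  rw [← hW.weilIndex_sq_toBilin hN hG hd]
  congr 1
  let p : A →ₗ[F] ({i // i ∉ s} → F) := LinearMap.pi fun i => c.coord i
  have hGs : LinearMap.BilinForm.IsSymm (Matrix.toBilin' G) := toBilin_isSymm hG
  refine hW.weilIndex_comp hGs p (fun y => ?_) fun x y => ?_
  · refine ⟨∑ i, y i • c i, ?_⟩
    ext j
    simp only [p, LinearMap.pi_apply, map_sum, map_smul, Module.Basis.coord_apply,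
      Module.Basis.repr_self, smul_eq_mul]
    rw [Finset.sum_eq_single j]
    · simp
    · intro i _ hij
      have : i.1 ≠ j.1 := fun h => hij (Subtype.ext h)
      simp [this]
    · simp
  · have hz : ∀ f : ι → F, (∀ i ∈ s, f i = 0) → ∑ i, f i = ∑ i : {i // i ∉ s}, f i := fun f hf => by
      rw [← Finset.sum_filter_add_sum_filter_not Finset.univ (fun i => i ∉ s)]
      rw [Finset.sum_subtype (p := fun i => i ∉ s) _ (by simp), add_eq_left]
      exact Finset.sum_eq_zero fun i hi => hf i (by simpa using hi)
    rw [Matrix.toBilin'_apply]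
    conv_lhs => rw [← c.sum_repr x, ← c.sum_repr y]
    simp only [map_sum, LinearMap.sum_apply, map_smul, LinearMap.smul_apply, smul_eq_mul]
    rw [hz, Finset.sum_comm]
    · refine Finset.sum_congr rfl fun j _ => ?_
      rw [hz, Finset.mul_sum]
      · refine Finset.sum_congr rfl fun i _ => ?_
        simp only [p, LinearMap.pi_apply, Module.Basis.coord_apply, G, Matrix.of_apply]
        ring
      · intro i hi
        rw [hs i hi, mul_zero]
    · intro i hi
      rw [Finset.sum_eq_zero, mul_zero]
      intro j _
      rw [hq.eq, hs i hi, mul_zero]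

end Discriminant

/-! ### Maslov forms of three and four subspaces. -/

section MaslovForm

variable {F : Type*} [Field F] {V : Type*} [AddCommGroup V] [Module F V]
  {ω : LinearMap.BilinForm F V}

/-- The form vanishes on the subspace. -/
def IsIsotropic (ω : LinearMap.BilinForm F V) (l : Submodule F V) : Prop :=
  ∀ x ∈ l, ∀ y ∈ l, ω x y = 0

theorem IsLagrangian.mem_iff {l : Submodule F V} (h : IsLagrangian ω l) {x : V} :
    x ∈ l ↔ ∀ y ∈ l, ω y x = 0 := by
  conv_lhs => rw [← h]
  rfl

theorem IsLagrangian.isIsotropic {l : Submodule F V} (h : IsLagrangian ω l) : IsIsotropic ω l :=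
  fun x hx _ hy => h.mem_iff.1 hy x hx

/-- (a + c)^⊥ = a^⊥ ∩ c^⊥ = a ∩ c, and ⊥ is an involution on subspaces. -/
theorem IsLagrangian.sup_eq [FiniteDimensional F V] {a c : Submodule F V} (ha : IsLagrangian ω a)
    (halt : ω.IsAlt) (hω : ω.Nondegenerate) (hc : IsLagrangian ω c) :
    a ⊔ c = ω.orthogonal (a ⊓ c) := by
  rw [← ω.orthogonal_orthogonal hω (halt.isRefl) (a ⊔ c)]
  congr 1
  ext z
  rw [Submodule.mem_inf, ha.mem_iff, hc.mem_iff, LinearMap.BilinForm.mem_orthogonal_iff]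
  constructor
  · intro hz
    exact ⟨fun y hy => hz y (Submodule.mem_sup_left hy),
      fun y hy => hz y (Submodule.mem_sup_right hy)⟩
  · rintro ⟨hz1, hz2⟩ y hy
    obtain ⟨y1, hy1, y2, hy2, rfl⟩ := Submodule.mem_sup.1 hy
    change ω (y1 + y2) z = 0
    rw [map_add, LinearMap.add_apply, hz1 _ hy1, hz2 _ hy2, add_zero]

theorem maslovForm_apply {n : ℕ} (l : Fin n → Submodule F V) (v w : maslovSpace l) :
    maslovForm ω l v w = ∑ i : Fin n, ∑ j ∈ Finset.Iio i, ω (v.1 i) (w.1 j) := by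
  simp [maslovForm, LinearMap.sum_apply]

theorem mem_maslovSpace {n : ℕ} {l : Fin n → Submodule F V} {v : Fin n → V} :
    v ∈ maslovSpace l ↔ (∀ i, v i ∈ l i) ∧ ∑ i, v i = 0 := Iff.rfl

theorem mem_maslovSpace_three {a b c : Submodule F V} {v : Fin 3 → V} :
    v ∈ maslovSpace ![a, b, c] ↔ v 0 ∈ a ∧ v 1 ∈ b ∧ v 2 ∈ c ∧ v 0 + v 1 + v 2 = 0 := by
  rw [mem_maslovSpace, Fin.forall_fin_succ, Fin.forall_fin_succ, Fin.forall_fin_succ,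
    Fin.sum_univ_three]
  simp [and_assoc]

theorem mem_maslovSpace_four {a b c d : Submodule F V} {v : Fin 4 → V} :
    v ∈ maslovSpace ![a, b, c, d] ↔
      v 0 ∈ a ∧ v 1 ∈ b ∧ v 2 ∈ c ∧ v 3 ∈ d ∧ v 0 + v 1 + v 2 + v 3 = 0 := by
  rw [mem_maslovSpace, Fin.forall_fin_succ, Fin.forall_fin_succ, Fin.forall_fin_succ,
    Fin.forall_fin_succ, Fin.sum_univ_four]
  simp [and_assoc]

/-- Because the components of `w` add up to 0, the terms with i = 2 sum to -ω(v₂, w₂), which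
vanishes on `c`. -/
theorem maslovForm_three {a b c : Submodule F V} (hc : IsIsotropic ω c)
    (v w : maslovSpace ![a, b, c]) : maslovForm ω ![a, b, c] v w = ω (v.1 1) (w.1 0) := by
  obtain ⟨-, -, hv, -⟩ := mem_maslovSpace_three.1 v.2
  obtain ⟨-, -, hw, hw'⟩ := mem_maslovSpace_three.1 w.2
  have h1 : w.1 0 + w.1 1 = -w.1 2 := eq_neg_of_add_eq_zero_left hw'
  have h2 : ω (v.1 2) (w.1 0) + ω (v.1 2) (w.1 1) = 0 := by
    rw [← map_add, h1, map_neg, hc _ hv _ hw, neg_zero]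
  rw [maslovForm_apply, Fin.sum_univ_three,
    show Finset.Iio (0 : Fin 3) = ∅ by decide, show Finset.Iio (1 : Fin 3) = {0} by decide,
    show Finset.Iio (2 : Fin 3) = {0, 1} by decide, Finset.sum_pair (by decide), h2]
  simp

theorem maslovForm_four {a b c d : Submodule F V} (hd : IsIsotropic ω d)
    (v w : maslovSpace ![a, b, c, d]) : maslovForm ω ![a, b, c, d] v w =
      ω (v.1 1) (w.1 0) + (ω (v.1 2) (w.1 0) + ω (v.1 2) (w.1 1)) := by
  obtain ⟨-, -, -, hv, -⟩ := mem_maslovSpace_four.1 v.2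
  obtain ⟨-, -, -, hw, hw'⟩ := mem_maslovSpace_four.1 w.2
  have h1 : w.1 0 + w.1 1 + w.1 2 = -w.1 3 := eq_neg_of_add_eq_zero_left hw'
  have h2 : ω (v.1 3) (w.1 0) + (ω (v.1 3) (w.1 1) + ω (v.1 3) (w.1 2)) = 0 := by
    rw [← map_add, ← map_add, ← add_assoc, h1, map_neg, hd _ hv _ hw, neg_zero]
  rw [maslovForm_apply, Fin.sum_univ_four,
    show Finset.Iio (0 : Fin 4) = ∅ by decide, show Finset.Iio (1 : Fin 4) = {0} by decide,
    show Finset.Iio (2 : Fin 4) = {0, 1} by decide,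
    show Finset.Iio (3 : Fin 4) = {0, 1, 2} by decide, Finset.sum_pair (by decide),
    Finset.sum_insert (by decide), Finset.sum_pair (by decide), h2]
  simp

/-- Expand ω(v₂, w₂) = 0 with v₂ = -v₀ - v₁ and w₂ = -w₀ - w₁; isotropy of `a` and `b` leaves only
the two mixed terms. -/
theorem maslovForm_three_isSymm (hω : ω.IsAlt) {a b c : Submodule F V} (ha : IsIsotropic ω a)
    (hb : IsIsotropic ω b) (hc : IsIsotropic ω c) : (maslovForm ω ![a, b, c]).IsSymm := by
  refine ⟨fun v w => ?_⟩
  rw [maslovForm_three hc, maslovForm_three hc]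
  obtain ⟨hv0, hv1, hv2, hv⟩ := mem_maslovSpace_three.1 v.2
  obtain ⟨hw0, hw1, hw2, hw⟩ := mem_maslovSpace_three.1 w.2
  have h1 := hc _ hv2 _ hw2
  have h2 := ha _ hv0 _ hw0
  have h3 := hb _ hv1 _ hw1
  have h4 := hω.neg_eq (w.1 1) (v.1 0)
  rw [eq_neg_of_add_eq_zero_right hv, eq_neg_of_add_eq_zero_right hw] at h1
  simp only [map_neg, map_add, LinearMap.add_apply, LinearMap.neg_apply] at h1
  linear_combination h1 - h2 - h3 + h4

theorem maslovForm_four_isSymm (hω : ω.IsAlt) {a b c d : Submodule F V} (ha : IsIsotropic ω a)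
    (hb : IsIsotropic ω b) (hc : IsIsotropic ω c) (hd : IsIsotropic ω d) :
    (maslovForm ω ![a, b, c, d]).IsSymm := by
  refine ⟨fun v w => ?_⟩
  rw [maslovForm_four hd, maslovForm_four hd]
  obtain ⟨hv0, hv1, hv2, hv3, hv⟩ := mem_maslovSpace_four.1 v.2
  obtain ⟨hw0, hw1, hw2, hw3, hw⟩ := mem_maslovSpace_four.1 w.2
  have h1 := hd _ hv3 _ hw3
  have h2 := ha _ hv0 _ hw0
  have h3 := hb _ hv1 _ hw1
  have h4 := hc _ hv2 _ hw2
  have h5 := hω.neg_eq (w.1 1) (v.1 0)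
  have h6 := hω.neg_eq (w.1 2) (v.1 0)
  have h7 := hω.neg_eq (w.1 2) (v.1 1)
  rw [eq_neg_of_add_eq_zero_right hv, eq_neg_of_add_eq_zero_right hw] at h1
  simp only [map_neg, map_add, LinearMap.add_apply, LinearMap.neg_apply] at h1
  linear_combination h1 - h2 - h3 - h4 + h5 + h6 + h7

end MaslovForm

/-! ### Symmetries and additivity of the Maslov index. -/

section Maslov

variable {F : Type*} [Field F] [TopologicalSpace F]
  [IsTopologicalRing F] [LocallyCompactSpace F] [SecondCountableTopology F] [T2Space F]
  {ψ : AddChar F Circle} (hW : HasWeilTheory ψ)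
  {V : Type*} [AddCommGroup V] [Module F V] [FiniteDimensional F V]
  {ω : LinearMap.BilinForm F V} (halt : ω.IsAlt)

include hW halt

/-- Two triples of isotropic subspaces related by an isometry of the Maslov forms. -/
theorem HasWeilTheory.maslovWeil_three_ne_zero {a b c : Submodule F V}
    (ha : IsIsotropic ω a) (hb : IsIsotropic ω b) (hc : IsIsotropic ω c) :
    maslovWeil ψ ω ![a, b, c] ≠ 0 :=
  hW.weilIndex_ne_zero (maslovForm_three_isSymm halt ha hb hc)

theorem HasWeilTheory.maslovWeil_rotate {a b c : Submodule F V}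
    (ha : IsIsotropic ω a) (hb : IsIsotropic ω b) (hc : IsIsotropic ω c) :
    maslovWeil ψ ω ![b, c, a] = maslovWeil ψ ω ![a, b, c] := by
  refine hW.weilIndex_comp (maslovForm_three_isSymm halt ha hb hc)
    ((LinearMap.funLeft F V ![2, 0, 1] ∘ₗ Submodule.subtype _).codRestrict _ fun v => ?_)
    (fun v => ?_) fun v w => ?_
  · obtain ⟨h0, h1, h2, h⟩ := mem_maslovSpace_three.1 v.2
    refine mem_maslovSpace_three.2 ⟨h2, h0, h1, ?_⟩
    change v.1 2 + v.1 0 + v.1 1 = 0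
    rw [← h]
    abel
  · obtain ⟨h0, h1, h2, h⟩ := mem_maslovSpace_three.1 v.2
    refine ⟨⟨![v.1 1, v.1 2, v.1 0], mem_maslovSpace_three.2 ⟨h1, h2, h0, ?_⟩⟩, ?_⟩
    · change v.1 1 + v.1 2 + v.1 0 = 0
      rw [← h]
      abel
    · ext i
      fin_cases i <;> rfl
  · rw [maslovForm_three ha, maslovForm_three hc]
    change _ = ω (v.1 0) (w.1 2)
    obtain ⟨hv0, hv1, hv2, hv⟩ := mem_maslovSpace_three.1 v.2
    obtain ⟨hw0, hw1, hw2, hw⟩ := mem_maslovSpace_three.1 w.2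
    have h2 := hb _ hv0 _ hw0
    have h4 := halt.neg_eq (w.1 1) (v.1 0)
    have h5 := (maslovForm_three_isSymm halt hb hc ha).eq v w
    rw [maslovForm_three ha, maslovForm_three ha] at h5
    rw [eq_neg_of_add_eq_zero_right hw]
    simp only [map_neg, map_add]
    linear_combination h5 + h2 - h4

theorem HasWeilTheory.maslovWeil_mul_reverse {a b c : Submodule F V}
    (ha : IsIsotropic ω a) (hb : IsIsotropic ω b) (hc : IsIsotropic ω c) :
    maslovWeil ψ ω ![a, b, c] * maslovWeil ψ ω ![c, b, a] = 1 := by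
  have hs := maslovForm_three_isSymm halt ha hb hc
  have h1 : maslovWeil ψ ω ![c, b, a] = weilIndex ψ (-maslovForm ω ![a, b, c]) := by
    refine hW.weilIndex_comp ⟨fun x y => by simp [hs.eq x y]⟩
      ((LinearMap.funLeft F V ![2, 1, 0] ∘ₗ Submodule.subtype _).codRestrict _ fun v => ?_)
      (fun v => ?_) fun v w => ?_
    · obtain ⟨h0, h1, h2, h⟩ := mem_maslovSpace_three.1 v.2
      refine mem_maslovSpace_three.2 ⟨h2, h1, h0, ?_⟩
      change v.1 2 + v.1 1 + v.1 0 = 0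
      rw [← h]
      abel
    · obtain ⟨h0, h1, h2, h⟩ := mem_maslovSpace_three.1 v.2
      refine ⟨⟨![v.1 2, v.1 1, v.1 0], mem_maslovSpace_three.2 ⟨h2, h1, h0, ?_⟩⟩, ?_⟩
      · change v.1 2 + v.1 1 + v.1 0 = 0
        rw [← h]
        abel
      · ext i
        fin_cases i <;> rfl
    · rw [maslovForm_three ha, LinearMap.neg_apply, LinearMap.neg_apply, maslovForm_three hc]
      change _ = -ω (v.1 1) (w.1 2)
      obtain ⟨hv0, hv1, hv2, hv⟩ := mem_maslovSpace_three.1 v.2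
      obtain ⟨hw0, hw1, hw2, hw⟩ := mem_maslovSpace_three.1 w.2
      have h2 := hb _ hv1 _ hw1
      rw [eq_neg_of_add_eq_zero_right hw]
      simp only [map_neg, map_add]
      linear_combination -h2
  rw [h1]
  exact hW.weilIndex_mul_weilIndex_neg hs fun _ _ => rfl

omit halt in
theorem HasWeilTheory.maslovWeil_eq_one {a b c : Submodule F V} (hc : IsIsotropic ω c)
    (h : ∀ x ∈ a, ∀ y ∈ b, x + y ∈ c → ∀ x' ∈ a, ∀ y' ∈ b, x' + y' ∈ c → ω y x' = 0) :
    maslovWeil ψ ω ![a, b, c] = 1 := by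
  have : maslovForm ω ![a, b, c] = 0 := by
    refine LinearMap.ext fun v => LinearMap.ext fun w => ?_
    rw [maslovForm_three hc]
    obtain ⟨hv0, hv1, hv2, hv⟩ := mem_maslovSpace_three.1 v.2
    obtain ⟨hw0, hw1, hw2, hw⟩ := mem_maslovSpace_three.1 w.2
    refine h _ hv0 _ hv1 ?_ _ hw0 _ hw1 ?_
    · rw [eq_neg_of_add_eq_zero_left hv]
      exact c.neg_mem hv2
    · rw [eq_neg_of_add_eq_zero_left hw]
      exact c.neg_mem hw2
  rw [maslovWeil, this, hW.weilIndex_zero]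

theorem HasWeilTheory.maslovWeil_four_rotate {a b c d : Submodule F V}
    (ha : IsIsotropic ω a) (hb : IsIsotropic ω b) (hc : IsIsotropic ω c) (hd : IsIsotropic ω d) :
    maslovWeil ψ ω ![b, c, d, a] = maslovWeil ψ ω ![a, b, c, d] := by
  refine hW.weilIndex_comp (maslovForm_four_isSymm halt ha hb hc hd)
    ((LinearMap.funLeft F V ![3, 0, 1, 2] ∘ₗ Submodule.subtype _).codRestrict _ fun v => ?_)
    (fun v => ?_) fun v w => ?_
  · obtain ⟨h0, h1, h2, h3, h⟩ := mem_maslovSpace_four.1 v.2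
    refine mem_maslovSpace_four.2 ⟨h3, h0, h1, h2, ?_⟩
    change v.1 3 + v.1 0 + v.1 1 + v.1 2 = 0
    rw [← h]
    abel
  · obtain ⟨h0, h1, h2, h3, h⟩ := mem_maslovSpace_four.1 v.2
    refine ⟨⟨![v.1 1, v.1 2, v.1 3, v.1 0], mem_maslovSpace_four.2 ⟨h1, h2, h3, h0, ?_⟩⟩, ?_⟩
    · change v.1 1 + v.1 2 + v.1 3 + v.1 0 = 0
      rw [← h]
      abel
    · ext i
      fin_cases i <;> rfl
  · rw [maslovForm_four ha, maslovForm_four hd]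
    change _ = ω (v.1 0) (w.1 3) + (ω (v.1 1) (w.1 3) + ω (v.1 1) (w.1 0))
    obtain ⟨hv0, hv1, hv2, hv3, hv⟩ := mem_maslovSpace_four.1 v.2
    obtain ⟨hw0, hw1, hw2, hw3, hw⟩ := mem_maslovSpace_four.1 w.2
    have h2 := hb _ hv0 _ hw0
    have h3 := hc _ hv1 _ hw1
    have h5 := (maslovForm_four_isSymm halt hb hc hd ha).eq v w
    rw [maslovForm_four ha, maslovForm_four ha] at h5
    have h6 := halt.neg_eq (w.1 1) (v.1 0)
    have h7 := halt.neg_eq (w.1 2) (v.1 0)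
    have h8 := halt.neg_eq (w.1 2) (v.1 1)
    rw [eq_neg_of_add_eq_zero_right hw]
    simp only [map_neg, map_add]
    linear_combination h5 + h2 + h3 - h6 - h7 - h8

/-- Splitting a quadrilateral into two triangles. -/
theorem HasWeilTheory.maslovWeil_four (hω : ω.Nondegenerate) {a b c d : Submodule F V}
    (ha : IsLagrangian ω a) (hb : IsLagrangian ω b)
    (hc : IsLagrangian ω c) (hd : IsLagrangian ω d) :
    maslovWeil ψ ω ![a, b, c, d] = maslovWeil ψ ω ![a, b, c] * maslovWeil ψ ω ![a, c, d] := by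
  have s1 := maslovForm_three_isSymm halt ha.isIsotropic hb.isIsotropic hc.isIsotropic
  have s2 := maslovForm_three_isSymm halt ha.isIsotropic hc.isIsotropic hd.isIsotropic
  have s := maslovForm_four_isSymm halt ha.isIsotropic hb.isIsotropic hc.isIsotropic hd.isIsotropic
  rw [maslovWeil, maslovWeil, maslovWeil, ← hW.weilIndex_orthoSum s1 s2]
  let P := maslovSpace ![a, b, c] × maslovSpace ![a, c, d]
  let u : P →ₗ[F] (Fin 3 → V) := Submodule.subtype _ ∘ₗ LinearMap.fst F _ _
  let u' : P →ₗ[F] (Fin 3 → V) := Submodule.subtype _ ∘ₗ LinearMap.snd F _ _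
  -- Glue the two triangles along the diagonal by adding their `a`-components and their
  -- `c`-components.
  let f₀ : P →ₗ[F] (Fin 4 → V) :=
    LinearMap.pi ![LinearMap.proj 0 ∘ₗ u + LinearMap.proj 0 ∘ₗ u', LinearMap.proj 1 ∘ₗ u,
      LinearMap.proj 2 ∘ₗ u + LinearMap.proj 1 ∘ₗ u', LinearMap.proj 2 ∘ₗ u']
  have hf0 : ∀ x, f₀ x 0 = x.1.1 0 + x.2.1 0 := fun _ => rfl
  have hf1 : ∀ x, f₀ x 1 = x.1.1 1 := fun _ => rfl
  have hf2 : ∀ x, f₀ x 2 = x.1.1 2 + x.2.1 1 := fun _ => rfl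
  have hf3 : ∀ x, f₀ x 3 = x.2.1 2 := fun _ => rfl
  have hfm : ∀ x, f₀ x ∈ maslovSpace ![a, b, c, d] := fun x => by
    obtain ⟨hv0, hv1, hv2, hv⟩ := mem_maslovSpace_three.1 x.1.2
    obtain ⟨hw0, hw1, hw2, hw⟩ := mem_maslovSpace_three.1 x.2.2
    refine mem_maslovSpace_four.2 ⟨?_, ?_, ?_, ?_, ?_⟩
    · exact hf0 x ▸ a.add_mem hv0 hw0
    · exact hf1 x ▸ hv1
    · exact hf2 x ▸ c.add_mem hv2 hw1
    · exact hf3 x ▸ hw2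
    · rw [hf0, hf1, hf2, hf3]
      refine Eq.trans ?_ ((congrArg₂ (· + ·) hv hw).trans (add_zero 0))
      abel
  let f := f₀.codRestrict _ hfm
  have hf : ∀ x, (f x).1 = f₀ x := fun _ => rfl
  -- `I` consists of the vectors (z, 0, -z, 0) with z in a ∩ c. It is isotropic, and the image of
  -- `f` is exactly its orthogonal.
  let I : Submodule F (maslovSpace ![a, b, c, d]) :=
    { carrier := {v | v.1 1 = 0 ∧ v.1 3 = 0}
      add_mem' := fun {v w} hv hw => ⟨by
        change v.1 1 + w.1 1 = 0
        rw [hv.1, hw.1, add_zero], by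
        change v.1 3 + w.1 3 = 0
        rw [hv.2, hw.2, add_zero]⟩
      zero_mem' := ⟨rfl, rfl⟩
      smul_mem' := fun t v hv => ⟨by
        change t • v.1 1 = 0
        rw [hv.1, smul_zero], by
        change t • v.1 3 = 0
        rw [hv.2, smul_zero]⟩ }
  have hImem : ∀ v : maslovSpace ![a, b, c, d], v ∈ I ↔ v.1 1 = 0 ∧ v.1 3 = 0 := fun _ => Iff.rfl
  have hIform : ∀ v ∈ I, ∀ w, maslovForm ω ![a, b, c, d] v w = -ω (v.1 0) (w.1 1) := by
    intro v hv w
    obtain ⟨h1, h3⟩ := (hImem v).1 hv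
    obtain ⟨hv0, hv1, hv2, hv3, hv⟩ := mem_maslovSpace_four.1 v.2
    obtain ⟨hw0, hw1, hw2, hw3, hw⟩ := mem_maslovSpace_four.1 w.2
    rw [h1, h3, add_zero, add_zero] at hv
    have h20 : v.1 2 = -v.1 0 := eq_neg_of_add_eq_zero_right hv
    rw [maslovForm_four hd.isIsotropic, h1, h20]
    simp [ha.isIsotropic _ hv0 _ hw0]
  refine (hW.weilIndex_of_range s I ?_ f (fun w => ?_) fun x y => ?_).symm
  · intro v hv w hw
    rw [hIform v hv, ((hImem w).1 hw).1, map_zero, neg_zero]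
  · obtain ⟨hw0, hw1, hw2, hw3, hw⟩ := mem_maslovSpace_four.1 w.2
    constructor
    · rintro ⟨x, rfl⟩ v hv
      obtain ⟨h1, h3⟩ := (hImem v).1 hv
      obtain ⟨hx0, hx1, hx2, hx⟩ := mem_maslovSpace_three.1 x.1.2
      obtain ⟨hv0, hv1, hv2, hv3, hv'⟩ := mem_maslovSpace_four.1 v.2
      rw [h1, h3, add_zero, add_zero] at hv'
      have h20 : v.1 0 = -v.1 2 := eq_neg_of_add_eq_zero_left hv'
      rw [hIform v hv, hf, hf1]
      have h10 : x.1.1 1 = -x.1.1 0 - x.1.1 2 := by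
        rw [← add_zero (-x.1.1 0 - x.1.1 2), ← hx]
        abel
      rw [h10, map_sub, map_neg, ha.isIsotropic _ hv0 _ hx0, h20, map_neg, LinearMap.neg_apply,
        hc.isIsotropic _ hv2 _ hx2]
      simp
    · intro h
      have h1 : ∀ z ∈ a ⊓ c, ω z (w.1 1) = 0 := fun z hz => by
        have hzm : ![z, 0, -z, 0] ∈ maslovSpace ![a, b, c, d] :=
          mem_maslovSpace_four.2 ⟨hz.1, b.zero_mem, c.neg_mem hz.2, d.zero_mem, by simp⟩
        have h2 := h ⟨![z, 0, -z, 0], hzm⟩ ((hImem _).2 ⟨rfl, rfl⟩)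
        rw [hIform _ ((hImem _).2 ⟨rfl, rfl⟩)] at h2
        exact neg_eq_zero.1 h2
      -- Orthogonality to `I` says that w₁ is orthogonal to a ∩ c, that is, w₁ ∈ a + c. A
      -- decomposition of w₁ is what cuts the quadrilateral into two triangles.
      have h2 : w.1 1 ∈ a ⊔ c := by
        rw [ha.sup_eq halt hω hc]
        exact h1
      obtain ⟨y, hy, z, hz, hyz⟩ := Submodule.mem_sup.1 h2
      refine ⟨(⟨![-y, w.1 1, -z], mem_maslovSpace_three.2
        ⟨a.neg_mem hy, hw1, c.neg_mem hz, ?_⟩⟩, ⟨![w.1 0 + y, w.1 2 + z, w.1 3],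
        mem_maslovSpace_three.2 ⟨a.add_mem hw0 hy, c.add_mem hw2 hz, hw3, ?_⟩⟩), ?_⟩
      · change -y + w.1 1 + -z = 0
        rw [← hyz]
        abel
      · change w.1 0 + y + (w.1 2 + z) + w.1 3 = 0
        rw [← hw, ← hyz]
        abel
      · ext i
        rw [hf]
        fin_cases i
        · change -y + (w.1 0 + y) = w.1 0
          abel
        · rfl
        · change -z + (w.1 2 + z) = w.1 2
          abel
        · rfl
  · rw [orthoSum_apply, maslovForm_three hc.isIsotropic, maslovForm_three hd.isIsotropic,
      maslovForm_four hd.isIsotropic, hf, hf, hf0, hf1, hf1, hf2]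
    obtain ⟨hx0, hx1, hx2, hx⟩ := mem_maslovSpace_three.1 x.1.2
    obtain ⟨hx0', hx1', hx2', hx'⟩ := mem_maslovSpace_three.1 x.2.2
    obtain ⟨hy0, hy1, hy2, hy⟩ := mem_maslovSpace_three.1 y.1.2
    obtain ⟨hy0', hy1', hy2', hy'⟩ := mem_maslovSpace_three.1 y.2.2
    have e1 : x.1.1 1 = -x.1.1 0 - x.1.1 2 := by
      rw [← add_zero (-x.1.1 0 - x.1.1 2), ← hx]
      abel
    have e2 : y.1.1 1 = -y.1.1 0 - y.1.1 2 := by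
      rw [← add_zero (-y.1.1 0 - y.1.1 2), ← hy]
      abel
    have i1 := ha.isIsotropic _ hx0 _ hy0'
    have i2 := hc.isIsotropic _ hx2 _ hy2
    have i3 := hc.isIsotropic _ hx1' _ hy2
    rw [e1, e2]
    simp only [map_add, map_sub, map_neg, LinearMap.add_apply, LinearMap.sub_apply,
      LinearMap.neg_apply]
    linear_combination i1 + i2 + i3

end Maslov

/-! ### Common complements of Lagrangian subspaces. -/

section Lagrangian

variable {F : Type*} [Field F] {V : Type*} [AddCommGroup V] [Module F V]
  {ω : LinearMap.BilinForm F V}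

/-- If `v` lies in `c` only and `w` lies outside `c`, then w, w + v and w - v all avoid `c`, while
`a` and `b` contain at most one of them each. The three points are distinct because 2 ≠ 0. -/
theorem exists_notMem_three (h2 : (2 : F) ≠ 0) {a b c : Submodule F V} (ha : a ≠ ⊤) (hb : b ≠ ⊤)
    (hc : c ≠ ⊤) : ∃ v, v ∉ a ∧ v ∉ b ∧ v ∉ c := by
  have hex : ∀ {a : Submodule F V}, a ≠ ⊤ → ∃ v, v ∉ a := fun h => by
    by_contra! h'
    exact h (Submodule.eq_top_iff'.2 h')
  obtain ⟨v, hva, hvb⟩ : ∃ v, v ∉ a ∧ v ∉ b := by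
    obtain ⟨x, hx⟩ := hex ha
    obtain ⟨y, hy⟩ := hex hb
    by_cases hxb : x ∈ b
    · by_cases hya : y ∈ a
      · exact ⟨x + y, fun h => hx ((a.add_mem_iff_left hya).1 h),
          fun h => hy ((b.add_mem_iff_right hxb).1 h)⟩
      · exact ⟨y, hya, hy⟩
    · exact ⟨x, hx, hxb⟩
  by_cases hvc : v ∈ c
  · obtain ⟨w, hw⟩ := hex hc
    have hwc : ∀ t : F, w + t • v ∉ c := fun t h => hw ((c.add_mem_iff_left (c.smul_mem t hvc)).1 h)
    have key : ∀ {p : Submodule F V}, v ∉ p → ∀ {s t : F}, s ≠ t → w + s • v ∈ p →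
        w + t • v ∉ p := fun {p} hp s t hst h h' => by
      have h3 := p.sub_mem h h'
      rw [add_sub_add_left_eq_sub, ← sub_smul] at h3
      exact hp ((p.smul_mem_iff (sub_ne_zero.2 hst)).1 h3)
    have h10 : (0 : F) ≠ 1 := zero_ne_one
    have h20 : (0 : F) ≠ -1 := by simp
    have h12 : (1 : F) ≠ -1 := fun h => h2 (by linear_combination h)
    by_contra! hall
    have hor : ∀ t : F, w + t • v ∈ a ∨ w + t • v ∈ b := fun t => by
      by_contra! h
      exact hwc t (hall _ h.1 h.2)
    rcases hor 0 with h0 | h0 <;> rcases hor 1 with h1 | h1 <;> rcases hor (-1) with h3 | h3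
    · exact key hva h10 h0 h1
    · exact key hva h10 h0 h1
    · exact key hva h20 h0 h3
    · exact key hvb h12 h1 h3
    · exact key hva h12 h1 h3
    · exact key hvb h20 h0 h3
    · exact key hvb h10 h0 h1
    · exact key hvb h10 h0 h1
  · exact ⟨v, hva, hvb, hvc⟩

variable [FiniteDimensional F V]

/-- Three Lagrangian subspaces have a common Lagrangian complement. -/
theorem exists_transversal (h2 : (2 : F) ≠ 0) (halt : ω.IsAlt) (hω : ω.Nondegenerate)
    {a b c : Submodule F V} (ha : IsIsotropic ω a) (hb : IsIsotropic ω b) (hc : IsIsotropic ω c) :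
    ∃ k, IsLagrangian ω k ∧ Disjoint a k ∧ Disjoint b k ∧ Disjoint c k := by
  -- Take `k` maximal among isotropic subspaces disjoint from the three. If k ≠ k^⊥, the three
  -- subspaces induce isotropic, hence proper, subspaces of the symplectic space k^⊥/k, and `k` can
  -- be enlarged by a vector of k^⊥ that avoids all of them.
  let S : Set (Submodule F V) :=
    {k | IsIsotropic ω k ∧ Disjoint a k ∧ Disjoint b k ∧ Disjoint c k}
  obtain ⟨k, ⟨hk, hka, hkb, hkc⟩, hmax⟩ := (wellFounded_gt (α := Submodule F V)).has_min S
    ⟨⊥, fun x hx y _ => by simp [(Submodule.mem_bot F).1 hx], disjoint_bot_right,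
      disjoint_bot_right, disjoint_bot_right⟩
  refine ⟨k, ?_, hka, hkb, hkc⟩
  by_contra hkl
  have hle : k ≤ ω.orthogonal k := fun x hx y hy => hk y hy x hx
  have hmem : ∀ x, x ∈ ω.orthogonal k ↔ ∀ y ∈ k, ω y x = 0 := fun _ => Iff.rfl
  have hnot : ¬ IsIsotropic ω (ω.orthogonal k) := fun h => hkl <| by
    refine le_antisymm ?_ hle
    conv_rhs => rw [← ω.orthogonal_orthogonal hω halt.isRefl k]
    exact fun x hx y hy => h y hy x hx
  have hprop : ∀ l, IsIsotropic ω l →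
      ((l ⊓ ω.orthogonal k) ⊔ k).comap (ω.orthogonal k).subtype ≠ ⊤ := fun l hl htop => by
    have h1 : ω.orthogonal k ≤ (l ⊓ ω.orthogonal k) ⊔ k := by
      rwa [Submodule.comap_subtype_eq_top] at htop
    refine hnot fun x hx y hy => ?_
    obtain ⟨x1, hx1, x2, hx2, rfl⟩ := Submodule.mem_sup.1 (h1 hx)
    obtain ⟨y1, hy1, y2, hy2, rfl⟩ := Submodule.mem_sup.1 (h1 hy)
    have e1 := hl _ hx1.1 _ hy1.1
    have e2 := (hmem _).1 hy1.2 _ hx2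
    have e3 := (hmem _).1 hx1.2 _ hy2
    have e4 := hk _ hx2 _ hy2
    have e5 := halt.neg_eq y2 x1
    simp only [map_add, LinearMap.add_apply]
    linear_combination e1 + e2 - e3 + e4 - e5
  obtain ⟨v, hva, hvb, hvc⟩ := exists_notMem_three h2 (hprop a ha) (hprop b hb) (hprop c hc)
  have hvk : (v : V) ∉ k := fun h => hva (Submodule.mem_sup_right h)
  have hdisj : ∀ l, Disjoint l k →
      v ∉ ((l ⊓ ω.orthogonal k) ⊔ k).comap (ω.orthogonal k).subtype →
      Disjoint l (k ⊔ Submodule.span F {(v : V)}) := by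
    intro l hlk hvl
    rw [Submodule.disjoint_def]
    intro x hx hx'
    obtain ⟨y, hy, z, hz, rfl⟩ := Submodule.mem_sup.1 hx'
    obtain ⟨t, rfl⟩ := Submodule.mem_span_singleton.1 hz
    by_cases ht : t = 0
    · rw [ht, zero_smul, add_zero] at hx ⊢
      exact Submodule.disjoint_def.1 hlk _ hx hy
    · exfalso
      apply hvl
      have h3 : t • (v : V) ∈ (l ⊓ ω.orthogonal k) ⊔ k := by
        have : t • (v : V) = (y + t • (v : V)) - y := by abel
        rw [this]
        exact Submodule.sub_mem _ (Submodule.mem_sup_left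
          ⟨hx, Submodule.add_mem _ (hle hy) (Submodule.smul_mem _ _ v.2)⟩)
          (Submodule.mem_sup_right hy)
      exact (Submodule.smul_mem_iff _ ht).1 h3
  refine hmax (k ⊔ Submodule.span F {(v : V)}) ⟨?_, hdisj a hka hva, hdisj b hkb hvb,
    hdisj c hkc hvc⟩ ?_
  · intro x hx y hy
    obtain ⟨x1, hx1, x2, hx2, rfl⟩ := Submodule.mem_sup.1 hx
    obtain ⟨y1, hy1, y2, hy2, rfl⟩ := Submodule.mem_sup.1 hy
    obtain ⟨t, rfl⟩ := Submodule.mem_span_singleton.1 hx2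
    obtain ⟨t', rfl⟩ := Submodule.mem_span_singleton.1 hy2
    have e1 := hk _ hx1 _ hy1
    have e2 := (hmem _).1 v.2 _ hx1
    have e3 := (hmem _).1 v.2 _ hy1
    have e4 := halt v
    have e5 := halt.neg_eq y1 v
    simp only [map_add, LinearMap.add_apply, map_smul, LinearMap.smul_apply, smul_eq_mul]
    linear_combination e1 + t' * e2 - t * e3 - t * e5 + t * t' * e4
  · refine lt_of_le_of_ne le_sup_left fun h => hvk ?_
    exact h.ge (Submodule.mem_sup_right (Submodule.mem_span_singleton_self _))

theorem IsLagrangian.isCompl (halt : ω.IsAlt) (hω : ω.Nondegenerate) {a k : Submodule F V}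
    (ha : IsLagrangian ω a) (hk : IsLagrangian ω k) (h : Disjoint a k) : IsCompl a k := by
  refine ⟨h, codisjoint_iff.2 ?_⟩
  rw [ha.sup_eq halt hω hk, h.eq_bot, LinearMap.BilinForm.orthogonal_bot]

theorem IsLagrangian.finrank (hω : ω.Nondegenerate) {a : Submodule F V}
    (ha : IsLagrangian ω a) : 2 * Module.finrank F a = Module.finrank F V := by
  have h := LinearMap.BilinForm.finrank_orthogonal hω a
  rw [ha] at h
  have := a.finrank_le
  omega

end Lagrangian

/-! ### The action of Sp(V) on subspaces. -/

section Act

variable {F : Type*} [Field F] {V : Type*} [AddCommGroup V] [Module F V]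
  {ω : LinearMap.BilinForm F V}

theorem mem_act {g : Sp ω} {l : Submodule F V} {x : V} : x ∈ act g l ↔ g.1.symm x ∈ l := by
  constructor
  · rintro ⟨y, hy, rfl⟩
    simpa using hy
  · intro h
    exact ⟨_, h, by simp⟩

theorem Sp.symm_form (g : Sp ω) (x y : V) : ω (g.1.symm x) (g.1.symm y) = ω x y := by
  rw [← g.2, LinearEquiv.apply_symm_apply, LinearEquiv.apply_symm_apply]

theorem act_mul (g h : Sp ω) (l : Submodule F V) : act (g * h) l = act g (act h l) := by
  ext x
  rw [mem_act, mem_act, mem_act]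
  rfl

theorem IsLagrangian.act {l : Submodule F V} (h : IsLagrangian ω l) (g : Sp ω) :
    IsLagrangian ω (act g l) := by
  ext x
  rw [mem_act, h.mem_iff, LinearMap.BilinForm.mem_orthogonal_iff]
  constructor
  · intro hx y hy
    rw [← g.2, LinearEquiv.apply_symm_apply]
    exact hx _ ⟨y, hy, rfl⟩
  · rintro hx _ ⟨y, hy, rfl⟩
    have := hx y hy
    rw [← g.2, LinearEquiv.apply_symm_apply] at this
    exact this

theorem disjoint_act {a b : Submodule F V} (g : Sp ω) (h : Disjoint a b) :
    Disjoint (act g a) (act g b) := by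
  rw [Submodule.disjoint_def] at h ⊢
  intro x hx hx'
  exact (LinearEquiv.map_eq_zero_iff _).1 (h _ (mem_act.1 hx) (mem_act.1 hx'))

end Act

/-! ### The Maslov cocycle as a coboundary. -/

section MaslovIndex

variable {F : Type*} [Field F] [TopologicalSpace F]
  [IsTopologicalRing F] [LocallyCompactSpace F] [SecondCountableTopology F] [T2Space F]
  {ψ : AddChar F Circle} (hW : HasWeilTheory ψ)
  {V : Type*} [AddCommGroup V] [Module F V] [FiniteDimensional F V]
  {ω : LinearMap.BilinForm F V} (halt : ω.IsAlt)

include hW halt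

theorem HasWeilTheory.maslovWeil_act {a b c : Submodule F V}
    (ha : IsIsotropic ω a) (hb : IsIsotropic ω b) (hc : IsIsotropic ω c) (g : Sp ω)
    (hgc : IsIsotropic ω (act g c)) :
    maslovWeil ψ ω ![act g a, act g b, act g c] = maslovWeil ψ ω ![a, b, c] := by
  refine hW.weilIndex_comp (maslovForm_three_isSymm halt ha hb hc)
    ((LinearMap.compLeft (g.1.symm : V →ₗ[F] V) (Fin 3) ∘ₗ Submodule.subtype _).codRestrict _
    fun v => ?_) (fun v => ?_) fun v w => ?_
  · obtain ⟨h0, h1, h2, h⟩ := mem_maslovSpace_three.1 v.2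
    refine mem_maslovSpace_three.2 ⟨mem_act.1 h0, mem_act.1 h1, mem_act.1 h2, ?_⟩
    change g.1.symm _ + g.1.symm _ + g.1.symm _ = 0
    rw [← map_add, ← map_add]
    exact (congrArg g.1.symm h).trans (map_zero _)
  · obtain ⟨h0, h1, h2, h⟩ := mem_maslovSpace_three.1 v.2
    refine ⟨⟨fun i => g.1 (v.1 i), mem_maslovSpace_three.2 ⟨⟨_, h0, rfl⟩, ⟨_, h1, rfl⟩,
      ⟨_, h2, rfl⟩, ?_⟩⟩, ?_⟩
    · rw [← map_add, ← map_add, h, map_zero]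
    · ext i
      exact g.1.symm_apply_apply _
  · rw [maslovForm_three hgc, maslovForm_three hc]
    exact (Sp.symm_form g _ _).symm

variable (hω : ω.Nondegenerate)
include hω

/-- The two diagonals of a quadrilateral give the same value, by cyclic invariance. -/
theorem HasWeilTheory.maslovWeil_cocycle {a b c d : Submodule F V}
    (ha : IsLagrangian ω a) (hb : IsLagrangian ω b)
    (hc : IsLagrangian ω c) (hd : IsLagrangian ω d) :
    maslovWeil ψ ω ![a, b, c] * maslovWeil ψ ω ![a, c, d] =
      maslovWeil ψ ω ![b, c, d] * maslovWeil ψ ω ![b, d, a] := by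
  rw [← hW.maslovWeil_four halt hω ha hb hc hd, ← hW.maslovWeil_four halt hω hb hc hd ha,
    hW.maslovWeil_four_rotate halt ha.isIsotropic hb.isIsotropic hc.isIsotropic hd.isIsotropic]

/-- The Maslov cocycle is a coboundary. -/
theorem HasWeilTheory.maslovWeil_three_eq {o a b c : Submodule F V}
    (ho : IsLagrangian ω o) (ha : IsLagrangian ω a) (hb : IsLagrangian ω b)
    (hc : IsLagrangian ω c) :
    maslovWeil ψ ω ![a, b, c] =
      maslovWeil ψ ω ![o, a, b] * maslovWeil ψ ω ![o, b, c] * maslovWeil ψ ω ![o, c, a] := by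
  have h1 := hW.maslovWeil_cocycle halt hω ho ha hb hc
  have h2 := hW.maslovWeil_rotate halt ho.isIsotropic ha.isIsotropic hc.isIsotropic
  have h3 := hW.maslovWeil_mul_reverse halt ho.isIsotropic ha.isIsotropic hc.isIsotropic
  have h4 := hW.maslovWeil_rotate halt ho.isIsotropic hc.isIsotropic ha.isIsotropic
  rw [h4] at h3
  rw [h2] at h1
  rw [h1, mul_assoc, h3, mul_one]

theorem HasWeilTheory.maslovWeil_swap {o a b : Submodule F V}
    (ho : IsLagrangian ω o) (ha : IsLagrangian ω a) (hb : IsLagrangian ω b) :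
    maslovWeil ψ ω ![o, a, b] * maslovWeil ψ ω ![o, b, a] = 1 := by
  rw [← hW.maslovWeil_mul_reverse halt ho.isIsotropic ha.isIsotropic hb.isIsotropic,
    hW.maslovWeil_rotate halt ho.isIsotropic hb.isIsotropic ha.isIsotropic]

end MaslovIndex

/-! ### Oriented discriminants computed along a common complement. -/

section OrientedDisc

variable {F : Type*} [Field F] {V : Type*} [AddCommGroup V] [Module F V] [FiniteDimensional F V]
  {ω : LinearMap.BilinForm F V} {a b k : Submodule F V}

/-- To be used for both Lagrangians with the same `bw` and `e`, so that the two bases share a basis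
of the intersection. -/
theorem exists_adapted_basis {ι : Type*} [Fintype ι] [DecidableEq ι] {d m : ℕ} {w : Submodule F V}
    (bw : Module.Basis (Fin d) F w) (e : Fin d ⊕ Fin m ≃ ι) (hwa : w ≤ a)
    (hm : Module.finrank F a = d + m) :
    ∃ c : Module.Basis ι F a, ∀ i, (c (e (Sum.inl i)) : V) = bw i := by
  obtain ⟨u, hu⟩ := (w.comap a.subtype).exists_isCompl
  have e1 : w ≃ₗ[F] w.comap a.subtype := (Submodule.comapSubtypeEquivOfLe hwa).symm
  have hd : Module.finrank F (w.comap a.subtype) = d := by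
    rw [LinearEquiv.finrank_eq (Submodule.comapSubtypeEquivOfLe hwa),
      Module.finrank_eq_card_basis bw, Fintype.card_fin]
  have hum : Module.finrank F u = m := by
    have := Submodule.finrank_add_eq_of_isCompl hu
    omega
  let bu : Module.Basis (Fin m) F u := Module.finBasisOfFinrankEq F u hum
  let c := (((bw.map (Submodule.comapSubtypeEquivOfLe hwa).symm).prod bu).map
    (Submodule.prodEquivOfIsCompl _ _ hu)).reindex e
  refine ⟨c, fun i => ?_⟩
  simp only [c, Module.Basis.reindex_apply, Equiv.symm_apply_apply, Module.Basis.map_apply,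
    Submodule.coe_prodEquivOfIsCompl']
  simp

theorem exists_isOrientedDisc {ι : Type*} [Fintype ι] [DecidableEq ι] (b₁ : Module.Basis ι F a)
    (b₂ : Module.Basis ι F b) : ∃ d, IsOrientedDisc ω b₁ b₂ d := by
  obtain ⟨m, hm⟩ : ∃ m, Fintype.card ι = Module.finrank F ↥(a ⊓ b) + m := by
    have := Submodule.finrank_mono (inf_le_left : a ⊓ b ≤ a)
    rw [Module.finrank_eq_card_basis b₁] at this
    exact ⟨_, (Nat.add_sub_cancel' this).symm⟩
  obtain ⟨e⟩ : Nonempty (Fin (Module.finrank F ↥(a ⊓ b)) ⊕ Fin m ≃ ι) := by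
    refine Fintype.card_eq.1 ?_
    simp [hm]
  let bw := Module.finBasis F ↥(a ⊓ b)
  obtain ⟨c₁, hc₁⟩ := exists_adapted_basis bw e inf_le_left
    (by rw [Module.finrank_eq_card_basis b₁, hm])
  obtain ⟨c₂, hc₂⟩ := exists_adapted_basis bw e inf_le_right
    (by rw [Module.finrank_eq_card_basis b₂, hm])
  refine ⟨_, Finset.univ.image (e ∘ Sum.inl), c₁, c₂, ?_, ?_, rfl⟩
  · simp only [Finset.mem_image, Finset.mem_univ, true_and]
    rintro _ ⟨i, rfl⟩
    exact (hc₁ i).trans (hc₂ i).symm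
  · rw [Finset.coe_image, Finset.coe_univ, Set.image_univ, ← Set.range_comp]
    have : (fun i => (c₁ i : V)) ∘ e ∘ Sum.inl = (a ⊓ b).subtype ∘ bw := funext fun i => hc₁ i
    rw [this, Set.range_comp, Submodule.span_image, bw.span_eq, Submodule.map_subtype_top]

/-- The form `(x, y) ↦ ω(x, π y)` for a linear map `π : a → b`. -/
def alongForm (ω : LinearMap.BilinForm F V) (π : a →ₗ[F] b) : LinearMap.BilinForm F a :=
  ω.compl₁₂ a.subtype (b.subtype ∘ₗ π)

@[simp] theorem alongForm_apply (π : a →ₗ[F] b) (x y : a) :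
    alongForm ω π x y = ω x (π y) := rfl

/-- Expand ω(x - πx, y - πy) = 0 on the isotropic `k`. -/
theorem alongForm_isSymm (halt : ω.IsAlt) (ha : IsIsotropic ω a) (hb : IsIsotropic ω b)
    (hk : IsIsotropic ω k) {π : a →ₗ[F] b} (hπ : ∀ x : a, (x : V) - π x ∈ k) :
    (alongForm ω π).IsSymm := ⟨fun x y => by
  have h1 := hk _ (hπ x) _ (hπ y)
  have h2 := ha _ x.2 _ y.2
  have h3 := hb _ (π x).2 _ (π y).2
  have h4 := halt.neg_eq (π x : V) y
  simp only [map_sub, LinearMap.sub_apply] at h1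
  simp only [alongForm_apply]
  linear_combination -h1 + h2 + h3 + h4⟩

theorem along_eq_self (hb : Disjoint b k) {π : a →ₗ[F] b} (hπ : ∀ x : a, (x : V) - π x ∈ k) {x : a}
    {y : b} (hy : (x : V) - y ∈ k) : π x = y := by
  have h1 : (y : V) - π x ∈ k := by
    have := k.sub_mem (hπ x) hy
    rwa [sub_sub_sub_cancel_left] at this
  have := Submodule.disjoint_def.1 hb _ (y - π x).2 h1
  exact (sub_eq_zero.1 (Subtype.ext this)).symm

/-- The discriminant of two oriented Lagrangians, computed along a common complement. -/
theorem IsOrientedDisc.eq_along {ι : Type*} [Fintype ι] [DecidableEq ι]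
    (halt : ω.IsAlt) (ha : IsLagrangian ω a) (hb : IsLagrangian ω b) (hk : IsLagrangian ω k)
    (hbk : Disjoint b k) {π : a ≃ₗ[F] b} (hπ : ∀ x : a, (x : V) - π x ∈ k)
    {b₁ : Module.Basis ι F a} {b₂ : Module.Basis ι F b} {d : F} (h : IsOrientedDisc ω b₁ b₂ d) :
    ∃ (s : Finset ι) (c : Module.Basis ι F a) (t : F), t ≠ 0 ∧
      s.card = Module.finrank F ↥(a ⊓ b) ∧
      (∀ i ∈ s, ∀ x, alongForm ω (π : a →ₗ[F] b) (c i) x = 0) ∧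
      (Matrix.of fun i j : {i // i ∉ s} => alongForm ω (π : a →ₗ[F] b) (c i) (c j)).det ≠ 0 ∧
      d = b₂.det (fun i => π (b₁ i)) *
        (Matrix.of fun i j : {i // i ∉ s} => alongForm ω (π : a →ₗ[F] b) (c i) (c j)).det *
          (t * t) := by
  obtain ⟨s, c₁, c₂, hc, hspan, rfl⟩ := h
  set β := alongForm ω (π : a →ₗ[F] b) with hβdef
  have hβ : β.IsSymm := alongForm_isSymm halt ha.isIsotropic hb.isIsotropic hk.isIsotropic hπ
  have hβa : ∀ x y, β x y = ω x (π y) := fun _ _ => rfl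
  have hπs : ∀ i ∈ s, π (c₁ i) = c₂ i := fun i hi =>
    along_eq_self (π := (π : a →ₗ[F] b)) hbk hπ (by rw [hc i hi, sub_self]; exact k.zero_mem)
  have hker : ∀ i ∈ s, ∀ x, β (c₁ i) x = 0 := fun i hi x => by
    rw [hβ.eq, hβa, hπs i hi, ← hc i hi]
    exact ha.isIsotropic _ x.2 _ (c₁ i).2
  let P : Module.Basis ι F b := c₁.map π
  have hP : ∀ i, P i = π (c₁ i) := fun i => c₁.map_apply π i
  -- `T` expresses `c₂` in the basis π(c₁). As `π` fixes a ∩ b pointwise, its columns indexed by `s`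
  -- are those of the identity.
  let T := P.toMatrix c₂
  have hTs : ∀ j ∈ s, ∀ i, T i j = if i = j then 1 else 0 := fun j hj i => by
    simp only [T, Module.Basis.toMatrix_apply]
    rw [← hπs j hj, ← hP, P.repr_self, Finsupp.single_apply]
    simp only [eq_comm]
  have hTdet : T.det = (Matrix.of fun i j : {i // i ∉ s} => T i j).det := by
    rw [Matrix.twoBlockTriangular_det T (· ∈ s)]
    · have h1 : T.toSquareBlockProp (· ∈ s) = 1 := by
        ext i j
        rw [Matrix.toSquareBlockProp_def, Matrix.of_apply, hTs j j.2, Matrix.one_apply]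
        simp only [Subtype.ext_iff]
      rw [h1]
      have h2 : ∀ _ : Fintype {i // i ∈ s}, (1 : Matrix {i // i ∈ s} {i // i ∈ s} F).det = 1 :=
        fun _ => Matrix.det_one
      rw [h2, one_mul]
      rfl
    · intro i hi j hj
      rw [hTs j hj, if_neg]
      rintro rfl
      exact hi hj
  have hT0 : T.det ≠ 0 := by
    have := P.isUnit_det c₂
    rw [Module.Basis.det_apply] at this
    exact this.ne_zero
  have hMdet : (Matrix.of fun i j : {i // i ∉ s} => ω (c₁ i) (c₂ j)).det =
      (Matrix.of fun i j : {i // i ∉ s} => β (c₁ i) (c₁ j)).det * T.det := by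
    rw [hTdet, ← Matrix.det_mul]
    congr 1
    ext i j
    rw [Matrix.mul_apply, Matrix.of_apply]
    have h1 : (c₂ j : V) = ∑ l, T l j • (π (c₁ l) : V) := by
      have := P.sum_toMatrix_smul_self c₂ j
      rw [← this, Submodule.coe_sum]
      simp [T, hP]
    rw [h1, map_sum, ← Finset.sum_filter_add_sum_filter_not Finset.univ (· ∉ s),
      Finset.sum_subtype (p := (· ∉ s)) _ (by simp)]
    rw [Finset.sum_eq_zero (s := Finset.univ.filter fun x => ¬ x ∉ s), add_zero]
    · refine Finset.sum_congr rfl fun l _ => ?_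
      rw [map_smul, smul_eq_mul, mul_comm]
      rfl
    · intro l hl
      have hl : l ∈ s := by simpa using hl
      rw [map_smul, ← hβa, hβ.eq, hker l hl, smul_zero]
  -- A vector killed by this Gram matrix lies in the radical, which is a ∩ b, and hence in the span
  -- of the c₁ i with i ∈ s; but it has no such coordinates.
  have hBdet : (Matrix.of fun i j : {i // i ∉ s} => β (c₁ i) (c₁ j)).det ≠ 0 := by
    intro h0
    obtain ⟨v, hv, hv0⟩ := Matrix.exists_mulVec_eq_zero_iff.2 h0
    let x : a := ∑ i : {i // i ∉ s}, v i • c₁ i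
    have hx1 : ∀ j, β (c₁ j) x = 0 := fun j => by
      by_cases hj : j ∈ s
      · exact hker j hj x
      · have := congrFun hv0 ⟨j, hj⟩
        rw [Matrix.mulVec, dotProduct] at this
        simp only [x, map_sum, map_smul, smul_eq_mul]
        rw [← Pi.zero_apply (M := fun _ => F) (⟨j, hj⟩ : {i // i ∉ s}), ← this]
        exact Finset.sum_congr rfl fun i _ => mul_comm _ _
    have hx2 : ∀ y, β y x = 0 := fun y => by
      conv_lhs => rw [← c₁.sum_repr y]
      simp only [map_sum, LinearMap.sum_apply, map_smul, LinearMap.smul_apply, hx1, smul_zero,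
        Finset.sum_const_zero]
    have hxb : (x : V) ∈ b := hb.mem_iff.2 fun y hy => by
      have := hx2 (π.symm ⟨y, hy⟩)
      rw [hβ.eq, hβa, LinearEquiv.apply_symm_apply] at this
      rw [← halt.neg_eq]
      exact neg_eq_zero.2 this
    have hxs : (x : V) ∈ Submodule.span F ((fun i => (c₁ i : V)) '' (s : Set ι)) := by
      rw [hspan]
      exact ⟨x.2, hxb⟩
    have hxs' : x ∈ Submodule.span F (c₁ '' (s : Set ι)) := by
      have h2 : (fun i => (c₁ i : V)) '' (s : Set ι) = a.subtype '' (c₁ '' (s : Set ι)) := by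
        rw [Set.image_image]
        rfl
      rw [h2, Submodule.span_image] at hxs
      obtain ⟨y, hy, hyx⟩ := hxs
      rwa [← Subtype.ext hyx]
    rw [Module.Basis.mem_span_image] at hxs'
    obtain ⟨i, hi⟩ := Function.ne_iff.1 hv
    have hxi : c₁.repr x i = v i := by
      simp only [x, map_sum, map_smul, Finsupp.coe_finsetSum, Finset.sum_apply,
        Module.Basis.repr_self, Finsupp.smul_apply, smul_eq_mul]
      rw [Finset.sum_eq_single i]
      · simp
      · intro j _ hj
        have : j.1 ≠ i.1 := fun h => hj (Subtype.ext h)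
        simp [this]
      · simp
    have : (i : ι) ∈ (s : Set ι) := hxs' (Finsupp.mem_support_iff.2 (by rw [hxi]; exact hi))
    exact i.2 this
  -- With this, `b₁.det c₁` and `T.det` both enter the discriminant twice, which produces the square
  -- t·t.
  have hdet : b₂.det c₂ = b₂.det (fun i => π (b₁ i)) * b₁.det c₁ * T.det := by
    have e1 : b₁.toMatrix c₁ = (b₁.map π).toMatrix P := by
      ext i j
      simp [Module.Basis.toMatrix_apply, hP]
    have e2 : (fun i => π (b₁ i)) = (b₁.map π : ι → b) := funext fun i => (b₁.map_apply π i).symm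
    rw [Module.Basis.det_apply, Module.Basis.det_apply, Module.Basis.det_apply, e1, e2,
      ← Matrix.det_mul, ← Matrix.det_mul, Module.Basis.toMatrix_mul_toMatrix,
      Module.Basis.toMatrix_mul_toMatrix]
  refine ⟨s, c₁, b₁.det c₁ * T.det, mul_ne_zero (b₁.isUnit_det c₁).ne_zero hT0, ?_, hker,
    hBdet, ?_⟩
  · rw [← hspan]
    have hli : LinearIndependent F (fun i => (c₁ i : V)) :=
      c₁.linearIndependent.map' a.subtype (Submodule.ker_subtype a)
    have h3 := finrank_span_eq_card (hli.comp ((↑) : s → ι) Subtype.val_injective)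
    rw [Set.image_eq_range]
    rw [Fintype.card_coe] at h3
    exact h3.symm
  · rw [hMdet, hdet]
    ring

end OrientedDisc

/-! ### The square of m(l₁, l₂). -/

section MIndex

variable {F : Type*} [Field F] [TopologicalSpace F]
  [IsTopologicalRing F] [LocallyCompactSpace F] [SecondCountableTopology F] [T2Space F]
  {ψ : AddChar F Circle} (hW : HasWeilTheory ψ) (hN : HasNormTheory ψ)
  {V : Type*} [AddCommGroup V] [Module F V] [FiniteDimensional F V]
  {ω : LinearMap.BilinForm F V} (halt : ω.IsAlt) (hω : ω.Nondegenerate)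
  {a b c k : Submodule F V}

/-- The isomorphism between two complements of the same subspace. -/
def alongEquiv (ha : IsCompl a k) (hb : IsCompl b k) : a ≃ₗ[F] b :=
  (Submodule.quotientEquivOfIsCompl k a ha.symm).symm.trans
    (Submodule.quotientEquivOfIsCompl k b hb.symm)

theorem sub_alongEquiv_mem (ha : IsCompl a k) (hb : IsCompl b k) (x : a) :
    (x : V) - alongEquiv ha hb x ∈ k := by
  have h1 : (Submodule.quotientEquivOfIsCompl k b hb.symm).symm (alongEquiv ha hb x) =
      (Submodule.quotientEquivOfIsCompl k a ha.symm).symm x :=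
    LinearEquiv.symm_apply_apply (Submodule.quotientEquivOfIsCompl k b hb.symm) _
  rw [Submodule.quotientEquivOfIsCompl_symm_apply, Submodule.quotientEquivOfIsCompl_symm_apply] at h1
  exact (Submodule.Quotient.eq k).1 h1.symm

include hW halt

/-- Disjointness of `b` and `k` forces every element of the Maslov space to be (x, -πx, πx - x), so
this space is a copy of `a`. -/
theorem HasWeilTheory.maslovWeil_eq_along (ha : IsIsotropic ω a) (hb : IsIsotropic ω b)
    (hk : IsIsotropic ω k) (hbk : Disjoint b k) {π : a ≃ₗ[F] b}
    (hπ : ∀ x : a, (x : V) - π x ∈ k) :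
    maslovWeil ψ ω ![a, b, k] = weilIndex ψ (alongForm ω (π : a →ₗ[F] b)) := by
  have hβ : (alongForm ω (π : a →ₗ[F] b)).IsSymm := alongForm_isSymm halt ha hb hk hπ
  let p : maslovSpace ![a, b, k] →ₗ[F] a :=
    (LinearMap.proj 0 ∘ₗ Submodule.subtype _).codRestrict a fun v =>
      (mem_maslovSpace_three.1 v.2).1
  have hp : ∀ v, (p v : V) = v.1 0 := fun _ => rfl
  have hv1 : ∀ v : maslovSpace ![a, b, k], v.1 1 = -(π (p v) : V) := fun v => by
    obtain ⟨h0, h1, h2, h⟩ := mem_maslovSpace_three.1 v.2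
    have := along_eq_self (π := (π : a →ₗ[F] b)) hbk hπ (x := p v) (y := -⟨v.1 1, h1⟩) (by
      rw [hp, Submodule.coe_neg, sub_neg_eq_add, eq_neg_of_add_eq_zero_left h]
      exact k.neg_mem h2)
    rw [LinearEquiv.coe_coe] at this
    rw [this]
    simp
  refine hW.weilIndex_comp hβ p (fun x => ?_) fun v w => ?_
  · refine ⟨⟨![x, -(π x : V), π x - x], mem_maslovSpace_three.2 ⟨x.2, b.neg_mem (π x).2, ?_, ?_⟩⟩,
      rfl⟩
    · change (π x : V) - x ∈ k
      rw [← neg_sub]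
      exact k.neg_mem (hπ x)
    · change (x : V) + -(π x : V) + ((π x : V) - x) = 0
      abel
  · rw [maslovForm_three hk, hv1, hβ.eq, alongForm_apply, hp, map_neg, LinearMap.neg_apply,
      halt.neg_eq]
    rfl

include hN hω

/-- The square of `m(l₁, l₂)` computed along a common complement. -/
theorem HasWeilTheory.mIndex_sq {ι : Type*} [Fintype ι] [DecidableEq ι]
    (ha : IsLagrangian ω a) (hb : IsLagrangian ω b) (hk : IsLagrangian ω k)
    (hbk : Disjoint b k) {π : a ≃ₗ[F] b} (hπ : ∀ x : a, (x : V) - π x ∈ k)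
    (b₁ : Module.Basis ι F a) (b₂ : Module.Basis ι F b) :
    mIndex ψ ω b₁ b₂ ^ 2 =
      scalarRatio ψ (b₂.det fun i => π (b₁ i)) * maslovWeil ψ ω ![a, b, k] ^ 2 := by
  have hd : IsOrientedDisc ω b₁ b₂ (orientedDisc ω b₁ b₂) :=
    Classical.epsilon_spec (exists_isOrientedDisc b₁ b₂)
  obtain ⟨s, c, t, ht, hs, hker, hdet, hd⟩ := hd.eq_along halt ha hb hk hbk hπ
  have hβ := alongForm_isSymm halt ha.isIsotropic hb.isIsotropic hk.isIsotropic hπ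
  have h0 : b₂.det (fun i => π (b₁ i)) ≠ 0 := by
    have : (fun i => π (b₁ i)) = (b₁.map π : ι → b) := funext fun i => (b₁.map_apply π i).symm
    rw [this]
    exact (b₂.isUnit_det _).ne_zero
  have hg := hW.scalar_ne_zero (one_ne_zero (α := F))
  rw [hW.maslovWeil_eq_along halt ha.isIsotropic hb.isIsotropic hk.isIsotropic hbk hπ,
    hW.weilIndex_sq_basis hN hβ c s hker hdet, mIndex, mul_pow, hW.scalar_sq_eq, hd,
    hW.scalarRatio_mul_square hN ht, hW.scalarRatio_mul hN h0 hdet]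
  -- dim V / 2 - dim(a ∩ b) is the rank of the form. The remaining -1 in the exponent of γ(1) turns
  -- γ(O)² into `scalarRatio`.
  have hcard : ((Module.finrank F V / 2 : ℕ) : ℤ) - (Module.finrank F ↥(a ⊓ b) : ℤ) =
      (Fintype.card {i // i ∉ s} : ℤ) := by
    have h1 := ha.finrank hω
    rw [Module.finrank_eq_card_basis b₁] at h1
    have h2 : Fintype.card {i // i ∉ s} + s.card = Fintype.card ι := by
      rw [Fintype.card_subtype_compl (· ∈ s), Fintype.card_coe]
      exact Nat.sub_add_cancel (Finset.card_le_univ s)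
    omega
  rw [hcard, zpow_sub₀ hg, zpow_one, zpow_natCast, div_pow, pow_mul']
  have h2 : weilIndexScalar ψ (1 : F) ^ 2 ≠ 0 := pow_ne_zero 2 hg
  field_simp

end MIndex

/-! ### The symplectic space V̄ ⊕ V. -/

section BarSum

variable {F : Type*} [Field F] {V : Type*} [AddCommGroup V] [Module F V]
  {ω : LinearMap.BilinForm F V}

theorem barSum_isAlt (halt : ω.IsAlt) : (barSum ω).IsAlt := fun x => by
  rw [barSum_apply, halt, halt, neg_zero, add_zero]

theorem barSum_nondegenerate (hω : ω.Nondegenerate) : (barSum ω).Nondegenerate := by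
  constructor
  · intro x hx
    refine Prod.ext (hω.1 _ fun y => ?_) (hω.1 _ fun y => ?_)
    · simpa [barSum_apply] using hx (y, 0)
    · simpa [barSum_apply] using hx (0, y)
  · intro x hx
    refine Prod.ext (hω.2 _ fun y => ?_) (hω.2 _ fun y => ?_)
    · simpa [barSum_apply] using hx (y, 0)
    · simpa [barSum_apply] using hx (0, y)

theorem act_inr_prod (g : Sp ω) (a b : Submodule F V) :
    act (inr ω g) (a.prod b) = a.prod (act g b) := by
  ext x
  rw [mem_act, Submodule.mem_prod, Submodule.mem_prod, mem_act]
  rfl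

theorem IsLagrangian.prod {a b : Submodule F V} (ha : IsLagrangian ω a) (hb : IsLagrangian ω b) :
    IsLagrangian (barSum ω) (a.prod b) := by
  ext ⟨x, y⟩
  rw [LinearMap.BilinForm.mem_orthogonal_iff, Submodule.mem_prod, ha.mem_iff, hb.mem_iff]
  constructor
  · intro h
    refine ⟨fun z hz => ?_, fun z hz => ?_⟩
    · simpa [barSum_apply] using h (z, 0) ⟨hz, b.zero_mem⟩
    · simpa [barSum_apply] using h (0, z) ⟨a.zero_mem, hz⟩
  · rintro ⟨h1, h2⟩ z ⟨hz1, hz2⟩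
    rw [barSum_apply, h1 _ hz1, h2 _ hz2, neg_zero, add_zero]

end BarSum

/-! ### The cocycle property of m². -/

section IsoIndex

variable {F : Type*} [Field F] [TopologicalSpace F]
  {V : Type*} [AddCommGroup V] [Module F V] [FiniteDimensional F V] {a b c k : Submodule F V}

/-- The index of an isomorphism `R : a ≃ b` of Lagrangians: `m(b, a)` for orientations that
correspond under `R`. -/
def isoIndex (ψ : AddChar F Circle) (ω : LinearMap.BilinForm F V) (R : a ≃ₗ[F] b) : ℂ :=
  mIndex ψ ω ((Module.finBasis F a).map R) (Module.finBasis F a)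

/-- The isomorphism `a ≃ g a`. -/
def actEquiv {ω : LinearMap.BilinForm F V} (g : Sp ω) (a : Submodule F V) : a ≃ₗ[F] act g a :=
  g.1.submoduleMap a

@[simp] theorem coe_actEquiv {ω : LinearMap.BilinForm F V} (g : Sp ω) (x : a) :
    (actEquiv g a x : V) = g.1 x := rfl

theorem mSelf_eq_isoIndex (ψ : AddChar F Circle) {ω : LinearMap.BilinForm F V} (g : Sp ω)
    (l : Submodule F V) : mSelf ψ g l = isoIndex ψ ω (actEquiv g l) := rfl

variable [IsTopologicalRing F] [LocallyCompactSpace F] [SecondCountableTopology F] [T2Space F]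
  {ψ : AddChar F Circle} (hW : HasWeilTheory ψ) (hN : HasNormTheory ψ)
  {ω : LinearMap.BilinForm F V} (halt : ω.IsAlt) (hω : ω.Nondegenerate)

include hW hN halt hω

/-- Replaces the orientations by the determinant of an automorphism of `a`, and determinants
multiply under composition. -/
theorem HasWeilTheory.isoIndex_sq (ha : IsLagrangian ω a) (hb : IsLagrangian ω b)
    (hk : IsLagrangian ω k) (hak : Disjoint a k) {π : b ≃ₗ[F] a}
    (hπ : ∀ x : b, (x : V) - π x ∈ k) (R : a ≃ₗ[F] b) :
    isoIndex ψ ω R ^ 2 =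
      scalarRatio ψ (LinearMap.det ((R.trans π : a ≃ₗ[F] a) : a →ₗ[F] a)) *
        maslovWeil ψ ω ![b, a, k] ^ 2 := by
  rw [isoIndex, hW.mIndex_sq hN halt hω hb ha hk hak hπ]
  have h := (Module.finBasis F a).det_comp ((R.trans π : a ≃ₗ[F] a) : a →ₗ[F] a)
    (Module.finBasis F a)
  rw [Module.Basis.det_self, mul_one] at h
  rw [← h]
  congr 4

theorem HasWeilTheory.isoIndex_ne_zero (ha : IsLagrangian ω a) (hb : IsLagrangian ω b)
    (R : a ≃ₗ[F] b) : isoIndex ψ ω R ≠ 0 := by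
  obtain ⟨k, hk, hak, hbk, -⟩ := exists_transversal hW.two_ne_zero halt hω ha.isIsotropic
    hb.isIsotropic hb.isIsotropic
  have h := hW.isoIndex_sq hN halt hω ha hb hk hak
    (sub_alongEquiv_mem (hb.isCompl halt hω hk hbk) (ha.isCompl halt hω hk hak)) R
  refine (pow_ne_zero_iff (two_ne_zero' ℕ)).1 ?_
  rw [h]
  refine mul_ne_zero (hW.scalarRatio_ne_zero hN ?_) (pow_ne_zero 2
    (hW.maslovWeil_three_ne_zero halt hb.isIsotropic ha.isIsotropic hk.isIsotropic))
  exact (LinearEquiv.isUnit_det' _).ne_zero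

/-- The square of the index of a composition. -/
theorem HasWeilTheory.isoIndex_trans_sq (ha : IsLagrangian ω a) (hb : IsLagrangian ω b)
    (hc : IsLagrangian ω c) (R : a ≃ₗ[F] b) (S : b ≃ₗ[F] c) :
    isoIndex ψ ω (R.trans S) ^ 2 =
      isoIndex ψ ω R ^ 2 * isoIndex ψ ω S ^ 2 * maslovWeil ψ ω ![a, b, c] ^ 2 := by
  -- One complement for all three Lagrangians: projections along `k` compose, so the determinants
  -- multiply, and every Maslov factor is based at `k`.
  obtain ⟨k, hk, hak, hbk, hck⟩ := exists_transversal hW.two_ne_zero halt hω ha.isIsotropic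
    hb.isIsotropic hc.isIsotropic
  have hba := sub_alongEquiv_mem (hb.isCompl halt hω hk hbk) (ha.isCompl halt hω hk hak)
  have hcb := sub_alongEquiv_mem (hc.isCompl halt hω hk hck) (hb.isCompl halt hω hk hbk)
  generalize alongEquiv (hb.isCompl halt hω hk hbk) (ha.isCompl halt hω hk hak) = p at hba
  generalize alongEquiv (hc.isCompl halt hω hk hck) (hb.isCompl halt hω hk hbk) = q at hcb
  have hca : ∀ x : c, (x : V) - (q.trans p) x ∈ k := fun x => by
    have := k.add_mem (hcb x) (hba (q x))
    rwa [sub_add_sub_cancel] at this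
  have hdet : LinearMap.det (((R.trans S).trans (q.trans p) : a ≃ₗ[F] a) : a →ₗ[F] a) =
      LinearMap.det ((R.trans p : a ≃ₗ[F] a) : a →ₗ[F] a) *
        LinearMap.det ((S.trans q : b ≃ₗ[F] b) : b →ₗ[F] b) := by
    rw [← LinearMap.det_conj ((S.trans q : b ≃ₗ[F] b) : b →ₗ[F] b) p, mul_comm,
      ← LinearMap.det_comp]
    congr 1
    ext x
    simp
  have h0 : ∀ (d : Submodule F V) (L : d ≃ₗ[F] d), LinearMap.det (L : d →ₗ[F] d) ≠ 0 :=
    fun d L => (LinearEquiv.isUnit_det' L).ne_zero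
  rw [hW.isoIndex_sq hN halt hω ha hc hk hak hca, hW.isoIndex_sq hN halt hω ha hb hk hak hba,
    hW.isoIndex_sq hN halt hω hb hc hk hbk hcb, hdet, hW.scalarRatio_mul hN (h0 _ _) (h0 _ _),
    hW.maslovWeil_three_eq halt hω hk ha hb hc,
    hW.maslovWeil_rotate halt hk.isIsotropic hc.isIsotropic ha.isIsotropic,
    hW.maslovWeil_rotate halt hk.isIsotropic hb.isIsotropic ha.isIsotropic,
    hW.maslovWeil_rotate halt hk.isIsotropic hc.isIsotropic hb.isIsotropic]
  have h1 := hW.maslovWeil_swap halt hω hk ha hb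
  have h2 := hW.maslovWeil_swap halt hω hk hb hc
  generalize maslovWeil ψ ω ![k, a, b] = x at *
  generalize maslovWeil ψ ω ![k, b, a] = y at *
  generalize maslovWeil ψ ω ![k, b, c] = z at *
  generalize maslovWeil ψ ω ![k, c, b] = w at *
  generalize maslovWeil ψ ω ![k, c, a] = u at *
  generalize scalarRatio ψ _ = r₁ at *
  generalize scalarRatio ψ _ = r₂ at *
  calc r₁ * r₂ * u ^ 2 = r₁ * r₂ * (x * y) ^ 2 * (z * w) ^ 2 * u ^ 2 := by
        rw [h1, h2, one_pow, mul_one, mul_one]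
    _ = _ := by ring

/-- Move the complement by `g` as well: the automorphism is conjugated, which keeps its determinant,
and the Maslov index is invariant. -/
theorem HasWeilTheory.isoIndex_conj_sq (ha : IsLagrangian ω a) (hb : IsLagrangian ω b)
    (R : a ≃ₗ[F] b) (g : Sp ω) (R' : act g a ≃ₗ[F] act g b)
    (hR : ∀ x : a, R' (actEquiv g a x) = actEquiv g b (R x)) :
    isoIndex ψ ω R' ^ 2 = isoIndex ψ ω R ^ 2 := by
  obtain ⟨k, hk, hak, hbk, -⟩ := exists_transversal hW.two_ne_zero halt hω ha.isIsotropic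
    hb.isIsotropic hb.isIsotropic
  have hba := sub_alongEquiv_mem (hb.isCompl halt hω hk hbk) (ha.isCompl halt hω hk hak)
  generalize alongEquiv (hb.isCompl halt hω hk hbk) (ha.isCompl halt hω hk hak) = p at hba
  let p' : act g b ≃ₗ[F] act g a :=
    (actEquiv g b).symm.trans (p.trans (actEquiv g a))
  have hp' : ∀ x : act g b, (x : V) - p' x ∈ act g k := fun x => by
    obtain ⟨y, rfl⟩ := (actEquiv g b).surjective x
    refine ⟨_, hba y, ?_⟩
    simp only [p', LinearEquiv.trans_apply, LinearEquiv.symm_apply_apply]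
    simp
  rw [hW.isoIndex_sq hN halt hω (ha.act g) (hb.act g) (hk.act g) (disjoint_act g hak) hp',
    hW.isoIndex_sq hN halt hω ha hb hk hak hba,
    hW.maslovWeil_act halt hb.isIsotropic ha.isIsotropic hk.isIsotropic g (hk.act g).isIsotropic]
  congr 2
  rw [← LinearMap.det_conj ((R.trans p : a ≃ₗ[F] a) : a →ₗ[F] a) (actEquiv g a)]
  congr 1
  refine LinearMap.ext fun x => ?_
  obtain ⟨y, rfl⟩ := (actEquiv g a).surjective x
  change p' (R' (actEquiv g a y)) =
    actEquiv g a (p (R ((actEquiv g a).symm (actEquiv g a y))))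
  rw [hR]
  simp only [p', LinearEquiv.trans_apply, LinearEquiv.symm_apply_apply]

theorem HasWeilTheory.mSelf_ne_zero (ha : IsLagrangian ω a) (g : Sp ω) : mSelf ψ g a ≠ 0 :=
  hW.isoIndex_ne_zero hN halt hω ha (ha.act g) _

/-- Factor a → gha through ga. The second leg is the conjugate by `g` of a → ha. -/
theorem HasWeilTheory.mSelf_mul_sq (ha : IsLagrangian ω a) (g h : Sp ω) :
    mSelf ψ (g * h) a ^ 2 =
      mSelf ψ g a ^ 2 * mSelf ψ h a ^ 2 *
        maslovWeil ψ ω ![a, act g a, act (g * h) a] ^ 2 := by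
  let S : act g a ≃ₗ[F] act (g * h) a := (actEquiv g a).symm.trans
    (actEquiv (g * h) a)
  have hS : (actEquiv g a).trans S = (actEquiv (g * h) a) := by
    ext x
    simp only [S, LinearEquiv.trans_apply, LinearEquiv.symm_apply_apply]
  have hS2 : isoIndex ψ ω S ^ 2 = mSelf ψ h a ^ 2 := by
    -- The target is generalised to `d` so that `act (g * h) a = act g (act h a)` can be
    -- substituted.
    have key : ∀ (d : Submodule F V) (hd : d = act g (act h a)) (T : act g a ≃ₗ[F] d),
        (∀ x : a, (T (actEquiv g a x) : V) = g.1 (h.1 x)) →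
        isoIndex ψ ω T ^ 2 = mSelf ψ h a ^ 2 := by
      rintro _ rfl T hT
      rw [mSelf_eq_isoIndex]
      exact hW.isoIndex_conj_sq hN halt hω ha (ha.act h) _ g T fun x => Subtype.ext (hT x)
    refine key _ (act_mul g h a) S fun x => ?_
    simp only [S, LinearEquiv.trans_apply, LinearEquiv.symm_apply_apply]
    rfl
  rw [mSelf_eq_isoIndex ψ (g * h), mSelf_eq_isoIndex ψ g, ← hS2,
    ← hW.isoIndex_trans_sq hN halt hω ha (ha.act g) (ha.act (g * h)), hS]

/-- For an isomorphism R : a → b, the paths a → b → gb and a → ga → gb agree when the last leg is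
the conjugate of R by `g`. Comparing their squared indices, the contributions of R and its conjugate
cancel. -/
theorem HasWeilTheory.mSelf_change_sq (ha : IsLagrangian ω a) (hb : IsLagrangian ω b)
    (g : Sp ω) :
    mSelf ψ g b ^ 2 =
      (maslovWeil ψ ω ![a, act g a, act g b, b] * mSelf ψ g a) ^ 2 := by
  obtain ⟨R⟩ : Nonempty (a ≃ₗ[F] b) := (by
    refine FiniteDimensional.nonempty_linearEquiv_of_finrank_eq ?_
    have h1 := ha.finrank hω
    have h2 := hb.finrank hω
    omega)
  let R' : act g a ≃ₗ[F] act g b :=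
    (actEquiv g a).symm.trans (R.trans (actEquiv g b))
  have h1 := hW.isoIndex_conj_sq hN halt hω ha hb R g R' (fun x => by
    change actEquiv g b (R ((actEquiv g a).symm (actEquiv g a x))) = _
    rw [LinearEquiv.symm_apply_apply])
  have h2 := hW.isoIndex_trans_sq hN halt hω ha hb (hb.act g) R (actEquiv g b)
  have h3 := hW.isoIndex_trans_sq hN halt hω ha (ha.act g) (hb.act g) (actEquiv g a) R'
  have h4 : (actEquiv g a).trans R' =
      R.trans (actEquiv g b) := by
    ext x
    simp only [R', LinearEquiv.trans_apply, LinearEquiv.symm_apply_apply]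
  rw [h4] at h3
  have h5 := pow_ne_zero 2 (hW.isoIndex_ne_zero hN halt hω ha hb R)
  have h6 := h2.symm.trans h3
  rw [h1] at h6
  have h7 := hW.maslovWeil_mul_reverse halt ha.isIsotropic hb.isIsotropic (hb.act g).isIsotropic
  have h8 := hW.maslovWeil_rotate halt ha.isIsotropic (hb.act g).isIsotropic hb.isIsotropic
  rw [h8] at h7
  rw [hW.maslovWeil_four halt hω ha (ha.act g) (hb.act g) hb, mSelf_eq_isoIndex, mSelf_eq_isoIndex]
  generalize isoIndex ψ ω (actEquiv g b) = m' at *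
  generalize isoIndex ψ ω (actEquiv g a) = m at *
  generalize maslovWeil ψ ω ![a, b, act g b] = x at *
  generalize maslovWeil ψ ω ![a, act g b, b] = y at *
  generalize maslovWeil ψ ω ![a, act g a, act g b] = z at *
  refine mul_left_cancel₀ h5 ?_
  calc _ = isoIndex ψ ω R ^ 2 * m' ^ 2 * (x * y) ^ 2 := by rw [h7, one_pow, mul_one]
    _ = (isoIndex ψ ω R ^ 2 * m' ^ 2 * x ^ 2) * y ^ 2 := by ring
    _ = _ := by rw [h6]; ring

-- The three-term form only pairs the first two subspaces. Their common first factor `a` is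
-- isotropic, so only the second coordinates count.
omit hN hω in
theorem HasWeilTheory.maslovWeil_prod {d : Submodule F V} (ha : IsIsotropic ω a)
    (hb : IsIsotropic ω b) (hc : IsIsotropic ω c) (hk : IsIsotropic ω k) (hd : IsIsotropic ω d) :
    maslovWeil ψ (barSum ω) ![a.prod b, a.prod c, d.prod k] = maslovWeil ψ ω ![b, c, k] := by
  refine hW.weilIndex_comp (maslovForm_three_isSymm halt hb hc hk)
    ((LinearMap.compLeft (LinearMap.snd F V V) (Fin 3) ∘ₗ Submodule.subtype _).codRestrict _
    fun v => ?_) (fun v => ?_) fun v w => ?_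
  · obtain ⟨h0, h1, h2, h⟩ := mem_maslovSpace_three.1 v.2
    exact mem_maslovSpace_three.2 ⟨h0.2, h1.2, h2.2, congrArg Prod.snd h⟩
  · obtain ⟨h0, h1, h2, h⟩ := mem_maslovSpace_three.1 v.2
    exact ⟨⟨fun i => (0, v.1 i), mem_maslovSpace_three.2 ⟨⟨a.zero_mem, h0⟩, ⟨a.zero_mem, h1⟩,
      ⟨d.zero_mem, h2⟩, by simp [h]⟩⟩, rfl⟩
  · have hdk : IsIsotropic (barSum ω) (d.prod k) := fun x hx y hy => by
      rw [barSum_apply, hd _ hx.1 _ hy.1, hk _ hx.2 _ hy.2, neg_zero, add_zero]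
    obtain ⟨h0, h1, h2, h⟩ := mem_maslovSpace_three.1 v.2
    obtain ⟨h0', h1', h2', h'⟩ := mem_maslovSpace_three.1 w.2
    rw [maslovForm_three hdk, maslovForm_three hk, barSum_apply,
      ha _ (Submodule.mem_prod.1 h1).1 _ (Submodule.mem_prod.1 h0').1, neg_zero, zero_add]
    rfl

/-- Along the complement k ⊕ k the automorphism of a ⊕ a is the identity on the first summand and
that of `g` on the second, so the determinant and the Maslov factor are those in V. -/
theorem HasWeilTheory.mSelf_inr_sq (ha : IsLagrangian ω a) (g : Sp ω) :
    mSelf ψ (inr ω g) (a.prod a) ^ 2 = mSelf ψ g a ^ 2 := by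
  obtain ⟨k, hk, hak, hbk, -⟩ := exists_transversal hW.two_ne_zero halt hω ha.isIsotropic
    (ha.act g).isIsotropic ha.isIsotropic
  have hba := sub_alongEquiv_mem ((ha.act g).isCompl halt hω hk hbk) (ha.isCompl halt hω hk hak)
  generalize alongEquiv ((ha.act g).isCompl halt hω hk hbk) (ha.isCompl halt hω hk hak) = p at hba
  have hB := barSum_isAlt halt
  have hB' := barSum_nondegenerate hω
  have haa := ha.prod ha
  have hkk := hk.prod hk
  have hd1 : Disjoint (a.prod a) (k.prod k) := by
    rw [Submodule.disjoint_def]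
    rintro x ⟨h1, h2⟩ ⟨h3, h4⟩
    exact Prod.ext (Submodule.disjoint_def.1 hak _ h1 h3) (Submodule.disjoint_def.1 hak _ h2 h4)
  have hd2 : Disjoint (act (inr ω g) (a.prod a)) (k.prod k) := by
    rw [act_inr_prod, Submodule.disjoint_def]
    rintro x ⟨h1, h2⟩ ⟨h3, h4⟩
    exact Prod.ext (Submodule.disjoint_def.1 hak _ h1 h3) (Submodule.disjoint_def.1 hbk _ h2 h4)
  have hq := sub_alongEquiv_mem ((haa.act (inr ω g)).isCompl hB hB' hkk hd2)
    (haa.isCompl hB hB' hkk hd1)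
  generalize alongEquiv ((haa.act (inr ω g)).isCompl hB hB' hkk hd2)
    (haa.isCompl hB hB' hkk hd1) = q at hq
  have hT : maslovWeil ψ (barSum ω) ![act (inr ω g) (a.prod a), a.prod a, k.prod k] =
      maslovWeil ψ ω ![act g a, a, k] := by
    rw [act_inr_prod]
    exact hW.maslovWeil_prod halt ha.isIsotropic (ha.act g).isIsotropic ha.isIsotropic
      hk.isIsotropic hk.isIsotropic
  rw [mSelf_eq_isoIndex, mSelf_eq_isoIndex, hW.isoIndex_sq hN halt hω ha (ha.act g) hk hak hba,
    hW.isoIndex_sq hN hB hB' haa (haa.act _) hkk hd1 hq, hT]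
  congr 2
  let E : (a × a) ≃ₗ[F] a.prod a :=
    { toFun := fun x => ⟨(x.1, x.2), x.1.2, x.2.2⟩
      invFun := fun x => (⟨x.1.1, x.2.1⟩, ⟨x.1.2, x.2.2⟩)
      map_add' := fun _ _ => rfl
      map_smul' := fun _ _ => rfl
      left_inv := fun _ => rfl
      right_inv := fun _ => rfl }
  rw [← one_mul (LinearMap.det (((actEquiv g a).trans p : a ≃ₗ[F] a) : a →ₗ[F] a)),
    ← LinearMap.det_id (M := a), ← LinearMap.det_prodMap, ← LinearMap.det_conj _ E]
  congr 1
  refine LinearMap.ext fun x => ?_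
  obtain ⟨⟨y, z⟩, rfl⟩ := E.surjective x
  refine along_eq_self (π := (q : act (inr ω g) (a.prod a) →ₗ[F] a.prod a)) hd1 hq
    (x := actEquiv (inr ω g) (a.prod a) (E (y, z))) ?_
  rw [LinearMap.comp_apply, LinearMap.comp_apply, LinearEquiv.coe_coe, LinearEquiv.coe_coe,
    LinearEquiv.symm_apply_apply, LinearMap.prodMap_apply]
  refine ⟨?_, hba (actEquiv g a z)⟩
  change (y : V) - y ∈ k
  rw [sub_self]
  exact k.zero_mem

end IsoIndex

/-! ### Transvections, and generation of Sp(V) by squares. -/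

section Transvection

variable {F : Type*} [Field F] {V : Type*} [AddCommGroup V] [Module F V]
  {ω : LinearMap.BilinForm F V} (halt : ω.IsAlt)

/-- The symplectic transvection `x ↦ x + c ω(v, x) v`. -/
def spTransvection (v : V) (c : F) : Sp ω :=
  ⟨{ toFun := fun x => x + (c * ω v x) • v
     invFun := fun x => x - (c * ω v x) • v
     map_add' := fun x y => by
       rw [map_add, mul_add, add_smul]
       abel
     map_smul' := fun r x => by
       rw [map_smul, RingHom.id_apply, smul_add, smul_smul, smul_eq_mul, mul_left_comm]
     left_inv := fun x => by simp [halt v]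
     right_inv := fun x => by simp [halt v] }, fun x y => by
    have h := halt.neg_eq v x
    simp only [LinearEquiv.coe_mk, LinearMap.coe_mk, AddHom.coe_mk, map_add, LinearMap.add_apply,
      map_smul, LinearMap.smul_apply, smul_eq_mul, halt v]
    linear_combination -c * ω v y * h⟩

@[simp] theorem spTransvection_apply (v : V) (c : F) (x : V) :
    (spTransvection halt v c).1 x = x + (c * ω v x) • v := rfl

theorem spTransvection_mul (v : V) (c d : F) :
    spTransvection halt v c * spTransvection halt v d = spTransvection halt v (c + d) := by
  ext x
  change (spTransvection halt v c).1 ((spTransvection halt v d).1 x) = _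
  simp only [spTransvection_apply, map_add, map_smul, halt v, mul_zero, zero_smul,
    add_zero, add_mul, add_smul]
  abel

/-- The fixed space of a symplectic transformation. -/
def fixedSpace (g : Sp ω) : Submodule F V := LinearMap.eqLocus (g.1 : V →ₗ[F] V) LinearMap.id

theorem mem_fixedSpace {g : Sp ω} {x : V} : x ∈ fixedSpace g ↔ g.1 x = x := Iff.rfl

include halt

/-- The transvection along u = gv - v with coefficient 1/ω(v, gv) carries gv back to `v`. It fixes
every x = gx, because ω(gv - v, x) = ω(gv, gx) - ω(v, x) = 0. -/
theorem exists_fixedSpace_lt {g : Sp ω} {v : V} (hv : ω v (g.1 v) ≠ 0) :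
    ∃ u c, fixedSpace g < fixedSpace (spTransvection halt u c * g) := by
  have hv' : ω (g.1 v) v ≠ 0 := by
    rw [← halt.neg_eq]
    exact neg_ne_zero.2 hv
  refine ⟨g.1 v - v, (ω v (g.1 v))⁻¹, lt_of_le_of_ne (fun x hx => ?_) fun h => ?_⟩
  · have hx := mem_fixedSpace.1 hx
    rw [mem_fixedSpace]
    change (spTransvection halt _ _).1 (g.1 x) = x
    rw [spTransvection_apply, hx, map_sub, LinearMap.sub_apply, ← g.2 v x, hx, sub_self, mul_zero,
      zero_smul, add_zero]
  · have hvf : v ∈ fixedSpace (spTransvection halt (g.1 v - v) (ω v (g.1 v))⁻¹ * g) := by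
      rw [mem_fixedSpace]
      change (spTransvection halt _ _).1 (g.1 v) = v
      rw [spTransvection_apply, map_sub, LinearMap.sub_apply, halt, zero_sub, mul_neg,
        inv_mul_cancel₀ hv, neg_smul, one_smul]
      abel
    rw [← h, mem_fixedSpace] at hvf
    rw [hvf] at hv
    exact hv (halt v)

/-- The symplectic group is generated by squares. -/
theorem Sp.induction_on_sq [FiniteDimensional F V] (h2 : (2 : F) ≠ 0) (hω : ω.Nondegenerate)
    {P : Sp ω → Prop} (hmul : ∀ g h, P g → P h → P (g * h)) (hsq : ∀ h, P (h * h)) (g : Sp ω) :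
    P g := by
  -- A transvection with coefficient c is the square of the one with c/2.
  have htr : ∀ v c, P (spTransvection halt v c) := fun v c => by
    have hc : c = c / 2 + c / 2 := by
      field_simp
      ring
    rw [hc, ← spTransvection_mul]
    exact hsq _
  have hcancel : ∀ v c g, P (spTransvection halt v c * g) → P g := fun v c g h => by
    have h3 := hmul _ _ (htr v (-c)) h
    rw [← mul_assoc, spTransvection_mul, neg_add_cancel] at h3
    have : spTransvection halt v (0 : F) = 1 := by
      ext x
      change (spTransvection halt v (0 : F)).1 x = x
      simp
    rwa [this, one_mul] at h3
  suffices h : ∀ (K : Submodule F V) (g : Sp ω), fixedSpace g = K → P g from h _ g rfl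
  intro K
  induction K using WellFoundedGT.induction with
  | ind K ih =>
  rintro g rfl
  by_cases hg : ∃ v, ω v (g.1 v) ≠ 0
  · obtain ⟨v, hv⟩ := hg
    obtain ⟨u, c, huc⟩ := exists_fixedSpace_lt halt hv
    exact hcancel u c g (ih _ huc _ rfl)
  -- If ω(v, gv) = 0 for all v, then `g` is an involution. A transvection along a vector with gv =
  -- -v loses no fixed vector of `g` and brings back the first case.
  push Not at hg
  have hpol : ∀ v w, ω (g.1 v) w = ω v (g.1 w) := fun v w => by
    have h := hg (v + w)
    simp only [map_add, LinearMap.add_apply, hg] at h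
    rw [← halt.neg_eq]
    linear_combination -h
  have hinv : ∀ v, g.1 (g.1 v) = v := fun v => by
    refine sub_eq_zero.1 (hω.1 _ fun w => ?_)
    obtain ⟨w, rfl⟩ := g.1.surjective w
    rw [map_sub, LinearMap.sub_apply, g.2, hpol, sub_self]
  by_cases hid : ∀ y, g.1 y = y
  · have : g = 1 := Subtype.ext (LinearEquiv.ext hid)
    rw [this, ← mul_one (1 : Sp ω)]
    exact hsq 1
  push Not at hid
  obtain ⟨y, hy⟩ := hid
  obtain ⟨v, hv0, hgv⟩ : ∃ v, v ≠ 0 ∧ g.1 v = -v :=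
    ⟨g.1 y - y, sub_ne_zero.2 hy, by rw [map_sub, hinv, neg_sub]⟩
  obtain ⟨x, hx⟩ : ∃ x, ω v x ≠ 0 := by
    by_contra! h
    exact hv0 (hω.1 v h)
  have hx1 : ω x ((spTransvection halt v 1 * g).1 x) ≠ 0 := by
    change ω x ((spTransvection halt v 1).1 (g.1 x)) ≠ 0
    rw [spTransvection_apply, map_add, hg, zero_add, map_smul, ← hpol, hgv, map_neg,
      LinearMap.neg_apply, smul_eq_mul, ← halt.neg_eq v x, one_mul, neg_mul_neg]
    exact mul_ne_zero hx hx
  obtain ⟨u, c, huc⟩ := exists_fixedSpace_lt halt hx1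
  refine hcancel v 1 g (hcancel u c _ (ih _ (lt_of_le_of_lt (fun z hz => ?_) huc) _ rfl))
  have hz := mem_fixedSpace.1 hz
  rw [mem_fixedSpace]
  change (spTransvection halt v 1).1 (g.1 z) = z
  have h0 : ω v z = 0 := by
    have := hpol v z
    rw [hgv, hz, map_neg, LinearMap.neg_apply] at this
    exact (mul_eq_zero.1 (by linear_combination -this : (2 : F) * ω v z = 0)).resolve_left h2
  rw [hz, spTransvection_apply, h0, mul_zero, zero_smul, add_zero]

end Transvection

/-! ### The metaplectic group, the lift and its uniqueness. -/

section Metaplectic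

variable {F : Type*} [Field F] [TopologicalSpace F]
  {V : Type*} [AddCommGroup V] [Module F V] [FiniteDimensional F V] {a b c d o : Submodule F V}
  [IsTopologicalRing F] [LocallyCompactSpace F] [SecondCountableTopology F] [T2Space F]
  {ψ : AddChar F Circle} (hW : HasWeilTheory ψ) (hN : HasNormTheory ψ)
  {ω : LinearMap.BilinForm F V} (halt : ω.IsAlt) (hω : ω.Nondegenerate)

include hW halt hω

/-- With all factors based at one `o`, identities between Maslov factors become cancellations by
`maslovWeil_swap`. -/
theorem HasWeilTheory.maslovWeil_four_eq (ho : IsLagrangian ω o) (ha : IsLagrangian ω a)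
    (hb : IsLagrangian ω b) (hc : IsLagrangian ω c) (hd : IsLagrangian ω d) :
    maslovWeil ψ ω ![a, b, c, d] =
      maslovWeil ψ ω ![o, a, b] * maslovWeil ψ ω ![o, b, c] * maslovWeil ψ ω ![o, c, d] *
        maslovWeil ψ ω ![o, d, a] := by
  rw [hW.maslovWeil_four halt hω ha hb hc hd, hW.maslovWeil_three_eq halt hω ho ha hb hc,
    hW.maslovWeil_three_eq halt hω ho ha hc hd]
  linear_combination maslovWeil ψ ω ![o, a, b] * maslovWeil ψ ω ![o, b, c] *
    maslovWeil ψ ω ![o, c, d] * maslovWeil ψ ω ![o, d, a] * hW.maslovWeil_swap halt hω ho hc ha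

theorem HasWeilTheory.maslovWeil_four_act (ha : IsLagrangian ω a) (hb : IsLagrangian ω b)
    (hc : IsLagrangian ω c) (hd : IsLagrangian ω d) (g : Sp ω) :
    maslovWeil ψ ω ![act g a, act g b, act g c, act g d] = maslovWeil ψ ω ![a, b, c, d] := by
  rw [hW.maslovWeil_four halt hω ha hb hc hd,
    hW.maslovWeil_four halt hω (ha.act g) (hb.act g) (hc.act g) (hd.act g),
    hW.maslovWeil_act halt ha.isIsotropic hb.isIsotropic hc.isIsotropic g (hc.act g).isIsotropic,
    hW.maslovWeil_act halt ha.isIsotropic hc.isIsotropic hd.isIsotropic g (hd.act g).isIsotropic]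

/-- The change of base point is multiplicative. -/
theorem HasWeilTheory.maslovWeil_four_trans (ha : IsLagrangian ω a) (hb : IsLagrangian ω b)
    (hc : IsLagrangian ω c) (g : Sp ω) :
    maslovWeil ψ ω ![a, act g a, act g c, c] =
      maslovWeil ψ ω ![b, act g b, act g c, c] * maslovWeil ψ ω ![a, act g a, act g b, b] := by
  have hga := ha.act g
  have hgb := hb.act g
  have hgc := hc.act g
  -- Invariance of τ(a,b,c) under `g` is the only geometric input; the rest is cancellation with
  -- base point `a`.
  have h1 := hW.maslovWeil_act halt ha.isIsotropic hb.isIsotropic hc.isIsotropic g hgc.isIsotropic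
  rw [hW.maslovWeil_three_eq halt hω ha hga hgb hgc,
    hW.maslovWeil_three_eq halt hω ha ha hb hc] at h1
  rw [hW.maslovWeil_four_eq halt hω ha ha hga hgc hc,
    hW.maslovWeil_four_eq halt hω ha hb hgb hgc hc, hW.maslovWeil_four_eq halt hω ha ha hga hgb hb]
  have e1 := hW.maslovWeil_swap halt hω ha hb hgb
  have e2 := hW.maslovWeil_swap halt hω ha hga hgc
  have e3 := hW.maslovWeil_swap halt hω ha hc ha
  have e4 := hW.maslovWeil_swap halt hω ha hc hb
  have e5 := hW.maslovWeil_swap halt hω ha hb ha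
  generalize maslovWeil ψ ω ![a, a, b] = ab at *
  generalize maslovWeil ψ ω ![a, b, a] = ba at *
  generalize maslovWeil ψ ω ![a, b, c] = bc at *
  generalize maslovWeil ψ ω ![a, c, b] = cb at *
  generalize maslovWeil ψ ω ![a, a, c] = ac at *
  generalize maslovWeil ψ ω ![a, c, a] = ca at *
  generalize maslovWeil ψ ω ![a, a, act g a] = u at *
  generalize maslovWeil ψ ω ![a, b, act g b] = v at *
  generalize maslovWeil ψ ω ![a, act g b, b] = v' at *
  generalize maslovWeil ψ ω ![a, act g c, c] = w at *
  generalize maslovWeil ψ ω ![a, act g a, act g c] = xz at *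
  generalize maslovWeil ψ ω ![a, act g c, act g a] = zx at *
  generalize maslovWeil ψ ω ![a, act g a, act g b] = xy at *
  generalize maslovWeil ψ ω ![a, act g b, act g c] = yz at *
  have : xz * ca = cb * ba * (xy * yz) := by
    have h0 : xy * yz = ab * bc * ca * xz := by
      linear_combination xz * h1 - xy * yz * e2
    rw [h0]
    linear_combination (-xz * ca * e4 * ab * ba - xz * ca * e5)
  linear_combination u * w * this - u * w * cb * ba * xy * yz * e1

omit hω in
theorem HasWeilTheory.maslovWeil_inr (hω : ω.Nondegenerate) (ha : IsLagrangian ω a)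
    (hb : IsLagrangian ω b) (g : Sp ω) :
    maslovWeil ψ (barSum ω)
      ![a.prod a, act (inr ω g) (a.prod a), act (inr ω g) (b.prod b), b.prod b] =
      maslovWeil ψ ω ![a, act g a, act g b, b] := by
  have hB := barSum_isAlt halt
  have hB' := barSum_nondegenerate hω
  rw [act_inr_prod, act_inr_prod, hW.maslovWeil_four hB hB' (ha.prod ha) (ha.prod (ha.act g))
    (hb.prod (hb.act g)) (hb.prod hb), hW.maslovWeil_four halt hω ha (ha.act g) (hb.act g) hb,
    hW.maslovWeil_prod halt ha.isIsotropic ha.isIsotropic (ha.act g).isIsotropic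
      (hb.act g).isIsotropic hb.isIsotropic,
    ← hW.maslovWeil_rotate hB (ha.prod ha).isIsotropic (hb.prod (hb.act g)).isIsotropic
      (hb.prod hb).isIsotropic,
    hW.maslovWeil_prod halt hb.isIsotropic (hb.act g).isIsotropic hb.isIsotropic
      ha.isIsotropic ha.isIsotropic,
    hW.maslovWeil_rotate halt ha.isIsotropic (hb.act g).isIsotropic hb.isIsotropic]

include hN

/-- One value with the right square spreads to all Lagrangians: the transformation rule is
transitive by `maslovWeil_four_trans` and compatible with m² by `mSelf_change_sq`. -/
theorem HasWeilTheory.mp_extend (l : Gr ω) {g : Sp ω} {c : ℂ}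
    (hc : c ^ 2 = mSelf ψ g l.1 ^ 2) :
    (g, fun L : Gr ω => maslovWeil ψ ω ![l.1, act g l.1, act g L.1, L.1] * c) ∈ Mp ψ ω := by
  constructor
  · intro L
    change (_ * c) ^ 2 = _
    rw [hW.mSelf_change_sq hN halt hω l.2 L.2, mul_pow, mul_pow, hc]
  · intro L L'
    change _ * c = _ * (_ * c)
    rw [← mul_assoc, ← hW.maslovWeil_four_trans halt hω l.2 L.2 L'.2]

/-- The condition on squares is the cocycle rule `mSelf_mul_sq`. The transformation rule is a
coboundary computation with every Maslov factor based at `l`. -/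
theorem HasWeilTheory.mp_mul_mem {x y : Sp ω × (Gr ω → ℂ)} (hx : x ∈ Mp ψ ω) (hy : y ∈ Mp ψ ω) :
    mpMul ψ x y ∈ Mp ψ ω := by
  obtain ⟨g, s⟩ := x
  obtain ⟨h, t⟩ := y
  constructor
  · intro l
    change (s l * t l * _) ^ 2 = mSelf ψ (g * h) l.1 ^ 2
    rw [mul_pow, mul_pow, hx.1 l, hy.1 l, hW.mSelf_mul_sq hN halt hω l.2]
  · intro l l'
    have h1 : s l' = maslovWeil ψ ω ![l.1, act g l.1, act g l'.1, l'.1] * s l := hx.2 l l'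
    have h2 : t l' = maslovWeil ψ ω ![l.1, act h l.1, act h l'.1, l'.1] * t l := hy.2 l l'
    change s l' * t l' * maslovWeil ψ ω ![l'.1, act g l'.1, act (g * h) l'.1] =
      maslovWeil ψ ω ![l.1, act (g * h) l.1, act (g * h) l'.1, l'.1] *
        (s l * t l * maslovWeil ψ ω ![l.1, act g l.1, act (g * h) l.1])
    have ho := l.2
    have ha := l.2
    have hb := l'.2
    have hga := ha.act g
    have hgb := hb.act g
    have hha := (ha.act h).act g
    have hhb := (hb.act h).act g
    rw [h1, h2, ← hW.maslovWeil_four_act halt hω ha (ha.act h) (hb.act h) hb g, act_mul, act_mul]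
    have e1 := hW.maslovWeil_swap halt hω ho hga hgb
    have e2 := hW.maslovWeil_swap halt hω ho hgb hb
    have e3 := hW.maslovWeil_swap halt hω ho hhb hgb
    have e4 := hW.maslovWeil_swap halt hω ho ha hha
    have e5 := hW.maslovWeil_four_eq halt hω ho ha hga hgb hb
    have e6 := hW.maslovWeil_four_eq halt hω ho hga hha hhb hgb
    have e7 := hW.maslovWeil_four_eq halt hω ho ha hha hhb hb
    have e8 := hW.maslovWeil_three_eq halt hω ho hb hgb hhb
    have e9 := hW.maslovWeil_three_eq halt hω ho ha hga hha
    rw [e5, e6, e7, e8]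
    clear e5 e6 e7 e8 h1 h2 hx hy
    generalize maslovWeil ψ ω ![l.1, act g l.1, act g l'.1] = p1 at *
    generalize maslovWeil ψ ω ![l.1, act g l'.1, act g l.1] = p1' at *
    generalize maslovWeil ψ ω ![l.1, act g l'.1, l'.1] = p2 at *
    generalize maslovWeil ψ ω ![l.1, l'.1, act g l'.1] = p2' at *
    generalize maslovWeil ψ ω ![l.1, act g (act h l'.1), act g l'.1] = p3 at *
    generalize maslovWeil ψ ω ![l.1, act g l'.1, act g (act h l'.1)] = p3' at *
    generalize maslovWeil ψ ω ![l.1, l.1, act g (act h l.1)] = p4 at *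
    generalize maslovWeil ψ ω ![l.1, act g (act h l.1), l.1] = p4' at *
    generalize maslovWeil ψ ω ![l.1, l.1, act g l.1] = q1 at *
    generalize maslovWeil ψ ω ![l.1, l'.1, l.1] = q2
    generalize maslovWeil ψ ω ![l.1, act g l.1, act g (act h l.1)] = q3 at *
    generalize maslovWeil ψ ω ![l.1, act g (act h l.1), act g (act h l'.1)] = q4
    generalize maslovWeil ψ ω ![l.1, act g (act h l'.1), l'.1] = q5
    calc _ = s l * t l * q1 * q2 * q3 * q4 * q5 * (p1 * p1') * (p2 * p2') * (p3 * p3') := by ring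
      _ = s l * t l * q2 * q4 * q5 * p4 * (q1 * q3 * p4') := by
        rw [e1, e2, e3]
        linear_combination -s l * t l * q1 * q2 * q3 * q4 * q5 * e4
      _ = _ := by
        rw [← e9]
        ring

theorem HasWeilTheory.mp_ne_zero {x : Sp ω × (Gr ω → ℂ)} (hx : x ∈ Mp ψ ω) (l : Gr ω) :
    x.2 l ≠ 0 := by
  have h := hx.1 l
  intro h0
  rw [h0, zero_pow (by norm_num)] at h
  exact hW.mSelf_ne_zero hN halt hω l.2 _ ((pow_eq_zero_iff (by norm_num)).1 h.symm)

omit hW hN halt hω in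
theorem Mp.eq_of_apply {x y : Sp ω × (Gr ω → ℂ)} (hx : x ∈ Mp ψ ω) (hy : y ∈ Mp ψ ω)
    (h : x.1 = y.1) {l : Gr ω} (hl : x.2 l = y.2 l) : x = y := by
  refine Prod.ext h (funext fun L => ?_)
  rw [hx.2 l L, hy.2 l L, h, hl]

-- Cut the quadrilateral along the diagonal from l ⊕ l to Γ_g. The triangle (l ⊕ l, l ⊕ gl, Γ_g) has
-- zero form, and the other one is a rotation of the triangle in Θ.
omit hN in
theorem HasWeilTheory.theta_aux (l : Gr ω) (g : Sp ω) :
    maslovWeil ψ (barSum ω) ![(double l).1, act (inr ω g) (double l).1,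
      act (inr ω g) (graph hω 1).1, (graph hω 1).1] =
      maslovWeil ψ (barSum ω) ![(graph hω g).1, (graph hω 1).1, (double l).1] := by
  have hB := barSum_isAlt halt
  have hB' := barSum_nondegenerate hω
  have hG : act (inr ω g) (graph hω 1).1 = (graph hω g).1 := by
    ext ⟨x, y⟩
    rw [mem_act]
    change g.1.symm y = x ↔ y = g.1 x
    exact g.1.symm_apply_eq
  have hD : (double l).1 = l.1.prod l.1 := rfl
  have hdl := (double l).2
  have hg := (graph hω g).2
  have hone := (graph hω 1).2
  rw [hG, hW.maslovWeil_four hB hB' hdl (hdl.act _) hg hone,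
    hW.maslovWeil_rotate hB hdl.isIsotropic hg.isIsotropic hone.isIsotropic,
    hD, act_inr_prod, hW.maslovWeil_eq_one hg.isIsotropic, one_mul]
  -- If x + y lies on Γ_g then x₂ = g(x₁ + y₁) - y₂ is in gl, so the first components pair inside
  -- `l` and the second ones inside gl.
  have hmem : ∀ x ∈ l.1.prod l.1, ∀ y ∈ l.1.prod (act g l.1), x + y ∈ (graph hω g).1 →
      x.2 ∈ act g l.1 := fun x hx y hy hxy => by
    have h1 : x.2 + y.2 = g.1 (x.1 + y.1) := hxy
    rw [eq_sub_of_add_eq h1]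
    exact sub_mem ⟨_, add_mem hx.1 hy.1, rfl⟩ hy.2
  intro x hx y hy hxy x' hx' y' hy' hxy'
  rw [barSum_apply, l.2.isIsotropic _ hy.1 _ hx'.1,
    (l.2.act g).isIsotropic _ hy.2 _ (hmem x' hx' y' hy' hxy'), neg_zero, add_zero]

omit hN hω in
theorem HasWeilTheory.exists_gr (hω : ω.Nondegenerate) : Nonempty (Gr ω) := by
  have h : IsIsotropic ω (⊥ : Submodule F V) := fun x hx y _ => by
    rw [(Submodule.mem_bot F).1 hx, map_zero, LinearMap.zero_apply]
  obtain ⟨k, hk, -⟩ := exists_transversal hW.two_ne_zero halt hω h h h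
  exact ⟨⟨k, hk⟩⟩

/-- The lift to `Mp(V)` of the embedding `Sp(V) → Sp(V̄ ⊕ V)`. -/
def HasWeilTheory.mpInr (l : Gr ω) (x : Mp ψ ω) : Mp ψ (barSum ω) :=
  ⟨(inr ω x.1.1, fun L => maslovWeil ψ (barSum ω)
      ![(double l).1, act (inr ω x.1.1) (double l).1, act (inr ω x.1.1) L.1, L.1] * x.1.2 l),
    hW.mp_extend hN (barSum_isAlt halt) (barSum_nondegenerate hω) (double l)
      ((x.2.1 l).trans (hW.mSelf_inr_sq hN halt hω l.2 x.1.1).symm)⟩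

theorem HasWeilTheory.mpInr_double (l L : Gr ω) (x : Mp ψ ω) :
    (hW.mpInr hN halt hω l x).1.2 (double L) = x.1.2 L := by
  rw [x.2.2 l L, ← hW.maslovWeil_inr halt hω l.2 L.2]
  rfl

/-- Elements of Mp over the same group element agree once they agree at one Lagrangian, so all is
checked at l ⊕ l, where the cocycle of V̄ ⊕ V equals that of V. -/
theorem HasWeilTheory.isHomomorphicEmbeddingOver_mpInr (l : Gr ω) :
    IsHomomorphicEmbeddingOver ψ (inr ω) (hW.mpInr hN halt hω l) where
  map_mul x y := by
    refine ⟨⟨mpMul ψ x.1 y.1, hW.mp_mul_mem hN halt hω x.2 y.2⟩, rfl, ?_⟩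
    refine Mp.eq_of_apply (Subtype.prop _) (hW.mp_mul_mem hN (barSum_isAlt halt)
      (barSum_nondegenerate hω) (Subtype.prop _) (Subtype.prop _)) (map_mul (inr ω) x.1.1 y.1.1)
      (l := double l) ?_
    rw [hW.mpInr_double]
    change _ = (hW.mpInr hN halt hω l x).1.2 (double l) * (hW.mpInr hN halt hω l y).1.2 (double l) *
      maslovWeil ψ (barSum ω) ![l.1.prod l.1, act (inr ω x.1.1) (l.1.prod l.1),
        act (inr ω (x.1.1 * y.1.1)) (l.1.prod l.1)]
    rw [hW.mpInr_double, hW.mpInr_double, act_inr_prod, act_inr_prod,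
      hW.maslovWeil_prod halt l.2.isIsotropic l.2.isIsotropic (l.2.act _).isIsotropic
        (l.2.act _).isIsotropic l.2.isIsotropic]
    rfl
  injective x y h := by
    have h1 : inr ω x.1.1 = inr ω y.1.1 := congrArg (fun z => z.1.1) h
    have h2 : x.1.1 = y.1.1 := by
      ext v
      exact congrArg (fun g : Sp (barSum ω) => (g.1 (0, v)).2) h1
    refine Subtype.ext (Mp.eq_of_apply x.2 y.2 h2 (l := l) ?_)
    rw [← hW.mpInr_double hN halt hω l l, h, hW.mpInr_double]
  covers _ := rfl

/-- `-(g, t) = (g, -t)`. -/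
def mpNeg (x : Sp ω × (Gr ω → ℂ)) : Sp ω × (Gr ω → ℂ) := (x.1, fun l => -x.2 l)

omit hW hN halt hω in
theorem mpNeg_mem {x : Sp ω × (Gr ω → ℂ)} (hx : x ∈ Mp ψ ω) : mpNeg x ∈ Mp ψ ω := by
  refine ⟨fun l => ?_, fun l l' => ?_⟩
  · change (-x.2 l) ^ 2 = _
    rw [neg_sq]
    exact hx.1 l
  · change -x.2 l' = _ * -x.2 l
    rw [mul_neg, hx.2 l l']
    rfl

omit hW hN halt hω in
theorem Mp.eq_or_eq_neg {x y : Sp ω × (Gr ω → ℂ)} (hx : x ∈ Mp ψ ω) (hy : y ∈ Mp ψ ω)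
    (h : x.1 = y.1) (l : Gr ω) : x = y ∨ x = mpNeg y := by
  have h1 : x.2 l ^ 2 = y.2 l ^ 2 := by rw [hx.1, hy.1, h]
  rcases sq_eq_sq_iff_eq_or_eq_neg.1 h1 with h2 | h2
  · exact Or.inl (Mp.eq_of_apply hx hy h h2)
  · exact Or.inr (Mp.eq_of_apply hx (mpNeg_mem hy) h h2)

omit hW hN halt hω in
theorem mpMul_mpNeg_left (x y : Sp ω × (Gr ω → ℂ)) :
    mpMul ψ (mpNeg x) y = mpNeg (mpMul ψ x y) :=
  Prod.ext rfl (funext fun l => by simp [mpMul, mpNeg])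

omit hW hN halt hω in
theorem mpMul_mpNeg_right (x y : Sp ω × (Gr ω → ℂ)) :
    mpMul ψ x (mpNeg y) = mpNeg (mpMul ψ x y) :=
  Prod.ext rfl (funext fun l => by simp [mpMul, mpNeg])

omit hW hN halt hω in
theorem mpNeg_mpNeg (x : Sp ω × (Gr ω → ℂ)) : mpNeg (mpNeg x) = x :=
  Prod.ext rfl (funext fun _ => neg_neg _)

theorem HasWeilTheory.mpNeg_ne {x : Sp ω × (Gr ω → ℂ)} (hx : x ∈ Mp ψ ω) :
    mpNeg x ≠ x := fun h => by
  obtain ⟨l⟩ := hW.exists_gr halt hω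
  have h1 : -x.2 l = x.2 l := congrArg (fun z => z.2 l) h
  exact hW.mp_ne_zero hN halt hω hx l (neg_eq_self.1 h1)

/-- Two embeddings differ by a sign on each element. Both commute with `mpNeg`, so the sign depends
only on the image in Sp(V); being multiplicative, it is trivial on squares and so everywhere. -/
theorem HasWeilTheory.embedding_unique {f f' : Mp ψ ω → Mp ψ (barSum ω)}
    (hf : IsHomomorphicEmbeddingOver ψ (inr ω) f)
    (hf' : IsHomomorphicEmbeddingOver ψ (inr ω) f') : f = f' := by
  obtain ⟨l⟩ := hW.exists_gr halt hω
  have hB := barSum_isAlt halt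
  have hB' := barSum_nondegenerate hω
  have hcov : ∀ x, (f x).1.1 = (f' x).1.1 := fun x => (hf.covers x).trans (hf'.covers x).symm
  have hor : ∀ x, (f x).1 = (f' x).1 ∨ (f x).1 = mpNeg (f' x).1 := fun x =>
    Mp.eq_or_eq_neg (f x).2 (f' x).2 (hcov x) (double l)
  -- The images of x and -x lie over the same element and are distinct by injectivity, so they are
  -- opposite.
  have hneg : ∀ (e : Mp ψ ω → Mp ψ (barSum ω)), IsHomomorphicEmbeddingOver ψ (inr ω) e →
      ∀ x y : Mp ψ ω, x.1 = mpNeg y.1 → (e x).1 = mpNeg (e y).1 := fun e he x y hxy => by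
    refine (Mp.eq_or_eq_neg (e x).2 (e y).2 ?_ (double l)).resolve_left fun h => ?_
    · rw [he.covers, he.covers, hxy]
      rfl
    · rw [he.injective (Subtype.ext h)] at hxy
      exact hW.mpNeg_ne hN halt hω y.2 hxy.symm
  have hfib : ∀ x y : Mp ψ ω, x.1.1 = y.1.1 → (f x).1 = (f' x).1 → (f y).1 = (f' y).1 :=
    fun x y hxy hx => by
      rcases Mp.eq_or_eq_neg y.2 x.2 hxy.symm l with h | h
      · rwa [Subtype.ext h]
      · rw [hneg f hf y x h, hneg f' hf' y x h, hx]
  have hlift : ∀ g : Sp ω, ∃ x : Mp ψ ω, x.1.1 = g := fun g =>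
    ⟨⟨_, hW.mp_extend hN halt hω l (g := g) rfl⟩, rfl⟩
  suffices h : ∀ g : Sp ω, ∀ x : Mp ψ ω, x.1.1 = g → (f x).1 = (f' x).1 from
    funext fun x => Subtype.ext (h _ x rfl)
  intro g
  refine Sp.induction_on_sq halt hW.two_ne_zero hω
    (P := fun g => ∀ x : Mp ψ ω, x.1.1 = g → (f x).1 = (f' x).1) ?_ ?_ g
  · intro g h hg hh x hx
    obtain ⟨y, hy⟩ := hlift g
    obtain ⟨z, hz⟩ := hlift h
    obtain ⟨w, hw, hfw⟩ := hf.map_mul y z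
    obtain ⟨w', hw', hfw'⟩ := hf'.map_mul y z
    obtain rfl : w' = w := Subtype.ext (hw'.trans hw.symm)
    refine hfib w' x ?_ ?_
    · rw [hw, hx]
      exact congrArg₂ (· * ·) hy hz
    · rw [hfw, hfw', hg y hy, hh z hz]
  · intro g x hx
    obtain ⟨y, hy⟩ := hlift g
    obtain ⟨w, hw, hfw⟩ := hf.map_mul y y
    obtain ⟨w', hw', hfw'⟩ := hf'.map_mul y y
    obtain rfl : w' = w := Subtype.ext (hw'.trans hw.symm)
    refine hfib w' x ?_ ?_
    · rw [hw, hx]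
      exact congrArg₂ (· * ·) hy hy
    · rw [hfw, hfw']
      rcases hor y with h | h
      · rw [h]
      · rw [h, mpMul_mpNeg_left, mpMul_mpNeg_right, mpNeg_mpNeg]

theorem HasWeilTheory.metaplectic_embedding :
    (∃! f' : Mp ψ ω → Mp ψ (barSum ω), IsHomomorphicEmbeddingOver ψ (inr ω) f') ∧
    ∀ f' : Mp ψ ω → Mp ψ (barSum ω), IsHomomorphicEmbeddingOver ψ (inr ω) f' →
      ∀ l : Gr ω, (∀ x : Mp ψ ω, ev ψ (double l) (f' x) = ev ψ l x) ∧
        theta ψ hω l = ev ψ (graph hω 1) ∘ f' := by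
  obtain ⟨l₀⟩ := hW.exists_gr halt hω
  refine ⟨⟨_, hW.isHomomorphicEmbeddingOver_mpInr hN halt hω l₀, fun f hf =>
    hW.embedding_unique hN halt hω hf (hW.isHomomorphicEmbeddingOver_mpInr hN halt hω l₀)⟩,
    fun f hf l => ?_⟩
  rw [hW.embedding_unique hN halt hω hf (hW.isHomomorphicEmbeddingOver_mpInr hN halt hω l)]
  refine ⟨fun x => hW.mpInr_double hN halt hω l l x, funext fun x => ?_⟩
  rw [theta, ← hW.theta_aux halt hω l x.1.1, mul_comm]
  rfl

end Metaplectic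

/-! ### Weil constants through approximations of 1. -/

section Approximation

open Filter Topology

variable {F : Type*} [Field F] [TopologicalSpace F] [IsTopologicalRing F] {ψ : AddChar F Circle}
  {A : Type*} [AddCommGroup A] [Module F A] [TopologicalSpace A] [IsTopologicalAddGroup A]
  [MeasurableSpace A] [BorelSpace A] [LocallyCompactSpace A] [SecondCountableTopology A]
  {q : LinearMap.BilinForm F A} {μ : Measure A} [SigmaFinite μ]

theorem integral_fourier_mul (hψ : Continuous ψ) (hq : q.IsSymm)
    (hqc : Continuous fun p : A × A => q p.1 p.2) {f g : A → ℂ} (hf : Integrable f μ)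
    (hg : Integrable g μ) :
    ∫ x, fourier ψ q μ f x * g x ∂μ = ∫ x, f x * fourier ψ q μ g x ∂μ := by
  have h := VectorFourier.integral_fourierIntegral_smul_eq_flip (e := ψ) (L := q) (μ := μ) (ν := μ)
    hψ hqc hf hg
  have hflip : LinearMap.flip q = q := LinearMap.ext fun x => LinearMap.ext fun y => hq.eq y x
  rw [hflip] at h
  exact h

theorem continuous_quadChar (hψ : Continuous ψ) (hqc : Continuous fun p : A × A => q p.1 p.2) :
    Continuous (quadChar ψ q) :=
  continuous_subtype_val.comp (hψ.comp (continuous_const.mul (hqc.comp (continuous_id.prodMk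
    continuous_id))))

/-- A Weil constant can be computed through approximations of `1`. -/
theorem integral_quadChar_fourier (hψ : Continuous ψ) (hq : q.IsSymm)
    (hqc : Continuous fun p : A × A => q p.1 p.2) {c : ℂ} {C : ℝ} {H : ℕ → A → ℂ}
    (hH : ∀ k, Integrable (H k) μ) (hH1 : ∀ k x, ‖H k x‖ ≤ 1)
    (hHlim : ∀ x, Tendsto (fun k => H k x) atTop (𝓝 1))
    (hC : ∀ k y, ‖fourier ψ q μ (fun x => quadChar ψ q x * H k x) y‖ ≤ C)
    (hlim : ∀ y, Tendsto (fun k => fourier ψ q μ (fun x => quadChar ψ q x * H k x) y) atTop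
      (𝓝 (c * quadChar ψ (-q) y)))
    {φ : A → ℂ} (hφ : IsTestFunction ψ q μ φ) :
    ∫ x, quadChar ψ q x * fourier ψ q μ φ x ∂μ = c * ∫ y, quadChar ψ (-q) y * φ y ∂μ := by
  have hquad := continuous_quadChar hψ hqc
  have hfH : ∀ k, Integrable (fun x => quadChar ψ q x * H k x) μ := fun k =>
    (hH k).bdd_mul hquad.aestronglyMeasurable (.of_forall fun x => (norm_quadChar q x).le)
  -- The Fourier transform can be moved from `φ` to f_q H_k, so the integrals in `h1` and `h2` agree
  -- for each k. Their limits are computed by dominated convergence.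
  have h1 : Tendsto (fun k => ∫ x, (quadChar ψ q x * H k x) * fourier ψ q μ φ x ∂μ) atTop
      (𝓝 (∫ x, quadChar ψ q x * fourier ψ q μ φ x ∂μ)) := by
    refine tendsto_integral_of_dominated_convergence (fun x => ‖fourier ψ q μ φ x‖)
      (fun k => (hfH k).aestronglyMeasurable.mul hφ.integrable_fourier.aestronglyMeasurable)
      hφ.integrable_fourier.norm (fun k => .of_forall fun x => ?_) (.of_forall fun x => ?_)
    · rw [norm_mul, norm_mul, norm_quadChar, one_mul]
      exact mul_le_of_le_one_left (norm_nonneg _) (hH1 k x)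
    · have := ((hHlim x).const_mul (quadChar ψ q x)).mul_const (fourier ψ q μ φ x)
      rwa [mul_one] at this
  have h2 : Tendsto (fun k => ∫ x, fourier ψ q μ (fun x => quadChar ψ q x * H k x) x * φ x ∂μ) atTop
      (𝓝 (∫ y, (c * quadChar ψ (-q) y) * φ y ∂μ)) := by
    refine tendsto_integral_of_dominated_convergence (fun x => C * ‖φ x‖)
      (fun k => ?_) (hφ.integrable.norm.const_mul C) (fun k => .of_forall fun x => ?_)
      (.of_forall fun x => (hlim x).mul_const _)
    · refine AEStronglyMeasurable.mul ?_ hφ.integrable.aestronglyMeasurable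
      exact (VectorFourier.fourierIntegral_continuous hψ hqc (hfH k)).aestronglyMeasurable
    · rw [norm_mul]
      gcongr
      exact hC k x
  simp_rw [integral_fourier_mul hψ hq hqc (hfH _) hφ.integrable] at h2
  rw [tendsto_nhds_unique h1 h2, ← integral_const_mul]
  simp_rw [mul_assoc]

end Approximation

/-! ### Compact open subgroups and Gauss sums. -/

section Lattice

open Filter Topology

variable {F : Type*} [Field F] [TopologicalSpace F] [IsTopologicalRing F] {ψ : AddChar F Circle}
  {A : Type*} [AddCommGroup A] [Module F A] [TopologicalSpace A] [IsTopologicalAddGroup A]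
  [MeasurableSpace A] [BorelSpace A] [LocallyCompactSpace A] [SecondCountableTopology A] [T2Space A]
  {q : LinearMap.BilinForm F A} {μ : Measure A} [μ.IsAddHaarMeasure]

/-- The annihilator of a subgroup under the pairing `ψ ∘ q`. -/
def annihilator (ψ : AddChar F Circle) (q : LinearMap.BilinForm F A) (K : AddSubgroup A) :
    AddSubgroup A where
  carrier := {y | ∀ x ∈ K, ψ (q x y) = 1}
  zero_mem' := fun x _ => by rw [map_zero, AddChar.map_zero_eq_one]
  add_mem' := fun {a b} ha hb x hx => by
    rw [map_add, AddChar.map_add_eq_mul, ha x hx, hb x hx, one_mul]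
  neg_mem' := fun {a} ha x hx => by rw [map_neg, AddChar.map_neg_eq_inv, ha x hx, inv_one]

omit [TopologicalSpace F] [IsTopologicalRing F] [TopologicalSpace A] [IsTopologicalAddGroup A]
  [MeasurableSpace A] [BorelSpace A] [LocallyCompactSpace A] [SecondCountableTopology A]
  [T2Space A] in
theorem mem_annihilator {K : AddSubgroup A} {y : A} :
    y ∈ annihilator ψ q K ↔ ∀ x ∈ K, ψ (q x y) = 1 := Iff.rfl

theorem annihilator_anti {K L : AddSubgroup A} (h : K ≤ L) :
    annihilator ψ q L ≤ annihilator ψ q K := fun _ hy x hx => hy x (h hx)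

theorem le_annihilator_annihilator (hq : q.IsSymm) (K : AddSubgroup A) :
    K ≤ annihilator ψ q (annihilator ψ q K) := fun x hx y hy => by
  rw [hq.eq]
  exact hy x hx

theorem annihilator_annihilator_annihilator (hq : q.IsSymm) (K : AddSubgroup A) :
    annihilator ψ q (annihilator ψ q (annihilator ψ q K)) = annihilator ψ q K :=
  le_antisymm (annihilator_anti (le_annihilator_annihilator hq K))
    (le_annihilator_annihilator hq _)

omit [IsTopologicalAddGroup A] [MeasurableSpace A] [BorelSpace A] [LocallyCompactSpace A]
  [SecondCountableTopology A] [T2Space A] in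
theorem isClosed_annihilator (hψ : Continuous ψ) (hqc : Continuous fun p : A × A => q p.1 p.2)
    (K : AddSubgroup A) : IsClosed (annihilator ψ q K : Set A) := by
  have : (annihilator ψ q K : Set A) = ⋂ x ∈ K, {y | ψ (q x y) = 1} := by
    ext y
    simp [mem_annihilator]
  rw [this]
  refine isClosed_biInter fun x _ => ?_
  exact isClosed_eq (hψ.comp (hqc.comp (continuous_const.prodMk continuous_id))) continuous_const

theorem setIntegral_add_subgroup {K : AddSubgroup A} {c : A} (hc : c ∈ K) (g : A → ℂ) :
    ∫ x in K, g (x + c) ∂μ = ∫ x in K, g x ∂μ := by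
  have h := (measurePreserving_add_right μ c).setIntegral_preimage_emb
    (MeasurableEquiv.addRight c).measurableEmbedding g K
  have hK : (fun x => x + c) ⁻¹' (K : Set A) = K := by
    ext x
    exact K.add_mem_cancel_right hc
  rw [hK] at h
  exact h

-- Orthogonality of characters: translation by c ∈ K multiplies the integral by ψ(-q(c, y)).
open Classical in
theorem setIntegral_char {K : AddSubgroup A} (hK : MeasurableSet (K : Set A)) (y : A) :
    ∫ x in K, (ψ (-q x y) : ℂ) ∂μ = if y ∈ annihilator ψ q K then (μ.real K : ℂ) else 0 := by
  split_ifs with hy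
  · have h : ∀ x ∈ (K : Set A), (ψ (-q x y) : ℂ) = 1 := fun x hx => by
      rw [AddChar.map_neg_eq_inv, mem_annihilator.1 hy x hx, inv_one, Circle.coe_one]
    rw [setIntegral_congr_fun hK h]
    simp
  · rw [mem_annihilator] at hy
    push Not at hy
    obtain ⟨c, hc, hc1⟩ := hy
    have h := setIntegral_add_subgroup (μ := μ) hc fun x => (ψ (-q x y) : ℂ)
    have h1 : ∀ x, (ψ (-q (x + c) y) : ℂ) = ψ (-q c y) * ψ (-q x y) := fun x => by
      rw [map_add, LinearMap.add_apply, neg_add_rev, AddChar.map_add_eq_mul, Circle.coe_mul]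
    simp_rw [h1] at h
    rw [integral_const_mul] at h
    have h2 : (ψ (-q c y) : ℂ) ≠ 1 := fun h3 => hc1 (by
      rw [AddChar.map_neg_eq_inv] at h3
      exact inv_eq_one.1 (Circle.ext h3))
    have h4 : ((ψ (-q c y) : ℂ) - 1) * ∫ x in K, (ψ (-q x y) : ℂ) ∂μ = 0 := by
      linear_combination h
    exact (mul_eq_zero.1 h4).resolve_left (sub_ne_zero.2 h2)

theorem fourier_indicator {K : AddSubgroup A} (hK : MeasurableSet (K : Set A)) :
    fourier ψ q μ (Set.indicator K 1) =
      Set.indicator (annihilator ψ q K) fun _ => (μ.real K : ℂ) := by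
  ext y
  classical
  rw [fourier_apply, Set.indicator_apply]
  refine Eq.trans ?_ (setIntegral_char (ψ := ψ) (q := q) (μ := μ) hK y)
  rw [← integral_indicator hK]
  refine integral_congr_ae (.of_forall fun x => ?_)
  by_cases hx : x ∈ (K : Set A) <;> simp [hx]

/-- A chain of compact open subgroups adapted to the pairing `ψ ∘ q`. -/
structure IsLatticeChain (ψ : AddChar F Circle) (q : LinearMap.BilinForm F A)
    (C : ℕ → AddSubgroup A) : Prop where
  antitone : Antitone C
  isOpen : ∀ k, IsOpen (C k : Set A)
  isCompact : ∀ k, IsCompact (C k : Set A)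
  isCompact_annihilator : ∀ k, IsCompact (annihilator ψ q (C k) : Set A)
  exists_mem : ∀ y, ∃ k, y ∈ annihilator ψ q (C k)
  le_annihilator : C 0 ≤ annihilator ψ q (C 0)
  quadChar_eq_one : ∀ x ∈ C 0, quadChar ψ q x = 1
  separating : ∀ w, (∀ y, ψ (q y w) = 1) → w = 0

variable {C : ℕ → AddSubgroup A}

theorem IsLatticeChain.isOpen_annihilator (h : IsLatticeChain ψ q C) (k : ℕ) :
    IsOpen (annihilator ψ q (C k) : Set A) :=
  AddSubgroup.isOpen_mono (h.le_annihilator.trans (annihilator_anti (h.antitone k.zero_le)))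
    (h.isOpen 0)

theorem IsLatticeChain.isOpen_annihilator_annihilator (h : IsLatticeChain ψ q C) (hq : q.IsSymm)
    (k : ℕ) : IsOpen (annihilator ψ q (annihilator ψ q (C k)) : Set A) :=
  AddSubgroup.isOpen_mono (le_annihilator_annihilator hq _) (h.isOpen k)

theorem IsLatticeChain.isCompact_annihilator_annihilator (h : IsLatticeChain ψ q C)
    (hψ : Continuous ψ) (hqc : Continuous fun p : A × A => q p.1 p.2) (k : ℕ) :
    IsCompact (annihilator ψ q (annihilator ψ q (C k)) : Set A) := by
  refine (h.isCompact_annihilator 0).of_isClosed_subset (isClosed_annihilator hψ hqc _) ?_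
  exact annihilator_anti (h.le_annihilator.trans (annihilator_anti (h.antitone k.zero_le)))

/-- The double annihilators are compact and decrease to 0, since each y lies in some annihilator and
the pairing separates points. Working with them instead of `C k` avoids having to know that C k is
its own double annihilator. -/
theorem IsLatticeChain.exists_subset (h : IsLatticeChain ψ q C) (hψ : Continuous ψ)
    (hqc : Continuous fun p : A × A => q p.1 p.2) {U : Set A} (hU : U ∈ 𝓝 (0 : A)) :
    ∃ k₀, ∀ k ≥ k₀, (annihilator ψ q (annihilator ψ q (C k)) : Set A) ⊆ U := by
  have hanti : Antitone fun k => (annihilator ψ q (annihilator ψ q (C k)) : Set A) :=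
    fun i j hij => annihilator_anti (annihilator_anti (h.antitone hij))
  obtain ⟨k₀, hk₀⟩ := exists_subset_nhds_of_isCompact (U := U) hanti.directed_ge
    (h.isCompact_annihilator_annihilator hψ hqc) fun x hx => by
      rw [h.separating x fun y => ?_]
      · exact hU
      · obtain ⟨k, hk⟩ := h.exists_mem y
        exact Set.mem_iInter.1 hx k y hk
  exact ⟨k₀, fun k hk => (hanti hk).trans hk₀⟩

/-- Write B for the annihilator of C k. Fubini moves the transform onto a character cut off to B,
whose own transform is vol(B) times a translate of the indicator of B^⊥. -/
theorem IsLatticeChain.partial_inversion (h : IsLatticeChain ψ q C) (hψ : Continuous ψ)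
    (hq : q.IsSymm) (hqc : Continuous fun p : A × A => q p.1 p.2) {φ : A → ℂ}
    (hφ : Integrable φ μ) (x : A) (k : ℕ) :
    ∫ y in annihilator ψ q (C k), (ψ (-q y x) : ℂ) * fourier ψ q μ φ y ∂μ =
      μ.real (annihilator ψ q (C k)) *
        ∫ z in annihilator ψ q (annihilator ψ q (C k)), φ (z - x) ∂μ := by
  have hB := (h.isOpen_annihilator k).measurableSet
  have hE := (h.isOpen_annihilator_annihilator hq k).measurableSet
  have hcont : Continuous fun y : A => (ψ (-q y x) : ℂ) :=
    continuous_subtype_val.comp (hψ.comp (hqc.comp (continuous_id.prodMk continuous_const)).neg)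
  have hg : Integrable (Set.indicator (annihilator ψ q (C k)) fun y => (ψ (-q y x) : ℂ)) μ :=
    (integrable_indicator_iff hB).2
      (hcont.continuousOn.integrableOn_compact (h.isCompact_annihilator k))
  have hflip := integral_fourier_mul hψ hq hqc hφ hg
  have h1 : ∀ z, fourier ψ q μ (Set.indicator (annihilator ψ q (C k))
      fun y => (ψ (-q y x) : ℂ)) z =
      Set.indicator (annihilator ψ q (annihilator ψ q (C k))) (fun _ =>
        (μ.real (annihilator ψ q (C k)) : ℂ)) (x + z) := fun z => by
    classical
    rw [fourier_apply, Set.indicator_apply]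
    refine Eq.trans ?_ (setIntegral_char (ψ := ψ) (q := q) (μ := μ) hB (x + z))
    rw [← integral_indicator hB]
    refine integral_congr_ae (.of_forall fun y => ?_)
    by_cases hy : y ∈ (annihilator ψ q (C k) : Set A)
    · simp only [Set.indicator_of_mem hy]
      rw [map_add, neg_add_rev, AddChar.map_add_eq_mul, Circle.coe_mul]
    · simp only [Set.indicator_of_notMem hy, mul_zero]
  simp_rw [h1] at hflip
  rw [← integral_indicator hB, ← integral_const_mul, ← integral_indicator hE,
    ← integral_add_right_eq_self (μ := μ) (fun a =>
      Set.indicator (annihilator ψ q (annihilator ψ q (C k)) : Set A)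
        (fun a => (μ.real (annihilator ψ q (C k)) : ℂ) * φ (a - x)) a) x]
  refine Eq.trans (integral_congr_ae (.of_forall fun y => ?_))
    (hflip.trans (integral_congr_ae (.of_forall fun z => ?_)))
  · by_cases hy : y ∈ (annihilator ψ q (C k) : Set A)
    · simp only [Set.indicator_of_mem hy, mul_comm]
    · simp only [Set.indicator_of_notMem hy, mul_zero]
  · by_cases hz : z + x ∈ (annihilator ψ q (annihilator ψ q (C k)) : Set A)
    · simp only [Set.indicator_of_mem hz, add_comm x z, add_sub_cancel_right, mul_comm]
    · simp only [Set.indicator_of_notMem hz, add_comm x z, mul_zero]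

theorem measureReal_pos_of_isOpen {K : AddSubgroup A} (hK : IsOpen (K : Set A))
    (hK' : IsCompact (K : Set A)) : 0 < μ.real K :=
  ENNReal.toReal_pos (hK.measure_pos μ ⟨0, K.zero_mem⟩).ne' hK'.measure_lt_top.ne

/-- `vol(B) vol(B^⊥)` is the same for all annihilators `B` of the chain. -/
theorem IsLatticeChain.measure_mul_eq (h : IsLatticeChain ψ q C) (hψ : Continuous ψ)
    (hq : q.IsSymm) (hqc : Continuous fun p : A × A => q p.1 p.2) (k : ℕ) :
    μ.real (annihilator ψ q (C k)) * μ.real (annihilator ψ q (annihilator ψ q (C k))) =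
      μ.real (annihilator ψ q (C 0)) * μ.real (annihilator ψ q (annihilator ψ q (C 0))) := by
  have hE := (h.isOpen_annihilator_annihilator hq 0).measurableSet
  have hEk := (h.isOpen_annihilator_annihilator hq k).measurableSet
  have hBk := (h.isOpen_annihilator k).measurableSet
  have hB := (h.isOpen_annihilator 0).measurableSet
  have hφ : Integrable (Set.indicator (annihilator ψ q (annihilator ψ q (C 0)) : Set A)
      (1 : A → ℂ)) μ :=
    (integrable_indicator_iff hE).2 (continuous_one.continuousOn.integrableOn_compact
      (h.isCompact_annihilator_annihilator hψ hqc 0))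
  -- Partial inversion at 0 for the indicator of the largest double annihilator; its transform is
  -- supported on the smallest annihilator.
  have h1 := h.partial_inversion hψ hq hqc hφ 0 k
  have hBB : (annihilator ψ q (C 0) : Set A) ⊆ annihilator ψ q (C k) :=
    annihilator_anti (h.antitone k.zero_le)
  have hEE : (annihilator ψ q (annihilator ψ q (C k)) : Set A) ⊆
      annihilator ψ q (annihilator ψ q (C 0)) := annihilator_anti hBB
  rw [fourier_indicator hE, annihilator_annihilator_annihilator hq] at h1
  simp only [map_zero, neg_zero, AddChar.map_zero_eq_one, Circle.coe_one, one_mul, sub_zero] at h1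
  rw [setIntegral_indicator hB, Set.inter_eq_right.2 hBB, setIntegral_indicator hE,
    Set.inter_eq_left.2 hEE] at h1
  simp only [setIntegral_const, Pi.one_apply, Complex.real_smul, mul_one] at h1
  exact_mod_cast h1.symm

/-- With vol(B) vol(B^⊥) = 1, partial inversion over B gives the average of `φ` over -x + B^⊥. As B
exhausts `A` these sets shrink to -x. -/
theorem IsLatticeChain.inversion (h : IsLatticeChain ψ q C) (hψ : Continuous ψ)
    (hq : q.IsSymm) (hqc : Continuous fun p : A × A => q p.1 p.2)
    (hμ : μ.real (annihilator ψ q (C 0)) * μ.real (annihilator ψ q (annihilator ψ q (C 0))) = 1)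
    {φ : A → ℂ} (hφ : IsTestFunction ψ q μ φ) (x : A) :
    fourier ψ q μ (fourier ψ q μ φ) x = φ (-x) := by
  have hmono : Monotone fun k => (annihilator ψ q (C k) : Set A) :=
    fun i j hij => annihilator_anti (h.antitone hij)
  have hunion : ⋃ k, (annihilator ψ q (C k) : Set A) = Set.univ :=
    Set.eq_univ_of_forall fun y => Set.mem_iUnion.2 (h.exists_mem y)
  have hcont : Continuous fun y : A => (ψ (-q y x) : ℂ) :=
    continuous_subtype_val.comp (hψ.comp (hqc.comp (continuous_id.prodMk continuous_const)).neg)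
  have hint : Integrable (fun y => (ψ (-q y x) : ℂ) * fourier ψ q μ φ y) μ :=
    hφ.integrable_fourier.bdd_mul hcont.aestronglyMeasurable
      (.of_forall fun y => (Circle.norm_coe _).le)
  have h1 := tendsto_setIntegral_of_monotone (μ := μ)
    (f := fun y => (ψ (-q y x) : ℂ) * fourier ψ q μ φ y)
    (fun k => (h.isOpen_annihilator k).measurableSet) hmono
    (by rw [hunion]; exact hint.integrableOn)
  rw [hunion, setIntegral_univ] at h1
  rw [fourier_apply]
  refine tendsto_nhds_unique h1 ?_
  simp_rw [h.partial_inversion hψ hq hqc hφ.integrable x]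
  rw [Metric.tendsto_atTop]
  intro ε hε
  have hφc : Continuous fun z => φ (z - x) := hφ.continuous.comp (continuous_sub_right x)
  obtain ⟨k₀, hk₀⟩ := h.exists_subset hψ hqc (U := {z | dist (φ (z - x)) (φ (-x)) < ε / 2}) (by
    have := hφc.tendsto 0
    rw [zero_sub] at this
    exact this (Metric.ball_mem_nhds _ (half_pos hε)))
  refine ⟨k₀, fun k hk => ?_⟩
  have hD := (h.measure_mul_eq (μ := μ) hψ hq hqc k).trans hμ
  have hEc := h.isCompact_annihilator_annihilator hψ hqc k
  have hE : MeasurableSet (annihilator ψ q (annihilator ψ q (C k)) : Set A) :=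
    hEc.measurableSet
  have hsub : ∫ z in annihilator ψ q (annihilator ψ q (C k)), (φ (z - x) - φ (-x)) ∂μ =
      ∫ z in annihilator ψ q (annihilator ψ q (C k)), φ (z - x) ∂μ -
        μ.real (annihilator ψ q (annihilator ψ q (C k))) * φ (-x) := by
    rw [integral_sub (hφc.continuousOn.integrableOn_compact hEc)
      (continuous_const.continuousOn.integrableOn_compact hEc)]
    simp
  have hnorm : ‖∫ z in annihilator ψ q (annihilator ψ q (C k)), (φ (z - x) - φ (-x)) ∂μ‖ ≤
      ε / 2 * μ.real (annihilator ψ q (annihilator ψ q (C k))) := by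
    refine norm_setIntegral_le_of_norm_le_const hEc.measure_lt_top fun z hz => ?_
    rw [← dist_eq_norm]
    exact (hk₀ k hk hz).le
  have hBnn : 0 ≤ μ.real (annihilator ψ q (C k)) := measureReal_nonneg
  rw [dist_eq_norm]
  have e1 : (μ.real (annihilator ψ q (C k)) : ℂ) *
      ∫ z in annihilator ψ q (annihilator ψ q (C k)), φ (z - x) ∂μ - φ (-x) =
      μ.real (annihilator ψ q (C k)) *
        ∫ z in annihilator ψ q (annihilator ψ q (C k)), (φ (z - x) - φ (-x)) ∂μ := by
    rw [hsub, mul_sub, ← mul_assoc, ← Complex.ofReal_mul, hD, Complex.ofReal_one, one_mul]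
  rw [e1, norm_mul, Complex.norm_real, Real.norm_of_nonneg hBnn]
  calc _ ≤ μ.real (annihilator ψ q (C k)) *
        (ε / 2 * μ.real (annihilator ψ q (annihilator ψ q (C k)))) := by gcongr
    _ = ε / 2 * (μ.real (annihilator ψ q (C k)) *
        μ.real (annihilator ψ q (annihilator ψ q (C k)))) := by ring
    _ < ε := by rw [hD]; linarith

theorem IsLatticeChain.exists_measure (h : IsLatticeChain ψ q C) (hψ : Continuous ψ)
    (hq : q.IsSymm) (hqc : Continuous fun p : A × A => q p.1 p.2) :
    ∃ μ : Measure A, μ.IsAddHaarMeasure ∧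
      μ.real (annihilator ψ q (C 0)) * μ.real (annihilator ψ q (annihilator ψ q (C 0))) = 1 := by
  let ν : Measure A := Measure.addHaar
  have h1 : 0 < ν.real (annihilator ψ q (C 0)) := measureReal_pos_of_isOpen
    (h.isOpen_annihilator 0) (h.isCompact_annihilator 0)
  have h2 : 0 < ν.real (annihilator ψ q (annihilator ψ q (C 0))) := measureReal_pos_of_isOpen
    (h.isOpen_annihilator_annihilator hq 0) (h.isCompact_annihilator_annihilator hψ hqc 0)
  set D := ν.real (annihilator ψ q (C 0)) * ν.real (annihilator ψ q (annihilator ψ q (C 0)))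
    with hD
  have hD0 : 0 < D := mul_pos h1 h2
  let s : NNReal := ⟨(Real.sqrt D)⁻¹, by positivity⟩
  have hs : s ≠ 0 := fun h0 => by
    have : (Real.sqrt D)⁻¹ = 0 := congrArg NNReal.toReal h0
    exact (Real.sqrt_pos.2 hD0).ne' (inv_eq_zero.1 this)
  refine ⟨s • ν, Measure.IsAddHaarMeasure.nnreal_smul ν hs, ?_⟩
  simp only [measureReal_nnreal_smul_apply]
  change ((Real.sqrt D)⁻¹ * _) * ((Real.sqrt D)⁻¹ * _) = 1
  rw [mul_mul_mul_comm, ← hD, ← mul_inv, Real.mul_self_sqrt hD0.le, inv_mul_cancel₀ hD0.ne']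

theorem fourier_quadChar_indicator {K : AddSubgroup A} (hK : MeasurableSet (K : Set A)) (y : A) :
    fourier ψ q μ (fun x => quadChar ψ q x * Set.indicator K 1 x) y =
      ∫ x in K, (ψ (-q x y) : ℂ) * quadChar ψ q x ∂μ := by
  rw [fourier_apply, ← integral_indicator hK]
  refine integral_congr_ae (.of_forall fun x => ?_)
  by_cases hx : x ∈ (K : Set A)
  · simp only [Set.indicator_of_mem hx, Pi.one_apply, mul_one]
  · simp only [Set.indicator_of_notMem hx, mul_zero]

/-- Completing the square, after a translation by y ∈ K. -/
theorem fourier_quadChar_indicator_of_mem (h2 : (2 : F) ≠ 0) (hq : q.IsSymm) {K : AddSubgroup A}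
    (hK : MeasurableSet (K : Set A)) {y : A} (hy : y ∈ K) :
    fourier ψ q μ (fun x => quadChar ψ q x * Set.indicator K 1 x) y =
      quadChar ψ (-q) y * ∫ x in K, quadChar ψ q x ∂μ := by
  rw [fourier_quadChar_indicator hK, ← setIntegral_add_subgroup hy]
  have h3 : ∀ x, (ψ (-q (x + y) y) : ℂ) * quadChar ψ q (x + y) =
      quadChar ψ (-q) y * quadChar ψ q x := fun x => by
    rw [quadChar, quadChar, quadChar, ← Circle.coe_mul, ← Circle.coe_mul,
      ← AddChar.map_add_eq_mul, ← AddChar.map_add_eq_mul]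
    congr 2
    simp only [map_add, LinearMap.add_apply, LinearMap.neg_apply, hq.eq y x]
    field_simp
    ring
  simp_rw [h3]
  rw [integral_const_mul]

theorem IsLatticeChain.le_annihilator_self (h : IsLatticeChain ψ q C) (k : ℕ) :
    C k ≤ annihilator ψ q (C k) :=
  (h.antitone k.zero_le).trans (h.le_annihilator.trans (annihilator_anti (h.antitone k.zero_le)))

theorem IsLatticeChain.quadChar_neg_eq_one (h : IsLatticeChain ψ q C) {y : A} (hy : y ∈ C 0) :
    quadChar ψ (-q) y = 1 := by
  have h5 := h.quadChar_eq_one y hy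
  rw [quadChar] at h5 ⊢
  rw [LinearMap.neg_apply, LinearMap.neg_apply, mul_neg, AddChar.map_neg_eq_inv,
    Circle.coe_inv, h5, inv_one]

/-- The Gauss sums over the lattices of the chain coincide. -/
theorem IsLatticeChain.gauss_eq (h : IsLatticeChain ψ q C) (h2 : (2 : F) ≠ 0)
    (hψ : Continuous ψ) (hq : q.IsSymm)
    (hqc : Continuous fun p : A × A => q p.1 p.2) (k : ℕ) :
    ∫ x in annihilator ψ q (C k), quadChar ψ q x ∂μ =
      ∫ x in annihilator ψ q (C 0), quadChar ψ q x ∂μ := by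
  have hB := (h.isOpen_annihilator k).measurableSet
  have hB0 := (h.isOpen_annihilator 0).measurableSet
  have hC0 := (h.isCompact 0).measurableSet
  have hf : Integrable (Set.indicator (C 0 : Set A) (1 : A → ℂ)) μ :=
    (integrable_indicator_iff hC0).2 (continuous_one.continuousOn.integrableOn_compact
      (h.isCompact 0))
  have hquad := continuous_quadChar hψ hqc
  have hg : Integrable (fun x => quadChar ψ q x *
      Set.indicator (annihilator ψ q (C k) : Set A) 1 x) μ :=
    ((integrable_indicator_iff hB).2 (continuous_one.continuousOn.integrableOn_compact
      (h.isCompact_annihilator k))).bdd_mul hquad.aestronglyMeasurable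
        (.of_forall fun x => (norm_quadChar q x).le)
  have hCB : C 0 ≤ annihilator ψ q (C k) :=
    h.le_annihilator.trans (annihilator_anti (h.antitone k.zero_le))
  have hBB : (annihilator ψ q (C 0) : Set A) ⊆ annihilator ψ q (C k) :=
    annihilator_anti (h.antitone k.zero_le)
  -- Pair the indicator of C 0 with f_q cut off to the k-th annihilator. One side is vol(C 0) times
  -- the Gauss sum at level 0, the other vol(C 0) times the one at level k.
  have hflip := integral_fourier_mul hψ hq hqc hf hg
  rw [fourier_indicator hC0] at hflip
  have h1 : ∀ x, Set.indicator (annihilator ψ q (C 0) : Set A) (fun _ => (μ.real (C 0) : ℂ)) x *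
      (quadChar ψ q x * Set.indicator (annihilator ψ q (C k) : Set A) 1 x) =
      Set.indicator (annihilator ψ q (C 0) : Set A)
        (fun x => (μ.real (C 0) : ℂ) * quadChar ψ q x) x := fun x => by
    by_cases hx : x ∈ (annihilator ψ q (C 0) : Set A)
    · simp only [Set.indicator_of_mem hx, Set.indicator_of_mem (hBB hx), Pi.one_apply, mul_one]
    · simp only [Set.indicator_of_notMem hx, zero_mul]
  have h3 : ∀ x, Set.indicator (C 0 : Set A) 1 x * fourier ψ q μ (fun x => quadChar ψ q x *
      Set.indicator (annihilator ψ q (C k) : Set A) 1 x) x = Set.indicator (C 0 : Set A)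
        (fun _ => ∫ x in annihilator ψ q (C k), quadChar ψ q x ∂μ) x := fun x => by
    by_cases hx : x ∈ (C 0 : Set A)
    · simp only [Set.indicator_of_mem hx]
      rw [fourier_quadChar_indicator_of_mem h2 hq hB (hCB hx), h.quadChar_neg_eq_one hx,
        Pi.one_apply, one_mul, one_mul]
    · simp only [Set.indicator_of_notMem hx, zero_mul]
  simp_rw [h1, h3] at hflip
  rw [integral_indicator hB0, integral_indicator hC0, integral_const_mul, setIntegral_const,
    Complex.real_smul] at hflip
  exact (mul_left_cancel₀ (Complex.ofReal_ne_zero.2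
    (measureReal_pos_of_isOpen (h.isOpen 0) (h.isCompact 0)).ne') hflip).symm

/-- On the annihilator of C k complete the square. Outside it, translate by some c ∈ C k with ψ(q(c,
y)) ≠ 1: this does not affect f_q there, so the integral vanishes. -/
theorem IsLatticeChain.fourier_quadChar (h : IsLatticeChain ψ q C) (h2 : (2 : F) ≠ 0)
    (hψ : Continuous ψ) (hq : q.IsSymm)
    (hqc : Continuous fun p : A × A => q p.1 p.2) (k : ℕ) (y : A) :
    fourier ψ q μ (fun x => quadChar ψ q x * Set.indicator (annihilator ψ q (C k)) 1 x) y =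
      Set.indicator (annihilator ψ q (C k)) (fun y => quadChar ψ (-q) y) y *
        ∫ x in annihilator ψ q (C 0), quadChar ψ q x ∂μ := by
  have hB := (h.isOpen_annihilator k).measurableSet
  by_cases hy : y ∈ (annihilator ψ q (C k) : Set A)
  · rw [Set.indicator_of_mem hy, fourier_quadChar_indicator_of_mem h2 hq hB hy,
      h.gauss_eq h2 hψ hq hqc]
  · rw [Set.indicator_of_notMem hy, zero_mul, fourier_quadChar_indicator hB]
    have hy' : ¬ ∀ x ∈ C k, ψ (q x y) = 1 := hy
    push Not at hy'
    obtain ⟨c, hc, hc1⟩ := hy'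
    have h3 := setIntegral_add_subgroup (μ := μ) (h.le_annihilator_self k hc)
      fun x => (ψ (-q x y) : ℂ) * quadChar ψ q x
    have h4 : ∀ x ∈ (annihilator ψ q (C k) : Set A),
        (ψ (-q (x + c) y) : ℂ) * quadChar ψ q (x + c) =
          ψ (-q c y) * ((ψ (-q x y) : ℂ) * quadChar ψ q x) := fun x hx => by
      have hadd : quadChar ψ q (x + c) = quadChar ψ q x * quadChar ψ q c * ψ (q x c) := by
        rw [quadChar, quadChar, quadChar, ← Circle.coe_mul, ← Circle.coe_mul,
          ← AddChar.map_add_eq_mul, ← AddChar.map_add_eq_mul]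
        congr 2
        simp only [map_add, LinearMap.add_apply, hq.eq c x]
        field_simp
        ring
      rw [hadd, h.quadChar_eq_one c (h.antitone k.zero_le hc), hq.eq x c, mem_annihilator.1 hx c hc,
        Circle.coe_one, map_add, LinearMap.add_apply, neg_add_rev, AddChar.map_add_eq_mul,
        Circle.coe_mul]
      ring
    rw [setIntegral_congr_fun hB h4, integral_const_mul] at h3
    have h5 : (ψ (-q c y) : ℂ) ≠ 1 := fun h3 => hc1 (by
      rw [AddChar.map_neg_eq_inv] at h3
      exact inv_eq_one.1 (Circle.ext h3))
    have h6 : ((ψ (-q c y) : ℂ) - 1) *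
        ∫ x in annihilator ψ q (C k), (ψ (-q x y) : ℂ) * quadChar ψ q x ∂μ = 0 := by
      linear_combination h3
    exact (mul_eq_zero.1 h6).resolve_left (sub_ne_zero.2 h5)

/-- The indicators of the annihilators approximate 1, the common Gauss sum is the constant, and the
indicator of C 0 is the test function. -/
theorem IsLatticeChain.exists_const (h : IsLatticeChain ψ q C) (h2 : (2 : F) ≠ 0)
    (hψ : Continuous ψ) (hq : q.IsSymm) (hqc : Continuous fun p : A × A => q p.1 p.2) :
    (∃ c, IsWeilConstant ψ q c) ∧ HasTestFunction ψ q := by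
  obtain ⟨μ, hμ, hμ1⟩ := h.exists_measure hψ hq hqc
  have hdual : IsSelfDualMeasure ψ q μ := ⟨hμ, fun φ hφ x => h.inversion hψ hq hqc hμ1 hφ x⟩
  have hint : ∀ K : AddSubgroup A, IsCompact (K : Set A) →
      Integrable (Set.indicator (K : Set A) (1 : A → ℂ)) μ := fun K hK =>
    (integrable_indicator_iff hK.measurableSet).2
      (continuous_one.continuousOn.integrableOn_compact hK)
  refine ⟨⟨∫ x in annihilator ψ q (C 0), quadChar ψ q x ∂μ, μ, hdual, fun φ hφ => ?_⟩,
    μ, Set.indicator (C 0) 1, hdual, ⟨?_, hint _ (h.isCompact 0), ?_⟩, ?_⟩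
  · refine integral_quadChar_fourier (H := fun k => Set.indicator (annihilator ψ q (C k)) 1)
      (C := ‖∫ x in annihilator ψ q (C 0), quadChar ψ q x ∂μ‖) hψ hq hqc
      (fun k => hint _ (h.isCompact_annihilator k)) (fun k x => ?_) (fun x => ?_) (fun k y => ?_)
      (fun y => ?_) hφ
    · by_cases hx : x ∈ (annihilator ψ q (C k) : Set A) <;> simp [hx]
    · obtain ⟨k₀, hk₀⟩ := h.exists_mem x
      refine tendsto_const_nhds.congr' ?_
      filter_upwards [eventually_ge_atTop k₀] with k hk
      exact (Set.indicator_of_mem (s := (annihilator ψ q (C k) : Set A))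
        (annihilator_anti (h.antitone hk) hk₀) (1 : A → ℂ)).symm
    · rw [h.fourier_quadChar h2 hψ hq hqc, norm_mul]
      refine mul_le_of_le_one_left (norm_nonneg _) ?_
      by_cases hy : y ∈ (annihilator ψ q (C k) : Set A)
      · rw [Set.indicator_of_mem hy, norm_quadChar]
      · rw [Set.indicator_of_notMem hy, norm_zero]
        exact zero_le_one
    · obtain ⟨k₀, hk₀⟩ := h.exists_mem y
      refine tendsto_const_nhds.congr' ?_
      filter_upwards [eventually_ge_atTop k₀] with k hk
      rw [h.fourier_quadChar h2 hψ hq hqc,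
        Set.indicator_of_mem (annihilator_anti (h.antitone hk) hk₀), mul_comm]
  · refine continuous_one.indicator ?_
    rw [IsClopen.frontier_eq ⟨(h.isCompact 0).isClosed, h.isOpen 0⟩]
    simp
  · rw [fourier_indicator (h.isCompact 0).measurableSet]
    exact (integrable_indicator_iff (h.isCompact_annihilator 0).measurableSet).2
      (continuous_const.continuousOn.integrableOn_compact (h.isCompact_annihilator 0))
  · have h3 : ∀ y, quadChar ψ (-q) y * Set.indicator (C 0 : Set A) 1 y =
        Set.indicator (C 0 : Set A) (1 : A → ℂ) y := fun y => by
      by_cases hy : y ∈ (C 0 : Set A)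
      · rw [h.quadChar_neg_eq_one hy, one_mul]
      · rw [Set.indicator_of_notMem hy, mul_zero]
    simp_rw [h3]
    rw [integral_indicator (h.isCompact 0).measurableSet]
    simp only [Pi.one_apply, integral_const, MeasurableSet.univ, measureReal_restrict_apply,
      Set.univ_inter, Complex.real_smul, mul_one]
    exact Complex.ofReal_ne_zero.2 (measureReal_pos_of_isOpen (h.isOpen 0) (h.isCompact 0)).ne'

end Lattice

/-! ### Ultrametric fields: existence of Weil constants. -/

section Ultrametric

open Filter Topology

variable {F : Type*} [Field F] [TopologicalSpace F]

/-- The topology of `F` is given by an ultrametric absolute value with compact balls. -/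
structure IsUltrametricAbs (v : AbsoluteValue F ℝ) : Prop where
  add_le : ∀ x y, v (x + y) ≤ max (v x) (v y)
  basis : (𝓝 (0 : F)).HasBasis (fun r : ℝ => 0 < r) fun r => {x | v x ≤ r}
  isCompact : ∀ r, IsCompact {x | v x ≤ r}

theorem addChar_sum {ι : Type*} (ψ : AddChar F Circle) (s : Finset ι) (f : ι → F) :
    ψ (∑ i ∈ s, f i) = ∏ i ∈ s, ψ (f i) := by
  classical
  induction s using Finset.induction_on with
  | empty => simp
  | insert i s hi ih => rw [Finset.sum_insert hi, Finset.prod_insert hi, AddChar.map_add_eq_mul, ih]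

/-- No small subgroups: as long as the powers stay within 1/2 of 1, squaring multiplies the distance
to 1 by at least 3/2. -/
theorem eq_one_of_pow_near_one {z : ℂ} (h : ∀ n : ℕ, ‖z ^ n - 1‖ ≤ 1 / 2) : z = 1 := by
  have hgrow : ∀ n : ℕ, (3 / 2 : ℝ) ^ n * ‖z - 1‖ ≤ ‖z ^ 2 ^ n - 1‖ := fun n => by
    induction n with
    | zero => simp
    | succ n ih =>
      have h1 : z ^ 2 ^ (n + 1) - 1 = (z ^ 2 ^ n - 1) * (z ^ 2 ^ n + 1) := by ring
      have h2 : (3 / 2 : ℝ) ≤ ‖z ^ 2 ^ n + 1‖ := by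
        have h3 : (2 : ℂ) = (z ^ 2 ^ n + 1) - (z ^ 2 ^ n - 1) := by ring
        have h4 := norm_sub_le (z ^ 2 ^ n + 1) (z ^ 2 ^ n - 1)
        rw [← h3, Complex.norm_ofNat] at h4
        have := h (2 ^ n)
        linarith
      rw [h1, norm_mul, pow_succ]
      calc _ = (3 / 2 : ℝ) ^ n * ‖z - 1‖ * (3 / 2) := by ring
        _ ≤ _ := by gcongr
  by_contra hz
  have hpos : 0 < ‖z - 1‖ := norm_pos_iff.2 (sub_ne_zero.2 hz)
  obtain ⟨n, hn⟩ := pow_unbounded_of_one_lt (1 / ‖z - 1‖) (by norm_num : (1 : ℝ) < 3 / 2)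
  rw [div_lt_iff₀ hpos] at hn
  have := hgrow n
  have := h (2 ^ n)
  linarith

variable [IsTopologicalRing F] {v : AbsoluteValue F ℝ} (hv : IsUltrametricAbs v)
include hv

/-- A closed ball as a subgroup. -/
def IsUltrametricAbs.ball (r : ℝ) (hr : 0 ≤ r) : AddSubgroup F where
  carrier := {x | v x ≤ r}
  zero_mem' := by simpa using hr
  add_mem' := fun {a b} ha hb => (hv.add_le a b).trans (max_le ha hb)
  neg_mem' := fun {a} ha => by
    rw [Set.mem_ofPred_eq, v.map_neg]
    exact ha

theorem IsUltrametricAbs.isOpen_ball {r : ℝ} (hr : 0 < r) : IsOpen (hv.ball r hr.le : Set F) :=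
  AddSubgroup.isOpen_of_mem_nhds _ (g := 0) (hv.basis.mem_of_mem hr)

theorem IsUltrametricAbs.locallyCompactSpace : LocallyCompactSpace F :=
  (hv.isCompact 1).locallyCompactSpace_of_mem_nhds_of_addGroup (hv.basis.mem_of_mem one_pos)

theorem IsUltrametricAbs.t2Space : T2Space F := by
  have : T1Space F := IsTopologicalAddGroup.t1Space F (by
    rw [← isOpen_compl_iff, isOpen_iff_mem_nhds]
    intro x hx
    have hx0 : 0 < v x := v.pos hx
    have h1 : {y | v y ≤ v x / 2} ∈ 𝓝 (0 : F) := hv.basis.mem_of_mem (half_pos hx0)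
    have h2 : Tendsto (fun y => y - x) (𝓝 x) (𝓝 0) := by
      have := (continuous_sub_right x).tendsto x
      rwa [sub_self] at this
    filter_upwards [h2 h1] with y hy h0
    rw [Set.mem_singleton_iff] at h0
    have hy : v (y - x) ≤ v x / 2 := hy
    rw [h0, zero_sub, v.map_neg] at hy
    linarith)
  infer_instance

theorem IsUltrametricAbs.secondCountableTopology : SecondCountableTopology F := by
  let _ : UniformSpace F := IsTopologicalAddGroup.rightUniformSpace F
  have : IsUniformAddGroup F := isUniformAddGroup_of_addCommGroup
  have hb : (𝓝 (0 : F)).HasBasis (fun _ : ℕ => True) fun n => {x | v x ≤ 1 / ((n : ℝ) + 1)} :=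
    hv.basis.to_hasBasis (fun r hr => by
      obtain ⟨n, hn⟩ := exists_nat_one_div_lt hr
      exact ⟨n, trivial, fun x hx => le_trans hx hn.le⟩)
      fun n _ => ⟨_, Nat.one_div_pos_of_nat, subset_rfl⟩
  have : (𝓝 (0 : F)).IsCountablyGenerated := hb.isCountablyGenerated
  have := IsUniformAddGroup.uniformity_countably_generated (α := F)
  have : SigmaCompactSpace F := ⟨⟨fun n : ℕ => {x | v x ≤ n}, fun n => hv.isCompact n,
    Set.eq_univ_of_forall fun x => Set.mem_iUnion.2 (exists_nat_ge (v x))⟩⟩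
  infer_instance

theorem IsUltrametricAbs.exists_char_eq_one {ψ : AddChar F Circle} (hψ : Continuous ψ) :
    ∃ r > 0, ∀ x, v x ≤ r → ψ x = 1 := by
  have h1 : Tendsto (fun x => (ψ x : ℂ)) (𝓝 0) (𝓝 1) := by
    have := (continuous_subtype_val.comp hψ).tendsto 0
    have h0 : (Subtype.val ∘ ψ) 0 = (1 : ℂ) := by
      change (ψ 0 : ℂ) = 1
      rw [AddChar.map_zero_eq_one, Circle.coe_one]
    rw [h0] at this
    exact this
  obtain ⟨r, hr, h⟩ := hv.basis.mem_iff.1 (h1 (Metric.closedBall_mem_nhds _ (by norm_num :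
    (0 : ℝ) < 1 / 2)))
  refine ⟨r, hr, fun x hx => Circle.ext (eq_one_of_pow_near_one fun n => ?_)⟩
  have h2 : n • x ∈ hv.ball r hr.le := AddSubgroup.nsmul_mem _ hx n
  have h3 := h h2
  rw [Set.mem_preimage, mem_closedBall_iff_norm, AddChar.map_nsmul_eq_pow, Circle.coe_pow] at h3
  exact h3

variable [LocallyCompactSpace F] [SecondCountableTopology F] [T2Space F]

omit hv [LocallyCompactSpace F] [SecondCountableTopology F] [T2Space F] in
theorem continuous_diagForm {n : ℕ} (a : Fin n → F) :
    Continuous fun p : (Fin n → F) × (Fin n → F) => diagForm a p.1 p.2 := by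
  simp only [diagForm_apply]
  fun_prop

/-- C k is the box |x_i| ≤ s/2^k, with `s` so small that the pairing and f_q are trivial on C 0.
Annihilators are bounded, since for a large y_i the pairing with some vector of the box would be
`t`, where ψ(t) ≠ 1. -/
theorem IsUltrametricAbs.exists_isLatticeChain {ψ : AddChar F Circle} (hψ : Continuous ψ)
    (hψ1 : ψ ≠ 1) {n : ℕ} {a : Fin n → F} (ha : ∀ i, a i ≠ 0) :
    ∃ C, IsLatticeChain ψ (diagForm a) C := by
  obtain ⟨r, hr, hψr⟩ := hv.exists_char_eq_one hψ
  obtain ⟨t, ht⟩ := AddChar.ne_one_iff.1 hψ1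
  have ht0 : t ≠ 0 := fun h => ht (by rw [h, AddChar.map_zero_eq_one])
  have hav : ∀ i, 0 < v (a i) := fun i => v.pos (ha i)
  have hnn : ∀ i, 0 ≤ v (a i) * (1 + v 2⁻¹) := fun i =>
    mul_nonneg (v.nonneg _) (add_nonneg zero_le_one (v.nonneg _))
  -- The factor 1 + |1/2| serves the form and half of the form at once.
  obtain ⟨s, hs, hs1⟩ : ∃ s : ℝ, 0 < s ∧ ∀ i, v (a i) * (1 + v 2⁻¹) * (s * s) ≤ r := by
    have hM : 0 < ∑ i, v (a i) * (1 + v 2⁻¹) + 1 :=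
      add_pos_of_nonneg_of_pos (Finset.sum_nonneg fun i _ => hnn i) one_pos
    set M := ∑ i, v (a i) * (1 + v 2⁻¹) + 1
    refine ⟨min 1 (r / M), lt_min one_pos (div_pos hr hM), fun i => ?_⟩
    have h1 : v (a i) * (1 + v 2⁻¹) ≤ M :=
      (Finset.single_le_sum (fun i _ => hnn i) (Finset.mem_univ i)).trans (by linarith)
    have h2 : (0 : ℝ) ≤ min 1 (r / M) := le_min zero_le_one (div_pos hr hM).le
    calc _ ≤ M * (1 * (r / M)) := by
          gcongr
          · exact min_le_left _ _
          · exact min_le_right _ _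
      _ = r := by field_simp
  have hchar : ∀ x y : Fin n → F, (∀ i, v (a i * (x i * y i)) ≤ r) → ψ (diagForm a x y) = 1 :=
    fun x y h => by
      rw [diagForm_apply, addChar_sum]
      exact Finset.prod_eq_one fun i _ => hψr _ (h i)
  have hsk : ∀ k : ℕ, 0 < s / 2 ^ k := fun k => by positivity
  have hsingle : ∀ i (y : Fin n → F), y i ≠ 0 →
      diagForm a (Pi.single i (t / (a i * y i))) y = t := fun i y hy => by
    rw [diagForm_apply, Finset.sum_eq_single i]
    · rw [Pi.single_eq_same]
      have := ha i
      field_simp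
    · intro j _ hj
      rw [Pi.single_eq_of_ne hj, zero_mul, mul_zero]
    · simp
  let C : ℕ → AddSubgroup (Fin n → F) := fun k =>
    AddSubgroup.pi Set.univ fun _ => hv.ball (s / 2 ^ k) (hsk k).le
  have hC : ∀ k x, x ∈ C k ↔ ∀ i, v (x i) ≤ s / 2 ^ k := fun k x => by
    simp only [C, AddSubgroup.mem_pi, Set.mem_univ, forall_true_left]
    rfl
  have hCset : ∀ k, (C k : Set (Fin n → F)) =
      Set.univ.pi fun _ => (hv.ball (s / 2 ^ k) (hsk k).le : Set F) := fun k => rfl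
  have hbd : ∀ k, ∀ y ∈ annihilator ψ (diagForm a) (C k), ∀ i,
      v (y i) ≤ v t / (v (a i) * (s / 2 ^ k)) := fun k y hy i => by
    by_contra! hlt
    have hy0 : y i ≠ 0 := fun h0 => by
      rw [h0, map_zero] at hlt
      exact absurd hlt (not_lt.2 (div_nonneg (v.nonneg _) (mul_nonneg (v.nonneg _) (hsk k).le)))
    have hyv := v.pos hy0
    refine ht ?_
    rw [← hsingle i y hy0]
    refine hy _ ((hC k _).2 fun j => ?_)
    by_cases hj : j = i
    · subst hj
      rw [Pi.single_eq_same, map_div₀, map_mul]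
      rw [div_lt_iff₀ (mul_pos (hav _) (hsk k))] at hlt
      rw [div_le_iff₀ (mul_pos (hav _) hyv)]
      linarith
    · rw [Pi.single_eq_of_ne hj, map_zero]
      exact (hsk k).le
  have hC0 : ∀ x ∈ C 0, ∀ i, v (x i) ≤ s := fun x hx i => by
    have := (hC 0 x).1 hx i
    rwa [pow_zero, div_one] at this
  have h2v : 0 ≤ v (2⁻¹ : F) := v.nonneg _
  refine ⟨C, ⟨?_, ?_, ?_, ?_, ?_, ?_, ?_, ?_⟩⟩
  · intro j k hjk x hx
    rw [hC] at hx ⊢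
    refine fun i => (hx i).trans ?_
    gcongr
    norm_num
  · intro k
    rw [hCset]
    exact isOpen_set_pi Set.finite_univ fun _ _ => hv.isOpen_ball (hsk k)
  · intro k
    rw [hCset]
    exact isCompact_univ_pi fun _ => hv.isCompact _
  · intro k
    refine IsCompact.of_isClosed_subset (isCompact_univ_pi fun i => hv.isCompact
      (v t / (v (a i) * (s / 2 ^ k)))) (isClosed_annihilator hψ (continuous_diagForm a) _)
      fun y hy i _ => hbd k y hy i
  · intro y
    have hS : 0 < ∑ i, v (a i * y i) * s + 1 := add_pos_of_nonneg_of_pos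
      (Finset.sum_nonneg fun i _ => mul_nonneg (v.nonneg _) hs.le) one_pos
    obtain ⟨k, hk⟩ := exists_pow_lt_of_lt_one (div_pos hr hS) (by norm_num : (1 / 2 : ℝ) < 1)
    refine ⟨k, fun x hx => hchar x y fun i => ?_⟩
    rw [lt_div_iff₀ hS] at hk
    have h1 : v (a i * y i) * s ≤ ∑ i, v (a i * y i) * s + 1 :=
      (Finset.single_le_sum (f := fun i => v (a i * y i) * s)
        (fun i _ => mul_nonneg (v.nonneg _) hs.le) (Finset.mem_univ i)).trans (by linarith)
    calc v (a i * (x i * y i)) = v (a i * y i) * v (x i) := by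
          rw [← map_mul]
          congr 1
          ring
      _ ≤ v (a i * y i) * (s / 2 ^ k) := by
          gcongr
          exact (hC k x).1 hx i
      _ = (1 / 2) ^ k * (v (a i * y i) * s) := by
          rw [one_div, inv_pow]
          ring
      _ ≤ (1 / 2) ^ k * (∑ i, v (a i * y i) * s + 1) := by gcongr
      _ ≤ r := hk.le
  · intro y hy x hx
    refine hchar x y fun i => ?_
    rw [map_mul, map_mul]
    refine le_trans ?_ (hs1 i)
    gcongr
    · have := hav i
      nlinarith
    · exact hC0 x hx i
    · exact hC0 y hy i
  · intro x hx
    rw [quadChar, ← Circle.coe_one, diagForm_apply, Finset.mul_sum, addChar_sum]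
    congr 1
    refine Finset.prod_eq_one fun i _ => hψr _ ?_
    rw [mul_left_comm, map_mul, map_mul, map_mul, ← mul_assoc]
    refine le_trans ?_ (hs1 i)
    gcongr
    · linarith
    · exact hC0 x hx i
    · exact hC0 x hx i
  · intro w hw
    ext i
    by_contra hwi
    refine ht ?_
    rw [← hsingle i w hwi]
    exact hw _

theorem IsUltrametricAbs.hasWeilTheory (h2 : (2 : F) ≠ 0) {ψ : AddChar F Circle}
    (hψ : Continuous ψ) (hψ1 : ψ ≠ 1) : HasWeilTheory ψ where
  two_ne_zero := h2
  continuous := hψ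
  exists_const n a ha := by
    let _ : MeasurableSpace (Fin n → F) := borel (Fin n → F)
    have : BorelSpace (Fin n → F) := ⟨rfl⟩
    obtain ⟨C, hC⟩ := hv.exists_isLatticeChain hψ hψ1 ha
    exact hC.exists_const h2 hψ (diagForm_isSymm a) (continuous_diagForm a)

end Ultrametric

/-! ### The Herbrand quotient of a finite group with an involution. -/

section Herbrand

theorem mul_mem_of_index_le_two {A : Type*} [CommGroup A] {H : Subgroup A} (hH : H.index ≠ 0)
    (h2 : H.index ≤ 2) {a b : A} (ha : a ∉ H) (hb : b ∉ H) : a * b ∈ H := by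
  have h1 : H.index ≠ 1 := fun h => ha (by rw [Subgroup.index_eq_one.1 h]; trivial)
  have : H.index = 2 := by omega
  rw [Subgroup.mul_mem_iff_of_index_two this]
  exact iff_of_false ha hb

theorem index_le_two_of_mul_mem {A : Type*} [CommGroup A] {H : Subgroup A}
    (h : ∀ a b, a ∉ H → b ∉ H → a * b ∈ H) : H.index ≤ 2 := by
  by_cases hH : ∃ a, a ∉ H
  · obtain ⟨a, ha⟩ := hH
    refine (Subgroup.index_eq_two_iff.2 ⟨a, fun b => ?_⟩).le
    by_cases hb : b ∈ H
    · exact Or.inr ⟨hb, fun hba => ha ((H.mul_mem_cancel_left hb).1 hba)⟩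
    · exact Or.inl ⟨h b a hb ha, hb⟩
  · push Not at hH
    rw [(Subgroup.eq_top_iff' H).2 hH, Subgroup.index_top]
    norm_num

variable {A : Type*} [CommGroup A] [Finite A] {σ : A →* A} (hσ : ∀ x, σ (σ x) = x)

include hσ

/-- For N(x) = x σ(x) and D(x) = x / σ(x), both |ker N| |im N| and |ker D| |im D| equal the order of
the group. -/
theorem herbrand_relIndex :
    (MonoidHom.id A * σ).range.relIndex (MonoidHom.id A / σ).ker =
      (MonoidHom.id A / σ).range.relIndex (MonoidHom.id A * σ).ker := by
  have h1 : (MonoidHom.id A * σ).range ≤ (MonoidHom.id A / σ).ker := by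
    rintro _ ⟨x, rfl⟩
    simp [MonoidHom.mem_ker, hσ, mul_comm]
  have h2 : (MonoidHom.id A / σ).range ≤ (MonoidHom.id A * σ).ker := by
    rintro _ ⟨x, rfl⟩
    simp [MonoidHom.mem_ker, hσ]
  have e1 := Subgroup.card_mul_index (MonoidHom.id A * σ).ker
  have e2 := Subgroup.card_mul_index (MonoidHom.id A / σ).ker
  rw [Subgroup.index_ker] at e1 e2
  have e3 := Subgroup.relIndex_mul_relIndex ⊥ _ _ bot_le h1
  have e4 := Subgroup.relIndex_mul_relIndex ⊥ _ _ bot_le h2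
  rw [Subgroup.relIndex_bot_left, Subgroup.relIndex_bot_left] at e3 e4
  rw [← e3] at e2
  rw [← e4] at e1
  have hp1 : 0 < Nat.card (MonoidHom.id A * σ).range := Nat.card_pos
  have hp2 : 0 < Nat.card (MonoidHom.id A / σ).range := Nat.card_pos
  refine Nat.eq_of_mul_eq_mul_left (Nat.mul_pos hp1 hp2) ?_
  linarith

/-- If `ker N / im D` has order at most two, so has `ker D / im N`. -/
theorem herbrand_two
    (h : ∀ z w : A, z * σ z = 1 → w * σ w = 1 → (∀ y, y / σ y ≠ z) → (∀ y, y / σ y ≠ w) →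
      ∃ y, y / σ y = z * w)
    {a b : A} (ha : σ a = a) (hb : σ b = b) (ha' : ∀ y, y * σ y ≠ a) (hb' : ∀ y, y * σ y ≠ b) :
    ∃ y, y * σ y = a * b := by
  have h1 : (MonoidHom.id A / σ).range.relIndex (MonoidHom.id A * σ).ker ≤ 2 := by
    refine index_le_two_of_mul_mem fun z w hz hw => ?_
    obtain ⟨y, hy⟩ := h z w z.2 w.2 (fun y hy => hz ⟨y, hy⟩) (fun y hy => hw ⟨y, hy⟩)
    exact ⟨y, hy⟩
  rw [← herbrand_relIndex hσ] at h1
  have h2 : ∀ x, σ x = x → x ∈ (MonoidHom.id A / σ).ker := fun x hx => by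
    simp [MonoidHom.mem_ker, hx]
  have h3 := mul_mem_of_index_le_two (H := (MonoidHom.id A * σ).range.subgroupOf
    (MonoidHom.id A / σ).ker) Subgroup.index_ne_zero_of_finite h1 (a := ⟨a, h2 a ha⟩)
    (b := ⟨b, h2 b hb⟩) (fun ⟨y, hy⟩ => ha' y hy) (fun ⟨y, hy⟩ => hb' y hy)
  obtain ⟨y, hy⟩ := h3
  exact ⟨y, hy⟩

theorem herbrand_one (h : ∀ z : A, z * σ z = 1 → ∃ y, y / σ y = z) {a : A} (ha : σ a = a) :
    ∃ y, y * σ y = a := by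
  have h1 : (MonoidHom.id A / σ).range.relIndex (MonoidHom.id A * σ).ker = 1 := by
    refine Subgroup.relIndex_eq_one.2 fun z hz => ?_
    obtain ⟨y, hy⟩ := h z hz
    exact ⟨y, hy⟩
  rw [← herbrand_relIndex hσ] at h1
  obtain ⟨y, hy⟩ := Subgroup.relIndex_eq_one.1 h1 (show a ∈ (MonoidHom.id A / σ).ker by
    simp [MonoidHom.mem_ker, ha])
  exact ⟨y, hy⟩

end Herbrand

/-! ### Squares near 1. -/

section LocalSquares

open Filter Topology

variable {F : Type*} [Field F] [TopologicalSpace F] [IsTopologicalRing F] {v : AbsoluteValue F ℝ}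
  (hv : IsUltrametricAbs v)
include hv

theorem IsUltrametricAbs.continuous : Continuous v := by
  rw [continuous_iff_continuousAt]
  intro x
  rw [ContinuousAt, Metric.tendsto_nhds]
  intro ε hε
  have h2 : Tendsto (fun y => y - x) (𝓝 x) (𝓝 0) := by
    have := (continuous_sub_right x).tendsto x
    rwa [sub_self] at this
  filter_upwards [h2 (hv.basis.mem_of_mem (half_pos hε))] with y hy
  have hy : v (y - x) ≤ ε / 2 := hy
  rw [Real.dist_eq]
  have := v.abs_abv_sub_le_abv_sub y x
  linarith

theorem IsUltrametricAbs.sub_le (x y : F) : v (x - y) ≤ max (v x) (v y) := by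
  have := hv.add_le x (-y)
  rwa [v.map_neg, ← sub_eq_add_neg] at this

theorem IsUltrametricAbs.add_le_of_le {x y : F} {r : ℝ} (hx : v x ≤ r) (hy : v y ≤ r) :
    v (x + y) ≤ r := (hv.add_le x y).trans (max_le hx hy)

theorem IsUltrametricAbs.sub_le_of_le {x y : F} {r : ℝ} (hx : v x ≤ r) (hy : v y ≤ r) :
    v (x - y) ≤ r := (hv.sub_le x y).trans (max_le hx hy)

theorem IsUltrametricAbs.one_add {x : F} (hx : v x < 1) : v (1 + x) = 1 := by
  refine le_antisymm (hv.add_le_of_le v.map_one.le hx.le) ?_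
  have h := hv.sub_le (1 + x) x
  rw [add_sub_cancel_right, v.map_one] at h
  exact (le_max_iff.1 h).resolve_right (not_le.2 hx)

theorem IsUltrametricAbs.two_le_one : v 2 ≤ 1 := by
  rw [← one_add_one_eq_two]
  exact hv.add_le_of_le v.map_one.le v.map_one.le

/-- `p ↦ p + p² / 2` is onto the closed ball of radius `r < |2|`. -/
theorem IsUltrametricAbs.exists_add_sq (h2 : (2 : F) ≠ 0) {r : ℝ} (hr : r < v 2) {t : F}
    (ht : v t ≤ r) : ∃ p, v p ≤ r ∧ p + p * p / 2 = t := by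
  have hr0 : 0 ≤ r := (v.nonneg t).trans ht
  have h20 : 0 < v 2 := v.pos h2
  have hsq : ∀ p q : F, v p ≤ r → v q ≤ r → v (p * q / 2) ≤ r := fun p q hp hq => by
    rw [map_div₀, map_mul, div_le_iff₀ h20]
    exact mul_le_mul hp (hq.trans hr.le) (v.nonneg _) hr0
  have hcont : ContinuousOn (fun p => v (p + p * p / 2 - t)) {p | v p ≤ r} :=
    (hv.continuous.comp (by fun_prop)).continuousOn
  -- In place of an iteration, minimise the error `d` on the compact ball. Replacing p by p - d
  -- multiplies it by (d - 2p)/2, of absolute value below 1, so the minimum is 0.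
  obtain ⟨p, hp, hmin⟩ := (hv.isCompact r).exists_isMinOn ⟨0, by simpa using hr0⟩ hcont
  have hp : v p ≤ r := hp
  refine ⟨p, hp, ?_⟩
  by_contra hne
  set d := p + p * p / 2 - t with hd
  have hd0 : d ≠ 0 := sub_ne_zero.2 hne
  have hdr : v d ≤ r := hv.sub_le_of_le (hv.add_le_of_le hp (hsq p p hp hp)) ht
  have hp1 : v (p - d) ≤ r := hv.sub_le_of_le hp hdr
  have h1 : v d ≤ v ((p - d) + (p - d) * (p - d) / 2 - t) := hmin hp1
  have h3 : (p - d) + (p - d) * (p - d) / 2 - t = d * ((d - 2 * p) / 2) := by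
    rw [hd]
    field_simp
    ring
  rw [h3, map_mul] at h1
  have h4 : v ((d - 2 * p) / 2) < 1 := by
    rw [map_div₀, div_lt_one h20]
    refine (hv.sub_le_of_le hdr ?_).trans_lt hr
    rw [map_mul]
    exact (mul_le_of_le_one_left (v.nonneg _) hv.two_le_one).trans hp
  have := v.pos hd0
  nlinarith

/-- The local square theorem. -/
theorem IsUltrametricAbs.isSquare_one_add (h2 : (2 : F) ≠ 0) {t : F} (ht : v t < v 2) :
    ∃ s, 1 + 2 * t = s * s := by
  obtain ⟨p, -, hp⟩ := hv.exists_add_sq h2 ht le_rfl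
  refine ⟨1 + p, ?_⟩
  rw [← hp]
  field_simp
  ring

end LocalSquares

/-! ### The extension F(i) and its principal units. -/

section GaussianExtension

open Filter Topology QuadraticAlgebra

variable {F : Type*} [Field F]

/-- `F[i]` with `i² = -1`. -/
abbrev Gaussian (F : Type*) [Field F] : Type _ := QuadraticAlgebra F (-1) 0

theorem Gaussian.norm_eq (z : Gaussian F) : norm z = z.re * z.re + z.im * z.im := by
  rw [norm_def]
  ring

theorem Gaussian.isSumTwoSq_norm [Fact (∀ r : F, r ^ 2 ≠ -1 + 0 * r)] {z : Gaussian F}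
    (hz : z ≠ 0) : IsSumTwoSq (norm z) :=
  ⟨fun h => hz (norm_eq_zero_iff_eq_zero.1 h), z.re, z.im, by rw [Gaussian.norm_eq]; ring⟩

theorem Gaussian.exists_norm_eq [Fact (∀ r : F, r ^ 2 ≠ -1 + 0 * r)] {a : F}
    (ha : IsSumTwoSq a) : ∃ u : (Gaussian F)ˣ, norm u.1 = a := by
  obtain ⟨ha0, c, d, h⟩ := ha
  have hn : norm (⟨c, d⟩ : Gaussian F) = a := by
    rw [Gaussian.norm_eq, h]
    ring
  refine ⟨Units.mk0 ⟨c, d⟩ fun h0 => ha0 ?_, hn⟩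
  rw [← hn, h0, QuadraticAlgebra.norm_zero]

/-- Conjugation on the units of `F[i]`. -/
def Gaussian.conj : (Gaussian F)ˣ →* (Gaussian F)ˣ :=
  Units.map (starRingEnd (Gaussian F) : Gaussian F →* Gaussian F)

@[simp] theorem Gaussian.coe_conj (u : (Gaussian F)ˣ) : (Gaussian.conj u).1 = star u.1 := rfl

theorem Gaussian.conj_conj (u : (Gaussian F)ˣ) : Gaussian.conj (Gaussian.conj u) = u :=
  Units.ext (star_star u.1)

theorem Gaussian.coe_mul_conj (u : (Gaussian F)ˣ) :
    (u * Gaussian.conj u).1 = algebraMap F (Gaussian F) (norm u.1) := by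
  rw [algebraMap_norm_eq_mul_star, Units.val_mul, Gaussian.coe_conj]

/-- Hilbert 90. -/
theorem Gaussian.exists_div_conj [Fact (∀ r : F, r ^ 2 ≠ -1 + 0 * r)] {z : (Gaussian F)ˣ}
    (hz : norm z.1 = 1) : ∃ y, y / Gaussian.conj y = z := by
  have hz' : z.1 * star z.1 = 1 := by rw [← algebraMap_norm_eq_mul_star, hz, map_one]
  -- y = 1 + z works unless z = -1, in which case y = i does.
  by_cases h : 1 + z.1 = 0
  · have hi : (⟨0, 1⟩ : Gaussian F) ≠ 0 := fun h => by
      simpa using congrArg QuadraticAlgebra.im h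
    refine ⟨Units.mk0 _ hi, ?_⟩
    rw [div_eq_iff_eq_mul]
    ext1
    rw [Units.val_mul, Gaussian.coe_conj, Units.val_mk0, eq_neg_of_add_eq_zero_right h]
    ext <;> simp
  · refine ⟨Units.mk0 _ h, ?_⟩
    rw [div_eq_iff_eq_mul]
    ext1
    rw [Units.val_mul, Gaussian.coe_conj, Units.val_mk0, star_add, star_one, mul_add, mul_one, hz',
      add_comm]

/-- `|re z ± im z| ≤ r`. -/
def Gaussian.IsSmall (v : AbsoluteValue F ℝ) (r : ℝ) (z : Gaussian F) : Prop :=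
  v (z.re + z.im) ≤ r ∧ v (z.re - z.im) ≤ r

variable [TopologicalSpace F] {v : AbsoluteValue F ℝ} (hv : IsUltrametricAbs v)
include hv

theorem Gaussian.IsSmall.add {r : ℝ} {z w : Gaussian F} (hz : IsSmall v r z)
    (hw : IsSmall v r w) : IsSmall v r (z + w) := by
  constructor
  · rw [re_add, im_add, add_add_add_comm]
    exact (hv.add_le _ _).trans (max_le hz.1 hw.1)
  · rw [re_add, im_add, add_sub_add_comm]
    exact (hv.add_le _ _).trans (max_le hz.2 hw.2)

omit hv in
theorem Gaussian.IsSmall.mono {r s : ℝ} {z : Gaussian F} (hz : IsSmall v r z) (h : r ≤ s) :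
    IsSmall v s z := ⟨hz.1.trans h, hz.2.trans h⟩

omit hv in
theorem Gaussian.IsSmall.neg {r : ℝ} {z : Gaussian F} (hz : IsSmall v r z) :
    IsSmall v r (-z) := by
  constructor
  · rw [re_neg, im_neg, ← neg_add, v.map_neg]
    exact hz.1
  · rw [re_neg, im_neg, ← neg_sub', v.map_neg]
    exact hz.2

omit hv in
theorem Gaussian.IsSmall.star {r : ℝ} {z : Gaussian F} (hz : IsSmall v r z) :
    IsSmall v r (star z) := by
  constructor
  · simpa [sub_eq_add_neg] using hz.2
  · simpa [sub_eq_add_neg] using hz.1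

omit hv in
theorem Gaussian.IsSmall.smul {r : ℝ} {z : Gaussian F} (hz : IsSmall v r z) (c : F) :
    IsSmall v (v c * r) (c • z) := by
  constructor
  · rw [re_smul, im_smul, smul_eq_mul, smul_eq_mul, ← mul_add, map_mul]
    exact mul_le_mul_of_nonneg_left hz.1 (v.nonneg _)
  · rw [re_smul, im_smul, smul_eq_mul, smul_eq_mul, ← mul_sub, map_mul]
    exact mul_le_mul_of_nonneg_left hz.2 (v.nonneg _)

/-- For a product, re ± im are half-sums of products of these quantities for the factors; hence the
division by |2|. -/
theorem Gaussian.IsSmall.mul (h2 : (2 : F) ≠ 0) {r s : ℝ} {z w : Gaussian F} (hz : IsSmall v r z)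
    (hw : IsSmall v s w) : IsSmall v (r * s / v 2) (z * w) := by
  have h20 : 0 < v 2 := v.pos h2
  have hr : 0 ≤ r := (v.nonneg _).trans hz.1
  have key : ∀ a b c d : F, v a ≤ r * s → v b ≤ r * s → v c ≤ r * s → v d ≤ r * s →
      v ((a + b + (c - d)) / 2) ≤ r * s / v 2 := fun a b c d ha hb hc hd => by
    rw [map_div₀]
    refine div_le_div_of_nonneg_right ?_ h20.le
    refine (hv.add_le _ _).trans (max_le ((hv.add_le _ _).trans (max_le ha hb)) ?_)
    have := hv.add_le c (-d)
    rw [v.map_neg, ← sub_eq_add_neg] at this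
    exact this.trans (max_le hc hd)
  have hm : ∀ a b : F, v a ≤ r → v b ≤ s → v (a * b) ≤ r * s := fun a b ha hb => by
    rw [map_mul]
    exact mul_le_mul ha hb (v.nonneg _) hr
  constructor
  · convert key _ _ _ _ (hm _ _ hz.1 hw.2) (hm _ _ hz.2 hw.1) (hm _ _ hz.1 hw.1)
      (hm _ _ hz.2 hw.2) using 2
    rw [re_mul, im_mul]
    field_simp
    ring
  · convert key _ _ _ _ (hm _ _ hz.1 hw.2) (hm _ _ hz.2 hw.1) (hm _ _ hz.2 hw.2)
      (hm _ _ hz.1 hw.1) using 2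
    rw [re_mul, im_mul]
    field_simp
    ring

theorem Gaussian.IsSmall.abs_norm_one_add [IsTopologicalRing F] (h2 : (2 : F) ≠ 0) {r : ℝ}
    (hr2 : r ≤ v 2) (hr1 : r < 1) {z : Gaussian F} (hz : IsSmall v r z) : v (norm (1 + z)) = 1 := by
  have h20 : 0 < v 2 := v.pos h2
  have hr : 0 ≤ r := (v.nonneg _).trans hz.1
  set p := z.re + z.im with hp
  set m := z.re - z.im with hm
  have : norm (1 + z) = 1 + (p + m + (p * p / 2 + m * m / 2)) := by
    rw [Gaussian.norm_eq, hp, hm]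
    simp only [re_add, im_add, re_one, im_one]
    field_simp
    ring
  rw [this]
  refine hv.one_add (lt_of_le_of_lt ?_ hr1)
  have hsq : ∀ p : F, v p ≤ r → v (p * p / 2) ≤ r := fun p hp => by
    rw [map_div₀, map_mul, div_le_iff₀ h20]
    exact mul_le_mul hp (hp.trans hr2) (v.nonneg _) hr
  exact hv.add_le_of_le (hv.add_le_of_le hz.1 hz.2) (hv.add_le_of_le (hsq _ hz.1) (hsq _ hz.2))

variable [Fact (∀ r : F, r ^ 2 ≠ -1 + 0 * r)]

omit [TopologicalSpace F] hv in
theorem Gaussian.inv_eq (u : (Gaussian F)ˣ) : (u⁻¹).1 = (norm u.1)⁻¹ • star u.1 := by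
  rw [Units.val_inv_eq_inv_val]
  rfl

theorem Gaussian.isSmall_mul_sub_one (h2 : (2 : F) ≠ 0) {r : ℝ} (hr2 : r ≤ v 2) {a b : Gaussian F}
    (ha : IsSmall v r (a - 1)) (hb : IsSmall v r (b - 1)) : IsSmall v r (a * b - 1) := by
  have h20 : 0 < v 2 := v.pos h2
  have hr : 0 ≤ r := (v.nonneg _).trans ha.1
  have h := (ha.mul hv h2 hb).mono (s := r) (by
    rw [div_le_iff₀ h20]
    exact mul_le_mul_of_nonneg_left hr2 hr)
  convert (h.add hv ha).add hv hb using 1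
  ring

variable [IsTopologicalRing F]

/-- The principal units `1 + s` of `F[i]` with `|re s ± im s| ≤ r`. -/
def Gaussian.principalUnits (h2 : (2 : F) ≠ 0) {r : ℝ} (hr0 : 0 ≤ r) (hr2 : r ≤ v 2)
    (hr1 : r < 1) : Subgroup (Gaussian F)ˣ where
  carrier := {u | IsSmall v r (u.1 - 1)}
  one_mem' := by
    rw [Set.mem_ofPred_eq, Units.val_one, sub_self]
    constructor <;> simpa using hr0
  mul_mem' {a b} ha hb := isSmall_mul_sub_one hv h2 hr2 ha hb
  inv_mem' {u} hu := by
    have hu : IsSmall v r (u.1 - 1) := hu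
    have hn : v (norm u.1) = 1 := by
      have := hu.abs_norm_one_add hv h2 hr2 hr1
      rwa [add_sub_cancel] at this
    have hs : IsSmall v r (star u.1 - 1) := by
      have := hu.star
      rwa [star_sub, star_one] at this
    have h1 : IsSmall v r (u.1 * star u.1 - 1) := isSmall_mul_sub_one hv h2 hr2 hu hs
    have h3 := (hs.add hv h1.neg).smul (norm u.1)⁻¹
    rw [map_inv₀, hn, inv_one, one_mul] at h3
    change IsSmall v r ((u⁻¹).1 - 1)
    convert h3 using 1
    rw [Gaussian.inv_eq, ← algebraMap_norm_eq_mul_star, algebraMap_eq]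
    have hn0 : norm u.1 ≠ 0 := fun h => by
      rw [h, map_zero] at hn
      exact zero_ne_one hn
    ext
    · simp
      field_simp
    · simp

/-- Take re = im = p/2, so that re + im = p and re - im = 0. Then 1 + z has norm 1 + p + p²/2, and
these values fill the ball by `exists_add_sq`. -/
theorem Gaussian.exists_norm_eq_of_abs_sub_one_le (h2 : (2 : F) ≠ 0) {r : ℝ} (hr0 : 0 ≤ r)
    (hr2 : r < v 2) (hr1 : r < 1) {c : F} (hc : v (c - 1) ≤ r) :
    ∃ u ∈ Gaussian.principalUnits hv h2 hr0 hr2.le hr1, norm u.1 = c := by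
  obtain ⟨p, hp, hpc⟩ := hv.exists_add_sq h2 hr2 hc
  have hs : IsSmall v r (⟨p / 2, p / 2⟩ : Gaussian F) := by
    constructor
    · rwa [← add_div, ← two_mul, mul_div_cancel_left₀ _ h2]
    · simpa using hr0
  have hn : norm (1 + (⟨p / 2, p / 2⟩ : Gaussian F)) = c := by
    rw [Gaussian.norm_eq]
    simp only [re_add, im_add, re_one, im_one]
    rw [sub_eq_iff_eq_add.1 hpc.symm]
    field_simp
    ring
  have hn1 := hs.abs_norm_one_add hv h2 hr2.le hr1
  have h0 : (1 + (⟨p / 2, p / 2⟩ : Gaussian F)) ≠ 0 := fun h => by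
    rw [h, QuadraticAlgebra.norm_zero, map_zero] at hn1
    exact zero_ne_one hn1
  refine ⟨Units.mk0 _ h0, ?_, hn⟩
  change IsSmall v r (1 + _ - 1)
  rwa [add_sub_cancel_left]

end GaussianExtension

/-! ### A finite quotient of F(i)ˣ. -/

section GaussianQuotient

open Filter Topology QuadraticAlgebra

variable {F : Type*} [Field F] [TopologicalSpace F] [IsTopologicalRing F]
  {v : AbsoluteValue F ℝ} (hv : IsUltrametricAbs v) [Fact (∀ r : F, r ^ 2 ≠ -1 + 0 * r)]
  (h2 : (2 : F) ≠ 0) {r : ℝ} (hr0 : 0 < r) (hr2 : r < v 2) (hr1 : r < 1) {p : F} (hp : p ≠ 0)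

/-- The image of `Fˣ` in the units of `F[i]`. -/
def Gaussian.ofUnit : Fˣ →* (Gaussian F)ˣ :=
  Units.map (algebraMap F (Gaussian F) : F →* Gaussian F)

@[simp] theorem Gaussian.coe_ofUnit (a : Fˣ) :
    (Gaussian.ofUnit a).1 = algebraMap F (Gaussian F) a.1 := rfl

/-- The norm on the units of `F[i]`. -/
def Gaussian.unitNorm : (Gaussian F)ˣ →* Fˣ := Units.map (QuadraticAlgebra.norm : Gaussian F →* F)

theorem Gaussian.mul_conj (u : (Gaussian F)ˣ) :
    u * Gaussian.conj u = Gaussian.ofUnit (Gaussian.unitNorm u) :=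
  Units.ext (Gaussian.coe_mul_conj u)

theorem Gaussian.unitNorm_ofUnit (a : Fˣ) : Gaussian.unitNorm (Gaussian.ofUnit a) = a ^ 2 :=
  Units.ext (norm_algebraMap a.1)

theorem Gaussian.isSumTwoSq_iff {a : Fˣ} :
    IsSumTwoSq a.1 ↔ ∃ u : (Gaussian F)ˣ, Gaussian.unitNorm u = a := by
  constructor
  · intro h
    obtain ⟨u, hu⟩ := Gaussian.exists_norm_eq h
    exact ⟨u, Units.ext hu⟩
  · rintro ⟨u, rfl⟩
    exact Gaussian.isSumTwoSq_norm u.ne_zero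

/-- The subgroup of the units of `F[i]` generated by principal units and by `p`. -/
def Gaussian.openUnits : Subgroup (Gaussian F)ˣ :=
  Gaussian.principalUnits hv h2 hr0.le hr2.le hr1 ⊔
    Subgroup.zpowers (Gaussian.ofUnit (Units.mk0 p hp))

theorem Gaussian.mem_openUnits {u : (Gaussian F)ˣ} :
    u ∈ Gaussian.openUnits hv h2 hr0 hr2 hr1 hp ↔
      ∃ w ∈ Gaussian.principalUnits hv h2 hr0.le hr2.le hr1, ∃ k : ℤ,
        w * Gaussian.ofUnit (Units.mk0 p hp) ^ k = u := by
  rw [openUnits, Subgroup.mem_sup]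
  simp [Subgroup.mem_zpowers_iff]

theorem Gaussian.conj_ofUnit (a : Fˣ) : Gaussian.conj (Gaussian.ofUnit a) = Gaussian.ofUnit a := by
  ext <;> simp

theorem Gaussian.conj_mem_principalUnits {w : (Gaussian F)ˣ}
    (hw : w ∈ Gaussian.principalUnits hv h2 hr0.le hr2.le hr1) :
    Gaussian.conj w ∈ Gaussian.principalUnits hv h2 hr0.le hr2.le hr1 := by
  have h : IsSmall v r (w.1 - 1) := hw
  have := h.star
  rwa [star_sub, star_one] at this

theorem Gaussian.openUnits_le_comap :
    Gaussian.openUnits hv h2 hr0 hr2 hr1 hp ≤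
      (Gaussian.openUnits hv h2 hr0 hr2 hr1 hp).comap Gaussian.conj := by
  intro u hu
  obtain ⟨w, hw, k, rfl⟩ := (mem_openUnits hv h2 hr0 hr2 hr1 hp).1 hu
  refine (mem_openUnits hv h2 hr0 hr2 hr1 hp).2 ⟨conj w, ?_, k, ?_⟩
  · exact conj_mem_principalUnits hv h2 hr0 hr2 hr1 hw
  · rw [map_mul, map_zpow, conj_ofUnit]

include hv in
theorem Gaussian.isSmall_of_le {a b : F} {s : ℝ} (ha : v a ≤ s) (hb : v b ≤ s) :
    IsSmall v s (⟨a, b⟩ : Gaussian F) :=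
  ⟨hv.add_le_of_le ha hb, hv.sub_le_of_le ha hb⟩

include hp in
omit [TopologicalSpace F] [IsTopologicalRing F] in
theorem Gaussian.exists_scale (hp1 : v p < 1) (u : (Gaussian F)ˣ) :
    ∃ k : ℤ, v p < max (v (p ^ k * u.1.re)) (v (p ^ k * u.1.im)) ∧
      max (v (p ^ k * u.1.re)) (v (p ^ k * u.1.im)) ≤ 1 := by
  have hm : 0 < max (v u.1.re) (v u.1.im) := by
    by_contra h
    have h1 : v u.1.re ≤ 0 := (le_max_left _ _).trans (not_lt.1 h)
    have h2 : v u.1.im ≤ 0 := (le_max_right _ _).trans (not_lt.1 h)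
    refine u.ne_zero (QuadraticAlgebra.ext ?_ ?_)
    · exact (v.nonpos_iff).1 h1
    · exact (v.nonpos_iff).1 h2
  have hp0 : 0 < v p := v.pos hp
  obtain ⟨n, hn1, hn2⟩ := exists_mem_Ioc_zpow hm (one_lt_inv₀ hp0 |>.2 hp1)
  have e : ∀ k : ℤ, max (v (p ^ k * u.1.re)) (v (p ^ k * u.1.im)) =
      v p ^ k * max (v u.1.re) (v u.1.im) := fun k => by
    rw [map_mul, map_mul, map_zpow₀, mul_max_of_nonneg _ _ (zpow_nonneg hp0.le _)]
  refine ⟨n + 1, ?_, ?_⟩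
  · rw [e, zpow_add_one₀ hp0.ne', mul_right_comm]
    refine lt_mul_of_one_lt_left hp0 ?_
    rwa [inv_zpow, inv_lt_iff_one_lt_mul₀ (zpow_pos hp0 _), mul_comm] at hn1
  · rw [e]
    rw [inv_zpow, le_inv_comm₀ hm (zpow_pos hp0 _)] at hn2
    calc _ ≤ (max (v u.1.re) (v u.1.im))⁻¹ * max (v u.1.re) (v u.1.im) :=
          mul_le_mul_of_nonneg_right hn2 hm.le
      _ = 1 := inv_mul_cancel₀ hm.ne'

/-- Modulo powers of `p` each unit has max(|re|, |im|) in [|p|, 1], a compact region. Near a point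
of it, units differ by a principal unit, so finitely many classes suffice. -/
theorem Gaussian.finite_quotient (hp1 : v p < 1) :
    Finite ((Gaussian F)ˣ ⧸ Gaussian.openUnits hv h2 hr0 hr2 hr1 hp) := by
  have h20 : 0 < v 2 := v.pos h2
  have hcv := hv.continuous
  have hp0 : 0 < v p := v.pos hp
  set S : Set (F × F) := ({x | v x ≤ 1} ×ˢ {x | v x ≤ 1}) ∩ {x | v p ≤ max (v x.1) (v x.2)} with hS
  have hSc : IsCompact S := ((hv.isCompact 1).prod (hv.isCompact 1)).inter_right
    (isClosed_le continuous_const ((hcv.comp continuous_fst).max (hcv.comp continuous_snd)))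
  -- Inversion costs a factor 1/|norm| and multiplication a factor 1/|2|; this radius makes the
  -- final bound exactly `r`.
  let ρ : F × F → ℝ := fun t => r * (v 2 * v (norm (⟨t.1, t.2⟩ : Gaussian F)))
  have hne : ∀ t ∈ S, (⟨t.1, t.2⟩ : Gaussian F) ≠ 0 := by
    rintro ⟨a, b⟩ ⟨-, h⟩ h0
    have ha : a = 0 := congrArg QuadraticAlgebra.re h0
    have hb : b = 0 := congrArg QuadraticAlgebra.im h0
    rw [Set.mem_ofPred_eq, ha, hb] at h
    simp only [map_zero, max_self] at h
    exact absurd hp0 (not_lt.2 h)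
  have hρ : ∀ t ∈ S, 0 < ρ t := fun t ht => mul_pos hr0 (mul_pos h20 (v.pos
    fun h => hne t ht (norm_eq_zero_iff_eq_zero.1 h)))
  let N : F × F → Set (F × F) := fun t => {x | v (x.1 - t.1) ≤ ρ t} ∩ {x | v (x.2 - t.2) ≤ ρ t}
  have hN : ∀ t ∈ S, N t ∈ 𝓝 t := by
    intro t ht
    have h : ∀ f : F × F → F, Continuous f → {x | v (f x - f t) ≤ ρ t} ∈ 𝓝 t := fun f hf => by
      have h1 : Tendsto (fun x => v (f x - f t)) (𝓝 t) (𝓝 0) := by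
        have : Continuous fun x => v (f x - f t) := hcv.comp (hf.sub continuous_const)
        have := this.tendsto t
        rwa [sub_self, map_zero] at this
      filter_upwards [h1 (Iio_mem_nhds (hρ t ht))] with x hx
      exact le_of_lt hx
    exact inter_mem (h _ continuous_fst) (h _ continuous_snd)
  obtain ⟨T, hTS, hT⟩ := hSc.elim_nhds_subcover N hN
  let g : T → (Gaussian F)ˣ ⧸ Gaussian.openUnits hv h2 hr0 hr2 hr1 hp := fun t =>
    QuotientGroup.mk (Units.mk0 _ (hne t.1 (hTS t.1 t.2)))
  refine Finite.of_surjective g fun x => ?_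
  obtain ⟨u, rfl⟩ := QuotientGroup.mk_surjective x
  obtain ⟨k, hk1, hk2⟩ := exists_scale hp hp1 u
  have hmem : (p ^ k * u.1.re, p ^ k * u.1.im) ∈ S :=
    ⟨⟨(le_max_left _ _).trans hk2, (le_max_right _ _).trans hk2⟩, hk1.le⟩
  obtain ⟨t, htT, htN⟩ := Set.mem_iUnion₂.1 (hT hmem)
  refine ⟨⟨t, htT⟩, QuotientGroup.eq.2 ((mem_openUnits hv h2 hr0 hr2 hr1 hp).2 ?_)⟩
  set t' := Units.mk0 _ (hne t (hTS t htT)) with ht'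
  have hpt : (Gaussian.ofUnit (Units.mk0 p hp) ^ k * u).1 =
      ⟨p ^ k * u.1.re, p ^ k * u.1.im⟩ := by
    rw [← map_zpow, Units.val_mul, coe_ofUnit, Units.val_zpow_eq_zpow_val, Units.val_mk0,
      ← Algebra.smul_def]
    ext <;> simp
  refine ⟨t'⁻¹ * (Gaussian.ofUnit (Units.mk0 p hp) ^ k * u), ?_, -k, ?_⟩
  · change IsSmall v r ((t'⁻¹ * (Gaussian.ofUnit (Units.mk0 p hp) ^ k * u)).1 - 1)
    have h1 : (t'⁻¹ * (Gaussian.ofUnit (Units.mk0 p hp) ^ k * u)).1 - 1 =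
        (norm t'.1)⁻¹ • (star t'.1 *
          ⟨p ^ k * u.1.re - t.1, p ^ k * u.1.im - t.2⟩) := by
      have : (⟨p ^ k * u.1.re - t.1, p ^ k * u.1.im - t.2⟩ : Gaussian F) =
          (Gaussian.ofUnit (Units.mk0 p hp) ^ k * u).1 - t'.1 := by
        rw [hpt]
        rfl
      rw [this, ← smul_mul_assoc, ← Gaussian.inv_eq, mul_sub, Units.inv_mul, Units.val_mul]
    rw [h1]
    have hst : IsSmall v 1 (star t'.1) :=
      (isSmall_of_le hv (hTS t htT).1.1 (hTS t htT).1.2).star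
    have h3 := (hst.mul hv h2 (isSmall_of_le hv htN.1 htN.2)).smul (norm t'.1)⁻¹
    refine h3.mono (le_of_eq ?_)
    have hn : v (norm t'.1) ≠ 0 := (v.pos fun h =>
      hne t (hTS t htT) (norm_eq_zero_iff_eq_zero.1 h)).ne'
    change v (norm t'.1)⁻¹ * (1 * (r * (v 2 * v (norm t'.1))) / v 2) = r
    rw [map_inv₀]
    field_simp
  · rw [zpow_neg, mul_comm _ u, ← mul_assoc, mul_inv_cancel_right]

end GaussianQuotient

/-! ### Sums of two squares have index at most two. -/

section NormIndex

open QuadraticAlgebra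

variable {F : Type*} [Field F] [TopologicalSpace F] [IsTopologicalRing F]
  {v : AbsoluteValue F ℝ} (hv : IsUltrametricAbs v) [Fact (∀ r : F, r ^ 2 ≠ -1 + 0 * r)]
  (h2 : (2 : F) ≠ 0) {r : ℝ} (hr0 : 0 < r) (hr2 : r < v 2) (hr1 : r < 1) {p : F} (hp : p ≠ 0)

namespace Gaussian

/-- Such an element is a power of `p` times some c close to 1, and c is the norm of a principal
unit. -/
theorem exists_of_ofUnit_mem {a : Fˣ} (ha : ofUnit a ∈ openUnits hv h2 hr0 hr2 hr1 hp) :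
    ∃ w ∈ openUnits hv h2 hr0 hr2 hr1 hp, ∃ k : ℤ, a = unitNorm w * Units.mk0 p hp ^ k := by
  obtain ⟨w, hw, k, hk⟩ := (mem_openUnits hv h2 hr0 hr2 hr1 hp).1 ha
  have hwc : w = ofUnit (a * (Units.mk0 p hp ^ k)⁻¹) := by
    rw [map_mul, map_inv, map_zpow, eq_mul_inv_iff_mul_eq, hk]
  set c := a * (Units.mk0 p hp ^ k)⁻¹ with hc
  have hs : IsSmall v r (w.1 - 1) := hw
  have hcr : v (c.1 - 1) ≤ r := by
    have := hs.1
    rw [hwc, coe_ofUnit] at this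
    simpa using this
  obtain ⟨w', hw', hn⟩ := exists_norm_eq_of_abs_sub_one_le hv h2 hr0.le hr2 hr1 hcr
  refine ⟨w', le_sup_left (a := principalUnits hv h2 hr0.le hr2.le hr1) hw', k, ?_⟩
  have : unitNorm w' = c := Units.ext hn
  rw [this, hc, inv_mul_cancel_right]

/-- Conjugation on the quotient by `openUnits`. -/
def quotientConj : ((Gaussian F)ˣ ⧸ openUnits hv h2 hr0 hr2 hr1 hp) →*
    ((Gaussian F)ˣ ⧸ openUnits hv h2 hr0 hr2 hr1 hp) :=
  QuotientGroup.map _ _ conj (openUnits_le_comap hv h2 hr0 hr2 hr1 hp)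

theorem quotientConj_mk (u : (Gaussian F)ˣ) :
    quotientConj hv h2 hr0 hr2 hr1 hp (QuotientGroup.mk u) = QuotientGroup.mk (conj u) := rfl

theorem quotientConj_quotientConj (x : (Gaussian F)ˣ ⧸ openUnits hv h2 hr0 hr2 hr1 hp) :
    quotientConj hv h2 hr0 hr2 hr1 hp (quotientConj hv h2 hr0 hr2 hr1 hp x) = x := by
  obtain ⟨u, rfl⟩ := QuotientGroup.mk_surjective x
  rw [quotientConj_mk, quotientConj_mk, conj_conj]

theorem exists_isSumTwoSq {a : Fˣ} {y : (Gaussian F)ˣ ⧸ openUnits hv h2 hr0 hr2 hr1 hp}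
    (hy : y * quotientConj hv h2 hr0 hr2 hr1 hp y = QuotientGroup.mk (ofUnit a)) :
    ∃ k : ℤ, IsSumTwoSq (a * Units.mk0 p hp ^ k).1 := by
  obtain ⟨u, rfl⟩ := QuotientGroup.mk_surjective y
  rw [quotientConj_mk, ← QuotientGroup.mk_mul, QuotientGroup.eq, mul_conj, ← map_inv,
    ← map_mul] at hy
  obtain ⟨w, -, k, hk⟩ := exists_of_ofUnit_mem hv h2 hr0 hr2 hr1 hp hy
  refine ⟨-k, isSumTwoSq_iff.2 ⟨u * w, ?_⟩⟩
  rw [map_mul, zpow_neg, eq_mul_inv_iff_mul_eq, mul_assoc, ← hk, mul_inv_cancel_left]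

theorem exists_unitNorm_eq_zpow {z : (Gaussian F)ˣ ⧸ openUnits hv h2 hr0 hr2 hr1 hp}
    (hz : z * quotientConj hv h2 hr0 hr2 hr1 hp z = 1) :
    ∃ u : (Gaussian F)ˣ, QuotientGroup.mk u = z ∧ ∃ k : ℤ, unitNorm u = Units.mk0 p hp ^ k := by
  obtain ⟨u, rfl⟩ := QuotientGroup.mk_surjective z
  rw [quotientConj_mk, ← QuotientGroup.mk_mul, QuotientGroup.eq_one_iff, mul_conj] at hz
  obtain ⟨w, hw, k, hk⟩ := exists_of_ofUnit_mem hv h2 hr0 hr2 hr1 hp hz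
  refine ⟨u * w⁻¹, ?_, k, ?_⟩
  · rw [QuotientGroup.mk_mul, (QuotientGroup.eq_one_iff _).2 (inv_mem hw), mul_one]
  · rw [map_mul, hk, map_inv, mul_comm, inv_mul_cancel_left]

/-- For k = 2j, multiplying `u` by p^(-j) does not change its class and makes the norm 1, so Hilbert
90 applies. -/
theorem exists_div_quotientConj {u : (Gaussian F)ˣ} {k : ℤ} (hk : Even k)
    (hu : unitNorm u = Units.mk0 p hp ^ k) :
    ∃ y, y / quotientConj hv h2 hr0 hr2 hr1 hp y = QuotientGroup.mk u := by
  obtain ⟨j, rfl⟩ := hk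
  have hP : ofUnit (Units.mk0 p hp ^ (-j)) ∈ openUnits hv h2 hr0 hr2 hr1 hp := by
    rw [map_zpow]
    exact le_sup_right (a := principalUnits hv h2 hr0.le hr2.le hr1)
      (Subgroup.zpow_mem_zpowers _ _)
  have h1 : unitNorm (u * ofUnit (Units.mk0 p hp ^ (-j))) = 1 := by
    rw [map_mul, hu, unitNorm_ofUnit, ← zpow_natCast, ← zpow_mul, ← zpow_add]
    convert zpow_zero (Units.mk0 p hp)
    push_cast
    ring
  obtain ⟨y, hy⟩ := exists_div_conj (congrArg Units.val h1)
  refine ⟨QuotientGroup.mk y, ?_⟩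
  rw [quotientConj_mk, ← QuotientGroup.mk_div, hy, QuotientGroup.mk_mul,
    (QuotientGroup.eq_one_iff _).2 hP, mul_one]

end Gaussian

open Gaussian

include hv h2

/-- Elements of ker N in the finite quotient lift to units of norm p^k, and those with `k` even lie
in im D. If `p` is a norm, parity bounds ker N / im D by two, and Herbrand gives the same bound for
ker D / im N. If `p` is not a norm, `k` is always even, so ker N = im D; then every a is a norm up
to a power of `p`, and b = p works. -/
theorem IsUltrametricAbs.index_le_two_of_not_square (hp : p ≠ 0) (hp1 : v p < 1) :
    ∃ b : F, b ≠ 0 ∧ ∀ a, a ≠ 0 → IsSumTwoSq a ∨ IsSumTwoSq (a * b) := by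
  obtain ⟨r, hr0, hr⟩ := exists_between (lt_min (v.pos h2) one_pos)
  have hr2 : r < v 2 := hr.trans_le (min_le_left _ _)
  have hr1 : r < 1 := hr.trans_le (min_le_right _ _)
  have := finite_quotient hv h2 hr0 hr2 hr1 hp hp1
  have hσ := quotientConj_quotientConj hv h2 hr0 hr2 hr1 hp
  have hfix : ∀ a : Fˣ, quotientConj hv h2 hr0 hr2 hr1 hp (QuotientGroup.mk (ofUnit a)) =
      QuotientGroup.mk (ofUnit a) := fun a => by rw [quotientConj_mk, conj_ofUnit]
  have hsq : ∀ k : ℤ, Even k → ∃ u : (Gaussian F)ˣ, unitNorm u = Units.mk0 p hp ^ k := by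
    rintro _ ⟨j, rfl⟩
    refine ⟨ofUnit (Units.mk0 p hp ^ j), ?_⟩
    rw [unitNorm_ofUnit, sq, zpow_add]
  by_cases hpn : ∃ u : (Gaussian F)ˣ, unitNorm u = Units.mk0 p hp
  · have hpow : ∀ k : ℤ, IsSumTwoSq (Units.mk0 p hp ^ k).1 := fun k => by
      obtain ⟨u, hu⟩ := hpn
      exact isSumTwoSq_iff.2 ⟨u ^ k, by rw [map_zpow, hu]⟩
    have hdesc : ∀ a : Fˣ, (∃ y, y * quotientConj hv h2 hr0 hr2 hr1 hp y =
        QuotientGroup.mk (ofUnit a)) → IsSumTwoSq a.1 := by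
      rintro a ⟨y, hy⟩
      obtain ⟨k, hk⟩ := exists_isSumTwoSq hv h2 hr0 hr2 hr1 hp hy
      have := hk.mul (hpow (-k))
      rwa [← Units.val_mul, zpow_neg, mul_inv_cancel_right] at this
    by_cases hall : ∀ a : Fˣ, IsSumTwoSq a.1
    · exact ⟨1, one_ne_zero, fun a ha => Or.inl (hall (Units.mk0 a ha))⟩
    · push Not at hall
      obtain ⟨b, hb⟩ := hall
      refine ⟨b.1, b.ne_zero, fun a ha => or_iff_not_imp_left.2 fun ha' => ?_⟩
      refine hdesc (Units.mk0 a ha * b) ?_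
      rw [map_mul, QuotientGroup.mk_mul]
      refine herbrand_two hσ (fun z w hz hw hz' hw' => ?_) (hfix _) (hfix _)
        (fun y hy => ha' (hdesc (Units.mk0 a ha) ⟨y, hy⟩)) (fun y hy => hb (hdesc b ⟨y, hy⟩))
      obtain ⟨u, rfl, k, hk⟩ := exists_unitNorm_eq_zpow hv h2 hr0 hr2 hr1 hp hz
      obtain ⟨t, rfl, l, hl⟩ := exists_unitNorm_eq_zpow hv h2 hr0 hr2 hr1 hp hw
      have hk' : ¬ Even k := fun h => by
        obtain ⟨y, hy⟩ := exists_div_quotientConj hv h2 hr0 hr2 hr1 hp h hk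
        exact hz' y hy
      have hl' : ¬ Even l := fun h => by
        obtain ⟨y, hy⟩ := exists_div_quotientConj hv h2 hr0 hr2 hr1 hp h hl
        exact hw' y hy
      rw [← QuotientGroup.mk_mul]
      refine exists_div_quotientConj hv h2 hr0 hr2 hr1 hp
        (Int.even_add.2 (iff_of_false hk' hl')) ?_
      rw [map_mul, hk, hl, zpow_add]
  · refine ⟨p, hp, fun a ha => ?_⟩
    obtain ⟨y, hy⟩ := herbrand_one hσ (fun z hz => by
      obtain ⟨u, rfl, k, hk⟩ := exists_unitNorm_eq_zpow hv h2 hr0 hr2 hr1 hp hz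
      refine exists_div_quotientConj hv h2 hr0 hr2 hr1 hp ?_ hk
      by_contra hodd
      rw [Int.not_even_iff_odd] at hodd
      obtain ⟨t, ht⟩ := hsq (1 - k) (Int.even_sub.2 (by simp [hodd]))
      refine hpn ⟨u * t, ?_⟩
      rw [map_mul, hk, ht, ← zpow_add, add_sub_cancel, zpow_one]) (hfix (Units.mk0 a ha))
    obtain ⟨k, hk⟩ := exists_isSumTwoSq hv h2 hr0 hr2 hr1 hp hy
    obtain ⟨w, hw⟩ := isSumTwoSq_iff.1 hk
    rcases Int.even_or_odd k with h | h
    · obtain ⟨t, ht⟩ := hsq (-k) h.neg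
      refine Or.inl (isSumTwoSq_iff (a := Units.mk0 a ha) |>.2 ⟨w * t, ?_⟩)
      rw [map_mul, hw, ht, zpow_neg, mul_inv_cancel_right]
    · obtain ⟨t, ht⟩ := hsq (1 - k) (Int.even_sub.2 (by simp [h]))
      refine Or.inr (isSumTwoSq_iff (a := Units.mk0 a ha * Units.mk0 p hp) |>.2 ⟨w * t, ?_⟩)
      rw [map_mul, hw, ht, mul_assoc, ← zpow_add, add_sub_cancel, zpow_one]

omit [TopologicalSpace F] [IsTopologicalRing F] [Fact (∀ r : F, r ^ 2 ≠ -1 + 0 * r)] hv in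
/-- If `-1` is a square then all elements are sums of two squares. -/
theorem isSumTwoSq_of_neg_one {i : F} (hi : i ^ 2 = -1) {a : F} (ha : a ≠ 0) : IsSumTwoSq a := by
  refine ⟨ha, (a + 1) / 2, i * ((a - 1) / 2), ?_⟩
  rw [mul_pow, hi]
  field_simp
  ring

omit [Fact (∀ r : F, r ^ 2 ≠ -1 + 0 * r)] in
theorem IsUltrametricAbs.index_le_two (hp : p ≠ 0) (hp1 : v p < 1) :
    ∃ b : F, b ≠ 0 ∧ ∀ a, a ≠ 0 → IsSumTwoSq a ∨ IsSumTwoSq (a * b) := by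
  by_cases h : ∃ i : F, i ^ 2 = -1
  · obtain ⟨i, hi⟩ := h
    exact ⟨1, one_ne_zero, fun a ha => Or.inl (isSumTwoSq_of_neg_one h2 hi ha)⟩
  · push Not at h
    have : Fact (∀ r : F, r ^ 2 ≠ -1 + 0 * r) := ⟨fun r => by rw [zero_mul, add_zero]; exact h r⟩
    exact hv.index_le_two_of_not_square h2 hp hp1

end NormIndex

/-! ### γ(1) is an eighth root of unity. -/

section EighthRoot

variable {F : Type*} [Field F] [TopologicalSpace F] [IsTopologicalRing F]
  [LocallyCompactSpace F] [SecondCountableTopology F] [T2Space F]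
  {ψ : AddChar F Circle} (hW : HasWeilTheory ψ)
include hW

theorem HasWeilTheory.scalar_one_pow_four (h : IsSumTwoSq (-1 : F)) :
    weilIndexScalar ψ (1 : F) ^ 4 = 1 := by
  have h1 := hW.scalar_sq_mul (a := (1 : F)) h
  have h2 := hW.scalar_mul_neg (one_ne_zero (α := F))
  rw [one_mul] at h1
  calc _ = weilIndexScalar ψ (1 : F) ^ 2 * weilIndexScalar ψ (1 : F) ^ 2 := by ring
    _ = weilIndexScalar ψ (1 : F) ^ 2 * weilIndexScalar ψ (-1 : F) ^ 2 := by rw [h1]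
    _ = 1 := by rw [← mul_pow, h2, one_pow]

/-- ⟨a⟩ ⊕ ⟨b⟩ ≅ ⟨-1⟩ ⊕ ⟨-ab⟩, and γ² ignores sums of two squares, so γ(1)⁴ = γ(-1)⁴ = γ(1)⁻⁴. -/
theorem HasWeilTheory.scalar_one_pow_eight {a b : F} (ha : IsSumTwoSq a) (hb : IsSumTwoSq b)
    (h : a + b = -1) : weilIndexScalar ψ (1 : F) ^ 8 = 1 := by
  have h0 : a + b ≠ 0 := by simp [h]
  have h1 := hW.scalar_mul_scalar h0
  have hg : ∀ c : F, IsSumTwoSq c → weilIndexScalar ψ c ^ 2 = weilIndexScalar ψ 1 ^ 2 :=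
    fun c hc => by
      have := hW.scalar_sq_mul (a := (1 : F)) hc
      rwa [one_mul] at this
  have h3 := hW.scalar_sq_mul (a := (-1 : F)) (ha.mul hb)
  have h2 := hW.scalar_mul_neg (one_ne_zero (α := F))
  have h4 : weilIndexScalar ψ (1 : F) ^ 4 = weilIndexScalar ψ (-1 : F) ^ 4 := by
    calc _ = weilIndexScalar ψ (1 : F) ^ 2 * weilIndexScalar ψ (1 : F) ^ 2 := by ring
      _ = (weilIndexScalar ψ a * weilIndexScalar ψ b) ^ 2 := by
        rw [mul_pow, hg a ha, hg b hb]
      _ = weilIndexScalar ψ (-1 : F) ^ 2 * weilIndexScalar ψ (-1 * (a * b)) ^ 2 := by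
        rw [h1, h, mul_pow, mul_comm (-1 : F)]
      _ = _ := by
        rw [h3]
        ring
  calc _ = weilIndexScalar ψ (1 : F) ^ 4 * weilIndexScalar ψ (1 : F) ^ 4 := by ring
    _ = weilIndexScalar ψ (1 : F) ^ 4 * weilIndexScalar ψ (-1 : F) ^ 4 := by rw [h4]
    _ = 1 := by rw [← mul_pow, h2, one_pow]

-- By compactness of the unit ball two distinct natural numbers lie within 1/2 of the same point;
-- take their difference.
omit hW [LocallyCompactSpace F] [SecondCountableTopology F] [T2Space F] in
theorem IsUltrametricAbs.exists_natCast {v : AbsoluteValue F ℝ} (hv : IsUltrametricAbs v) :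
    ∃ n : ℕ, 0 < n ∧ v n < 1 := by
  let N : F → Set F := fun t => {x | v (x - t) ≤ 1 / 2}
  have hN : ∀ t ∈ {x | v x ≤ 1}, N t ∈ nhds t := fun t _ => by
    have h1 : Filter.Tendsto (fun x => v (x - t)) (nhds t) (nhds 0) := by
      have : Continuous fun x => v (x - t) := hv.continuous.comp (by fun_prop)
      have := this.tendsto t
      rwa [sub_self, map_zero] at this
    filter_upwards [h1 (Iio_mem_nhds (by norm_num : (0 : ℝ) < 1 / 2))] with x hx
    exact le_of_lt (show v (x - t) < 1 / 2 from hx)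
  obtain ⟨T, -, hT⟩ := (hv.isCompact 1).elim_nhds_subcover N hN
  have hn : ∀ n : ℕ, ∃ t : T, (n : F) ∈ N t := fun n => by
    have h1 : v (n : F) ≤ 1 := by
      induction n with
      | zero => simp
      | succ n ih =>
        push_cast
        exact hv.add_le_of_le ih v.map_one.le
    obtain ⟨t, ht, h⟩ := Set.mem_iUnion₂.1 (hT h1)
    exact ⟨⟨t, ht⟩, h⟩
  choose f hf using hn
  obtain ⟨m, n, hmn, h⟩ := Finite.exists_ne_map_eq_of_infinite f
  wlog hlt : m < n generalizing m n
  · exact this n m hmn.symm h.symm (lt_of_le_of_ne (not_lt.1 hlt) hmn.symm)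
  refine ⟨n - m, Nat.sub_pos_of_lt hlt, ?_⟩
  rw [Nat.cast_sub hlt.le]
  have h1 : v (n - f n) ≤ 1 / 2 := hf n
  have h2 : v (m - f n) ≤ 1 / 2 := h ▸ hf m
  have := hv.sub_le_of_le h1 h2
  rw [sub_sub_sub_cancel_right] at this
  exact this.trans_lt (by norm_num)

/-- Suppose -1 is not a sum of two squares; then one of ±a is, for each a ≠ 0. If such sums were
closed under addition, 4n - 1 would be one, while 1 - 4n is a square for |n| < 1, and so -1 would be
one. Hence some x + y fails, -(x + y) is a sum of two squares, and division by it writes -1 as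
needed. -/
theorem IsUltrametricAbs.hasNormTheory {v : AbsoluteValue F ℝ} (hv : IsUltrametricAbs v)
    {p : F} (hp : p ≠ 0) (hp1 : v p < 1) : HasNormTheory ψ := by
  have h2 := hW.two_ne_zero
  obtain ⟨b, hb, hab⟩ := hv.index_le_two h2 hp hp1
  refine ⟨⟨b, hb, hab⟩, ?_⟩
  by_cases hneg : IsSumTwoSq (-1 : F)
  · have := hW.scalar_one_pow_four hneg
    rw [show 8 = 4 * 2 from rfl, pow_mul, this, one_pow]
  have hdiv : ∀ x y : F, IsSumTwoSq x → IsSumTwoSq y → IsSumTwoSq (x / y) := fun x y hx hy => by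
    have := (hx.mul hy).mul (isSumTwoSq_sq (inv_ne_zero hy.1))
    convert this using 1
    have := hy.1
    field_simp
  have hpm : ∀ a : F, a ≠ 0 → IsSumTwoSq a ∨ IsSumTwoSq (-a) := fun a ha => by
    have hnb : IsSumTwoSq (-1 * b) := (hab (-1) (by simp)).resolve_left hneg
    refine (hab a ha).imp_right fun h => ?_
    have := hdiv _ _ (h.mul hnb) (isSumTwoSq_sq hb)
    convert this using 1
    field_simp
  by_cases hadd : ∀ x y : F, IsSumTwoSq x → IsSumTwoSq y → IsSumTwoSq (x + y)
  · exfalso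
    have h1 : IsSumTwoSq (1 : F) := by simpa using isSumTwoSq_sq (one_ne_zero (α := F))
    have hnat : ∀ n : ℕ, IsSumTwoSq ((n + 1 : ℕ) : F) := fun n => by
      induction n with
      | zero => simpa using h1
      | succ n ih =>
        have := hadd _ _ ih h1
        push_cast at this ⊢
        exact this
    obtain ⟨n, hn, hvn⟩ := hv.exists_natCast
    have hv2 := v.pos h2
    obtain ⟨s, hs⟩ := hv.isSquare_one_add h2 (t := -(2 * n)) (by
      rw [v.map_neg, map_mul]
      exact mul_lt_of_lt_one_right hv2 hvn)
    -- Here m + 1 stands for 4n - 1; n > 0 keeps the natural subtraction exact.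
    obtain ⟨m, hm⟩ : ∃ m : ℕ, 4 * n = m + 1 + 1 := ⟨4 * n - 2, by omega⟩
    have hm' : ((m + 1 : ℕ) : F) = 4 * n - 1 := by
      have := congrArg (Nat.cast (R := F)) hm
      push_cast at this ⊢
      rw [this]
      ring
    have hs0 : s ≠ 0 := by
      rintro rfl
      have h3 : IsSumTwoSq ((m + 1 : ℕ) : F) := hnat m
      refine h3.1 ?_
      rw [hm']
      linear_combination -hs
    refine hneg ?_
    have h3 := hdiv _ _ (isSumTwoSq_sq hs0) (hnat m)
    convert h3 using 1
    rw [eq_div_iff (hnat m).1, hm']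
    linear_combination hs
  · push Not at hadd
    obtain ⟨x, y, hx, hy, hxy⟩ := hadd
    by_cases h0 : x + y = 0
    · refine absurd ?_ hneg
      have := hdiv _ _ hy hx
      rwa [eq_neg_of_add_eq_zero_right h0, neg_div, div_self hx.1] at this
    · have h := (hpm _ h0).resolve_left hxy
      refine hW.scalar_one_pow_eight (hdiv _ _ hx h) (hdiv _ _ hy h) ?_
      rw [← add_div, div_neg, div_self h0]

end EighthRoot

/-! ### Non-archimedean local fields. -/

section Nonarchimedean

open Filter Topology ValuativeRel

variable (F : Type*) [Field F] [TopologicalSpace F]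

/-- The rank one embedding of the value group gives a real absolute value. Powers of an element with
|p| < 1 compare its balls with those of the valuation. -/
theorem exists_isUltrametricAbs [ValuativeRel F] [IsNonarchimedeanLocalField F] :
    ∃ v : AbsoluteValue F ℝ, IsUltrametricAbs v ∧ ∃ p, p ≠ 0 ∧ v p < 1 := by
  obtain ⟨e⟩ := ValuativeRel.IsRankLeOne.nonempty (R := F)
  have hmax : ∀ x y : F, (e.emb (valuation F (x + y)) : ℝ) ≤
      max (e.emb (valuation F x) : ℝ) (e.emb (valuation F y)) := fun x y => by
    have h := e.strictMono.monotone ((valuation F).map_add x y)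
    rw [e.strictMono.monotone.map_max] at h
    exact_mod_cast h
  let v : AbsoluteValue F ℝ :=
    { toFun := fun x => (e.emb (valuation F x) : ℝ)
      map_mul' := fun x y => by rw [map_mul, map_mul, NNReal.coe_mul]
      nonneg' := fun x => NNReal.coe_nonneg _
      eq_zero' := fun x => by simp
      add_le' := fun x y => (hmax x y).trans (max_le_add_of_nonneg (by simp) (by simp)) }
  have hv : ∀ x, v x = (e.emb (valuation F x) : ℝ) := fun x => rfl
  obtain ⟨γ, hγ0, hγ1⟩ := ValuativeRel.IsNontrivial.exists_lt_one (R := F)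
  obtain ⟨p, rfl⟩ := ValuativeRel.valuation_surjective γ
  have hp0 : p ≠ 0 := fun h => hγ0.ne' (by simp [h])
  have hp1 : v p < 1 := by
    have := e.strictMono hγ1
    rw [map_one] at this
    rw [hv]
    exact_mod_cast this
  have hnhds : ∀ r : ℝ, 0 < r → {x | v x ≤ r} ∈ 𝓝 (0 : F) := fun r hr => by
    obtain ⟨n, hn⟩ := exists_pow_lt_of_lt_one hr hp1
    refine mem_of_superset ((IsValuativeTopology.hasBasis_nhds_zero' F).mem_of_mem
      (i := valuation F (p ^ n)) (by simp [hp0])) fun x hx => ?_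
    have hx : valuation F x < valuation F (p ^ n) := hx
    have h1 : v x < v (p ^ n) := by
      rw [hv, hv]
      exact_mod_cast e.strictMono hx
    rw [map_pow] at h1
    exact (h1.trans hn).le
  refine ⟨v, ⟨hmax, ⟨fun s => ⟨fun hs => ?_, fun ⟨r, hr, hrs⟩ => mem_of_superset (hnhds r hr) hrs⟩⟩,
    fun r => ?_⟩, p, hp0, hp1⟩
  · obtain ⟨γ, hγ, hγs⟩ := (IsValuativeTopology.hasBasis_nhds_zero' F).mem_iff.1 hs
    have h0 : 0 < (e.emb γ : ℝ) := by
      have := e.strictMono (zero_lt_iff.2 hγ)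
      rw [map_zero] at this
      exact_mod_cast this
    refine ⟨e.emb γ / 2, half_pos h0, fun x hx => hγs ?_⟩
    have hx : v x ≤ e.emb γ / 2 := hx
    have h1 : (e.emb (valuation F x) : ℝ) < e.emb γ := hx.trans_lt (half_lt_self h0)
    exact e.strictMono.lt_iff_lt.1 (by exact_mod_cast h1)
  · rcases le_or_gt r 0 with hr | hr
    · refine (Set.finite_singleton (0 : F)).subset (fun x hx => ?_) |>.isCompact
      exact v.nonpos_iff.1 (le_trans (show v x ≤ r from hx) hr)
    · let B : AddSubgroup F :=
        { carrier := {x | v x ≤ r}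
          zero_mem' := by simpa using hr.le
          add_mem' := fun {a b} ha hb => (hmax a b).trans (max_le ha hb)
          neg_mem' := fun {a} ha => by
            rw [Set.mem_ofPred_eq, v.map_neg]
            exact ha }
      have hB : IsClosed (B : Set F) :=
        B.isClosed_of_isOpen (AddSubgroup.isOpen_of_mem_nhds _ (g := 0) (hnhds r hr))
      obtain ⟨n, hn⟩ := exists_pow_lt_of_lt_one (inv_pos.2 hr) hp1
      refine (IsNonarchimedeanLocalField.isCompact_closedBall F
        (valuation F (p ^ n)⁻¹)).of_isClosed_subset hB fun x hx => ?_
      have hx : v x ≤ r := hx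
      have h1 : v x ≤ v (p ^ n)⁻¹ := by
        rw [map_inv₀, map_pow]
        exact hx.trans ((le_inv_comm₀ hr (pow_pos (v.pos hp0) n)).2 hn.le)
      rw [hv, hv] at h1
      exact e.strictMono.le_iff_le.1 (by exact_mod_cast h1)

end Nonarchimedean

/-! ### Finite fields. -/

section FiniteField

open Filter Topology

variable {F : Type*} [Field F] [TopologicalSpace F] [Finite F] [DiscreteTopology F]

/-- Lets the lattice argument cover finite fields as well. -/
theorem isUltrametricAbs_trivial [DecidablePred fun x : F => x = 0] :
    IsUltrametricAbs (AbsoluteValue.trivial : AbsoluteValue F ℝ) where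
  add_le x y := by
    by_cases hx : x = 0
    · simp [hx]
    · rw [AbsoluteValue.trivial_apply hx]
      refine le_max_of_le_left ?_
      by_cases hxy : x + y = 0
      · simp [hxy]
      · rw [AbsoluteValue.trivial_apply hxy]
  basis := ⟨fun s => by
    rw [nhds_discrete, mem_pure]
    constructor
    · refine fun hs => ⟨1 / 2, by norm_num, fun x hx => ?_⟩
      by_cases h0 : x = 0
      · rwa [h0]
      · rw [Set.mem_ofPred_eq, AbsoluteValue.trivial_apply h0] at hx
        norm_num at hx
    · rintro ⟨r, hr, hs⟩
      refine hs ?_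
      rw [Set.mem_ofPred_eq, map_zero]
      exact hr.le⟩
  isCompact r := (Set.toFinite _).isCompact

omit [TopologicalSpace F] [DiscreteTopology F] in
theorem FiniteField.isSumTwoSq (h2 : (2 : F) ≠ 0) {a : F} (ha : a ≠ 0) : IsSumTwoSq a := by
  have := Fintype.ofFinite F
  have hodd : Fintype.card F % 2 = 1 := by
    refine FiniteField.odd_card_of_char_ne_two fun h => h2 ?_
    have := ringChar.Nat.cast_ringChar (R := F)
    rw [h] at this
    exact_mod_cast this
  obtain ⟨x, y, h⟩ := FiniteField.exists_root_sum_quadratic (R := F) (Polynomial.degree_X_pow 2)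
    (Polynomial.degree_X_pow_sub_C (by norm_num) a) hodd
  refine ⟨ha, x, y, ?_⟩
  simp only [Polynomial.eval_pow, Polynomial.eval_X, Polynomial.eval_sub, Polynomial.eval_C] at h
  linear_combination -h

/-- The trivial absolute value has no p ≠ 0 with |p| < 1, so the Herbrand argument is replaced by
the fact that every element is a sum of two squares. -/
theorem HasWeilTheory.hasNormTheory_of_finite [IsTopologicalRing F]
    [LocallyCompactSpace F] [SecondCountableTopology F] [T2Space F] {ψ : AddChar F Circle}
    (hW : HasWeilTheory ψ) : HasNormTheory ψ := by
  refine ⟨⟨1, one_ne_zero, fun a ha => Or.inl (FiniteField.isSumTwoSq hW.two_ne_zero ha)⟩, ?_⟩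
  have := hW.scalar_one_pow_four (FiniteField.isSumTwoSq hW.two_ne_zero (by simp))
  rw [show 8 = 4 * 2 from rfl, pow_mul, this, one_pow]

end FiniteField

/-! ### Gaussian integrals for real forms with signs. -/

section RealModel

open Filter Topology WithLp FourierTransform
open scoped RealInnerProductSpace

variable {ι : Type*} [Fintype ι] {ε : ι → ℝ} (hε : ∀ i, ε i * ε i = 1)

/-- The change of signs `x ↦ (ε i * x i)`. -/
def signFlip (hε : ∀ i, ε i * ε i = 1) : (ι → ℝ) ≃ₜ (ι → ℝ) :=
  Homeomorph.piCongrRight fun i => Homeomorph.mulLeft₀ (ε i) fun h => by simpa [h] using hε i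

theorem signFlip_apply (x : ι → ℝ) (i : ι) : signFlip hε x i = ε i * x i := rfl

theorem measurePreserving_signFlip : MeasurePreserving (signFlip hε) := by
  refine volume_preserving_pi (f := fun i x => ε i * x) fun i => ?_
  rcases mul_self_eq_one_iff.1 (hε i) with h | h
  · simp only [h, one_mul]
    exact MeasurePreserving.id _
  · simp only [h, neg_one_mul]
    exact Measure.measurePreserving_neg _

theorem integral_signFlip (g : (ι → ℝ) → ℂ) : ∫ x, g (signFlip hε x) = ∫ x, g x :=
  (measurePreserving_signFlip hε).integral_comp (signFlip hε).measurableEmbedding g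

theorem integral_toLp (g : EuclideanSpace ℝ ι → ℂ) : ∫ x : ι → ℝ, g (toLp 2 x) = ∫ v, g v :=
  (PiLp.volume_preserving_toLp ι).integral_comp
    (MeasurableEquiv.toLp 2 (ι → ℝ)).measurableEmbedding g

/-- A change of signs in the frequency reduces the transform to the Euclidean one. -/
theorem fourier_diagForm (φ : (ι → ℝ) → ℂ) (y : ι → ℝ) :
    fourier Real.fourierChar (diagForm ε) volume φ y =
      𝓕 (fun v : EuclideanSpace ℝ ι => φ (ofLp v)) (toLp 2 (signFlip hε y)) := by
  rw [fourier_apply, Real.fourier_eq, ← integral_toLp]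
  congr 1 with x
  rw [Circle.smul_def, smul_eq_mul]
  congr 4
  rw [diagForm_apply, PiLp.inner_apply]
  refine Finset.sum_congr rfl fun i _ => ?_
  simp only [RCLike.inner_apply, conj_trivial, signFlip_apply]
  ring

include hε in
theorem isSelfDualMeasure_diagForm :
    IsSelfDualMeasure Real.fourierChar (diagForm ε) (volume : Measure (ι → ℝ)) where
  isAddHaarMeasure := inferInstance
  inversion φ hφ x := by
    set f : EuclideanSpace ℝ ι → ℂ := fun v => φ (ofLp v) with hf
    have hfc : Continuous f := hφ.continuous.comp (PiLp.continuous_ofLp 2 _)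
    have hfi : Integrable f := by
      rw [← (PiLp.volume_preserving_toLp ι).integrable_comp_emb
        (MeasurableEquiv.toLp 2 (ι → ℝ)).measurableEmbedding]
      exact hφ.integrable
    have hFi : Integrable (𝓕 f) := by
      rw [← (PiLp.volume_preserving_toLp ι).integrable_comp_emb
        (MeasurableEquiv.toLp 2 (ι → ℝ)).measurableEmbedding,
        ← (measurePreserving_signFlip hε).integrable_comp_emb (signFlip hε).measurableEmbedding]
      refine hφ.integrable_fourier.congr (.of_forall fun y => ?_)
      exact fourier_diagForm hε φ y
    have h1 : fourier Real.fourierChar (diagForm ε) volume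
        (fourier Real.fourierChar (diagForm ε) volume φ) x = 𝓕 (𝓕 f) (toLp 2 x) := by
      rw [fourier_apply, Real.fourier_eq, ← integral_toLp, ← integral_signFlip hε]
      congr 1 with y
      have hflip : signFlip hε (signFlip hε y) = y := funext fun i => by
        rw [signFlip_apply, signFlip_apply, ← mul_assoc, hε, one_mul]
      rw [Circle.smul_def, smul_eq_mul, fourier_diagForm hε, hflip]
      congr 4
      rw [diagForm_apply, PiLp.inner_apply]
      refine Finset.sum_congr rfl fun i _ => ?_
      simp only [RCLike.inner_apply, conj_trivial, signFlip_apply]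
      linear_combination (y i * x i) * hε i
    have h2 := congrFun (hfc.fourierInv_fourier_eq hfi hFi) (-toLp 2 x)
    rw [Real.fourierInv_eq_fourier_neg, neg_neg] at h2
    rw [h1, h2]
    rfl

/-- The Gaussian `x ↦ exp (-π ∑ b i * x i ^ 2)`. -/
def gaussian (b : ι → ℂ) (x : ι → ℝ) : ℂ := Complex.exp (-∑ i, (Real.pi * b i) * (x i : ℂ) ^ 2)

theorem continuous_gaussian (b : ι → ℂ) : Continuous (gaussian b) := by
  unfold gaussian
  fun_prop

theorem re_pi_mul {b : ℂ} (hb : 0 < b.re) : 0 < (Real.pi * b).re := by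
  rw [Complex.re_ofReal_mul]
  exact mul_pos Real.pi_pos hb

theorem integrable_gaussian {b : ι → ℂ} (hb : ∀ i, 0 < (b i).re) : Integrable (gaussian b) := by
  have := GaussianFourier.integrable_cexp_neg_sum_mul_add (fun i => re_pi_mul (hb i))
    (fun _ : ι => (0 : ℂ))
  refine this.congr (.of_forall fun x => ?_)
  simp [gaussian]

theorem fourier_gaussian {b : ι → ℂ} (hb : ∀ i, 0 < (b i).re) (y : ι → ℝ) :
    fourier Real.fourierChar (diagForm ε) volume (gaussian b) y =
      ∏ i, ((b i)⁻¹ ^ (1 / 2 : ℂ) * Complex.exp (-(Real.pi * (ε i * y i) ^ 2 / b i))) := by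
  have h := GaussianFourier.integral_cexp_neg_sum_mul_add (fun i => re_pi_mul (hb i))
    (fun i => -(2 * Real.pi * (ε i * y i) * Complex.I))
  rw [fourier_apply]
  refine Eq.trans ?_ (h.trans ?_)
  · congr 1 with x
    rw [Real.fourierChar_apply, gaussian, ← Complex.exp_add, diagForm_apply]
    congr 1
    rw [add_comm]
    congr 1
    push_cast
    rw [mul_neg, neg_mul, Finset.mul_sum, Finset.sum_mul, ← Finset.sum_neg_distrib]
    refine Finset.sum_congr rfl fun i _ => ?_
    ring
  · refine Finset.prod_congr rfl fun i _ => ?_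
    have hb0 : b i ≠ 0 := fun h => by simpa [h] using hb i
    have hpi : (Real.pi : ℂ) ≠ 0 := by exact_mod_cast Real.pi_ne_zero
    congr 2
    · field_simp
    · field_simp
      ring_nf
      rw [Complex.I_sq]
      ring

theorem quadChar_diagForm (x : ι → ℝ) :
    quadChar Real.fourierChar (diagForm ε) x = gaussian (fun i => -(ε i * Complex.I)) x := by
  rw [quadChar, Real.fourierChar_apply, gaussian, diagForm_apply]
  congr 1
  push_cast
  rw [Finset.mul_sum, Finset.mul_sum, Finset.sum_mul, ← Finset.sum_neg_distrib]
  refine Finset.sum_congr rfl fun i _ => ?_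
  ring

theorem gaussian_mul (b c : ι → ℂ) (x : ι → ℝ) :
    gaussian b x * gaussian c x = gaussian (b + c) x := by
  rw [gaussian, gaussian, gaussian, ← Complex.exp_add, ← neg_add, ← Finset.sum_add_distrib]
  congr 2
  refine Finset.sum_congr rfl fun i _ => ?_
  rw [Pi.add_apply]
  ring

include hε

theorem hasTestFunction_real : HasTestFunction Real.fourierChar (diagForm ε) := by
  have hb : ∀ _ : ι, 0 < (1 : ℂ).re := fun _ => by simp
  refine ⟨volume, gaussian fun _ => 1, isSelfDualMeasure_diagForm hε,
    ⟨continuous_gaussian _, integrable_gaussian hb, ?_⟩, ?_⟩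
  · refine (integrable_gaussian hb).congr (.of_forall fun y => ?_)
    rw [fourier_gaussian hb, gaussian, ← Finset.sum_neg_distrib, Complex.exp_sum]
    refine Finset.prod_congr rfl fun i _ => ?_
    have : (ε i : ℂ) * ε i = 1 := by exact_mod_cast hε i
    rw [inv_one, Complex.one_cpow, one_mul, mul_pow, sq (ε i : ℂ), this]
    congr 1
    ring
  · have hb' : ∀ i, 0 < (((fun i => -(((-ε) i : ℝ) * Complex.I)) + fun _ => 1 : ι → ℂ) i).re :=
      fun i => by simp
    have h := fourier_gaussian (ε := ε) hb' 0
    rw [fourier_apply] at h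
    have e : -diagForm ε = diagForm (-ε) := by
      refine LinearMap.ext fun x => LinearMap.ext fun y => ?_
      simp [Finset.sum_neg_distrib]
    simp only [map_zero, neg_zero, AddChar.map_zero_eq_one, Circle.coe_one, one_mul] at h
    simp only [e, quadChar_diagForm, gaussian_mul]
    rw [h]
    refine Finset.prod_ne_zero_iff.2 fun i _ => mul_ne_zero ?_ (Complex.exp_ne_zero _)
    rw [Ne, Complex.cpow_eq_zero_iff, not_and_or]
    refine Or.inl (inv_ne_zero fun h0 => ?_)
    have := hb' i
    rw [h0] at this
    simp at this

omit [Fintype ι] hε in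
theorem norm_cpow_half_le_one {z : ℂ} (hz : ‖z‖ ≤ 1) : ‖z ^ (1 / 2 : ℂ)‖ ≤ 1 := by
  have h : (z ^ (1 / 2 : ℂ)) ^ 2 = z := by
    rw [← Complex.cpow_nat_mul]
    norm_num
  rw [← h, norm_pow] at hz
  exact (pow_le_one_iff_of_nonneg (norm_nonneg _) (two_ne_zero' ℕ)).1 hz

/-- The form `∑ ε i * x i * y i` with signs `ε i` has a Weil constant, an eighth root of unity. -/
theorem exists_isWeilConstant_real :
    ∃ c : ℂ, c ^ 8 = 1 ∧ IsWeilConstant Real.fourierChar (diagForm ε) c := by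
  have hεC : ∀ i, (ε i : ℂ) * ε i = 1 := fun i => by exact_mod_cast hε i
  let δ : ℕ → ℝ := fun k => 1 / ((k : ℝ) + 1)
  have hδ : ∀ k, 0 < δ k := fun k => Nat.one_div_pos_of_nat
  have hδ0 : Tendsto δ atTop (𝓝 0) := tendsto_one_div_add_atTop_nhds_zero_nat
  -- f_q is the Gaussian with parameters -i ε_j; damping by d > 0 gives it positive real part. The
  -- constant is the value at d = 0 of the product of the β^(-1/2), an eighth root of unity since β⁴
  -- = 1 there.
  let β : ι → ℝ → ℂ := fun i d => -(ε i * Complex.I) + d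
  have hβre : ∀ i d, (β i d).re = d := fun i d => by simp [β]
  have hβim : ∀ i d, (β i d).im = -ε i := fun i d => by simp [β]
  have hβnorm : ∀ i d, 1 ≤ ‖β i d‖ := fun i d => by
    refine le_trans ?_ (Complex.abs_im_le_norm _)
    rw [hβim, abs_neg]
    rcases mul_self_eq_one_iff.1 (hε i) with h | h <;> simp [h]
  have hβ0 : ∀ i d, β i d ≠ 0 := fun i d h => by
    have := hβnorm i d
    rw [h, norm_zero] at this
    linarith
  refine ⟨∏ i, (β i 0)⁻¹ ^ (1 / 2 : ℂ), ?_, volume, isSelfDualMeasure_diagForm hε, fun φ hφ => ?_⟩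
  · rw [← Finset.prod_pow]
    refine Finset.prod_eq_one fun i _ => ?_
    rw [← Complex.cpow_nat_mul, show ((8 : ℕ) : ℂ) * (1 / 2) = (4 : ℕ) by norm_num,
      Complex.cpow_natCast]
    have h4 : β i 0 ^ 4 = 1 := by
      have : β i 0 ^ 4 = (ε i * ε i : ℂ) ^ 2 * (Complex.I ^ 2) ^ 2 := by
        simp only [β]
        push_cast
        ring
      rw [this, hεC, Complex.I_sq]
      norm_num
    rw [inv_pow, h4, inv_one]
  · have hfour : ∀ k y, fourier Real.fourierChar (diagForm ε) volume
        (fun x => quadChar Real.fourierChar (diagForm ε) x * gaussian (fun _ => (δ k : ℂ)) x) y =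
        ∏ i, ((β i (δ k))⁻¹ ^ (1 / 2 : ℂ) *
          Complex.exp (-(Real.pi * (ε i * y i) ^ 2 / β i (δ k)))) := fun k y => by
      simp only [quadChar_diagForm, gaussian_mul]
      exact fourier_gaussian (fun i => (hβre i (δ k)).symm ▸ hδ k) y
    refine integral_quadChar_fourier (H := fun k => gaussian fun _ => (δ k : ℂ)) (C := 1)
      Real.continuous_fourierChar (diagForm_isSymm ε) ?_ (fun k => integrable_gaussian fun i => ?_)
      (fun k x => ?_) (fun x => ?_) (fun k y => ?_) (fun y => ?_) hφ
    · simp only [diagForm_apply]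
      fun_prop
    · simpa using hδ k
    · rw [gaussian, Complex.norm_exp, Real.exp_le_one_iff, Complex.neg_re, neg_nonpos,
        Complex.re_sum]
      refine Finset.sum_nonneg fun i _ => ?_
      have : ((Real.pi : ℂ) * δ k * (x i : ℂ) ^ 2) = ((Real.pi * δ k * x i ^ 2 : ℝ) : ℂ) := by
        push_cast
        rfl
      rw [this, Complex.ofReal_re]
      have := hδ k
      positivity
    · have hc : Continuous fun d : ℝ => gaussian (fun _ => (d : ℂ)) x := by
        unfold gaussian
        fun_prop
      have := (hc.tendsto 0).comp hδ0
      simpa [gaussian, Function.comp_def] using this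
    · rw [hfour, norm_prod]
      refine Finset.prod_le_one (fun _ _ => norm_nonneg _) fun i _ => ?_
      rw [norm_mul]
      refine mul_le_one₀ (norm_cpow_half_le_one ?_) (norm_nonneg _) ?_
      · rw [norm_inv]
        exact inv_le_one_of_one_le₀ (hβnorm i _)
      · rw [Complex.norm_exp, Real.exp_le_one_iff, Complex.neg_re, neg_nonpos]
        have : ((Real.pi : ℂ) * (ε i * y i) ^ 2) = ((Real.pi * (ε i * y i) ^ 2 : ℝ) : ℂ) := by
          push_cast
          rfl
        rw [this, div_eq_mul_inv, Complex.re_ofReal_mul, Complex.inv_re, hβre]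
        have := hδ k
        have := Complex.normSq_nonneg (β i (δ k))
        positivity
    · simp only [hfour]
      have e : -diagForm ε = diagForm (-ε) := by
        refine LinearMap.ext fun x => LinearMap.ext fun y => ?_
        simp [Finset.sum_neg_distrib]
      have hlim : (∏ i, (β i 0)⁻¹ ^ (1 / 2 : ℂ)) * quadChar Real.fourierChar (-diagForm ε) y =
          ∏ i, ((β i 0)⁻¹ ^ (1 / 2 : ℂ) * Complex.exp (-(Real.pi * (ε i * y i) ^ 2 / β i 0))) := by
        rw [Finset.prod_mul_distrib, e, quadChar_diagForm, gaussian, ← Finset.sum_neg_distrib,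
          Complex.exp_sum]
        congr 1
        refine Finset.prod_congr rfl fun i _ => ?_
        congr 2
        rw [eq_div_iff (hβ0 i 0)]
        simp only [β, Pi.neg_apply]
        push_cast
        linear_combination (-(Real.pi * (y i : ℂ) ^ 2 * ε i * ε i)) * Complex.I_sq
      rw [hlim]
      refine tendsto_finsetProd _ fun i _ => ?_
      have hβc : Tendsto (fun k => β i (δ k)) atTop (𝓝 (β i 0)) := by
        have : Continuous (β i) := by
          simp only [β]
          fun_prop
        exact (this.tendsto 0).comp hδ0
      have hinv := hβc.inv₀ (hβ0 i 0)
      refine Tendsto.mul ?_ ?_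
      -- The limit has non-zero imaginary part, so it is off the branch cut of the square root.
      · refine hinv.cpow tendsto_const_nhds (Or.inr ?_)
        rw [Complex.inv_im, hβim, neg_neg]
        refine div_ne_zero (fun h => ?_) (by simpa using hβ0 i 0)
        simpa [h] using hε i
      · exact ((tendsto_const_nhds.div hβc (hβ0 i 0)).neg).cexp

end RealModel

/-! ### Continuous characters of the real line. -/

section RealCharacters

open intervalIntegral

/-- Continuous characters of `ℝ` are of the form `x ↦ exp (2 π i s x)`. -/
theorem exists_eq_fourierChar {χ : AddChar ℝ Circle} (hχ : Continuous χ) :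
    ∃ s : ℝ, ∀ x, χ x = Real.fourierChar (s * x) := by
  set f : ℝ → ℂ := fun x => χ x with hf
  have hfc : Continuous f := continuous_subtype_val.comp hχ
  have hf0 : f 0 = 1 := by simp [hf]
  have hadd : ∀ x y, f (x + y) = f x * f y := fun x y => by
    simp only [hf, AddChar.map_add_eq_mul, Circle.coe_mul]
  have hG : ∀ x, HasDerivAt (fun u => ∫ t in (0 : ℝ)..u, f t) (f x) x := fun x =>
    hfc.integral_hasStrictDerivAt 0 x |>.hasDerivAt
  -- Some ∫₀ᵃ f is non-zero as f(0) = 1. Then f(x) ∫₀ᵃ f is the integral of f from x to x + a, which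
  -- shows that f is differentiable.
  obtain ⟨a, ha⟩ : ∃ a : ℝ, ∫ t in (0 : ℝ)..a, f t ≠ 0 := by
    by_contra! h
    have h1 := hG 0
    simp only [h, hf0] at h1
    exact zero_ne_one ((hasDerivAt_const (0 : ℝ) (0 : ℂ)).unique h1)
  set J := ∫ t in (0 : ℝ)..a, f t with hJ
  have hint : ∀ u w, IntervalIntegrable f volume u w := fun u w => hfc.intervalIntegrable u w
  have hfx : ∀ x, f x = ((∫ t in (0 : ℝ)..(x + a), f t) - ∫ t in (0 : ℝ)..x, f t) / J := fun x => by
    rw [eq_div_iff ha, integral_interval_sub_left (hint _ _) (hint _ _), hJ,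
      ← intervalIntegral.integral_const_mul]
    simp only [← hadd]
    have := integral_comp_add_left (a := 0) (b := a) f x
    rwa [add_zero] at this
  set c := (f a - 1) / J with hc
  have hderiv : ∀ x, HasDerivAt f (f x * c) x := fun x => by
    have h1 : HasDerivAt (fun x => ((∫ t in (0 : ℝ)..(x + a), f t) - ∫ t in (0 : ℝ)..x, f t) / J)
        ((f (x + a) - f x) / J) x :=
      (((hG (x + a)).comp_add_const x a).sub (hG x)).div_const J
    have e : f x * c = (f (x + a) - f x) / J := by
      rw [hadd, hc]
      ring
    rw [e]
    exact h1.congr_of_eventuallyEq (.of_forall hfx)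
  have hexp : ∀ x : ℝ, f x = Complex.exp (c * x) := fun x => by
    have hd : ∀ y : ℝ, HasDerivAt (fun y : ℝ => f y * Complex.exp (-(c * y))) 0 y := fun y => by
      have h1 : HasDerivAt (fun y : ℝ => -(c * (y : ℂ))) (-(c * 1)) y :=
        ((Complex.ofRealCLM.hasDerivAt (x := y)).const_mul c).neg
      have h2 : (0 : ℂ) = f y * c * Complex.exp (-(c * y)) +
          f y * (Complex.exp (-(c * y)) * -(c * 1)) := by ring
      rw [h2]
      exact (hderiv y).mul h1.cexp
    have h2 := is_const_of_deriv_eq_zero (fun y => (hd y).differentiableAt)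
      (fun y => (hd y).deriv) x 0
    simp only [hf0, Complex.ofReal_zero, mul_zero, neg_zero, Complex.exp_zero, mul_one] at h2
    rw [Complex.exp_neg, ← div_eq_mul_inv, div_eq_one_iff_eq (Complex.exp_ne_zero _)] at h2
    exact h2
  have hre : c.re = 0 := by
    have h1 : ‖f 1‖ = 1 := Circle.norm_coe _
    rw [hexp, Complex.norm_exp, Complex.ofReal_one, mul_one, Real.exp_eq_one_iff] at h1
    exact h1
  refine ⟨c.im / (2 * Real.pi), fun x => Circle.ext ?_⟩
  rw [Real.fourierChar_apply]
  refine (hexp x).trans ?_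
  congr 1
  have : c = c.im * Complex.I := by
    apply Complex.ext <;> simp [hre]
  rw [this]
  simp only [Complex.mul_I_im, Complex.ofReal_re]
  have hpi := Real.pi_ne_zero
  rw [show 2 * Real.pi * (c.im / (2 * Real.pi) * x) = c.im * x by field_simp]
  push_cast
  ring

end RealCharacters

/-! ### Transport along a bicontinuous field isomorphism. -/

section Transport

variable {F : Type*} [Field F] [TopologicalSpace F] {K : Type*} [Field K] [TopologicalSpace K]
  (e : F ≃+* K) (he : Continuous e) (he' : Continuous e.symm)

/-- A bicontinuous isomorphism of fields as a homeomorphism. -/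
def homeomorphOfRingEquiv : F ≃ₜ K where
  toEquiv := e.toEquiv
  continuous_toFun := he
  continuous_invFun := he'

include e he he' in
theorem isTopologicalRing_of_ringEquiv [IsTopologicalRing K] : IsTopologicalRing F where
  continuous_add := by
    have h : Continuous fun p : F × F => e.symm (e p.1 + e p.2) := by fun_prop
    simpa using h
  continuous_mul := by
    have h : Continuous fun p : F × F => e.symm (e p.1 * e p.2) := by fun_prop
    simpa using h
  continuous_neg := by
    have h : Continuous fun x : F => e.symm (-e x) := by fun_prop
    simpa using h

/-- The character of `K` that corresponds to a character of `F`. -/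
def charOfRingEquiv (ψ : AddChar F Circle) : AddChar K Circle :=
  ψ.compAddMonoidHom (e.symm : K →+ F)

theorem charOfRingEquiv_apply (ψ : AddChar F Circle) (x : K) :
    charOfRingEquiv e ψ x = ψ (e.symm x) := rfl

end Transport

/-! ### Reduction of real forms to signs. -/

section RealCase

variable {F : Type*} [Field F] [TopologicalSpace F]
  {e : F ≃+* ℝ} (he : Continuous e) (he' : Continuous e.symm) {ψ : AddChar F Circle}
  (hψ : Continuous ψ) (hψ1 : ψ ≠ 1)

include he' hψ hψ1 in
theorem exists_fourierChar_real : ∃ s : ℝ, s ≠ 0 ∧ ∀ x, ψ x = Real.fourierChar (s * e x) := by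
  obtain ⟨s, hs⟩ := exists_eq_fourierChar (χ := charOfRingEquiv e ψ) (hψ.comp he')
  have h : ∀ x, ψ x = Real.fourierChar (s * e x) := fun x => by
    rw [← hs, charOfRingEquiv_apply, e.symm_apply_apply]
  refine ⟨s, fun h0 => hψ1 (DFunLike.ext _ _ fun x => ?_), h⟩
  rw [h, h0, zero_mul, AddChar.map_zero_eq_one, AddChar.one_apply]

include he he' hψ hψ1 in
-- If ψ corresponds to the frequency `s`, the scale √|s a_i| is absorbed into the i-th coordinate
-- and only the sign of s a_i remains.
theorem exists_isCharIsometry_real [IsTopologicalRing F] {n : ℕ} {a : Fin n → F}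
    (ha : ∀ i, a i ≠ 0) : ∃ (ε : Fin n → ℝ) (E : (Fin n → F) ≃ₜ (Fin n → ℝ)),
      (∀ i, ε i * ε i = 1) ∧
        IsCharIsometry ψ (diagForm a) Real.fourierChar (diagForm ε) E := by
  obtain ⟨s, hs0, hs⟩ := exists_fourierChar_real he' hψ hψ1
  have hsa : ∀ i, s * e (a i) ≠ 0 := fun i => mul_ne_zero hs0 (by simpa using ha i)
  let c : Fin n → ℝ := fun i => Real.sqrt |s * e (a i)|
  have hc : ∀ i, c i ≠ 0 := fun i => (Real.sqrt_pos.2 (abs_pos.2 (hsa i))).ne'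
  let ε : Fin n → ℝ := fun i => (s * e (a i)) / |s * e (a i)|
  have hεc : ∀ i, ε i * (c i * c i) = s * e (a i) := fun i => by
    rw [Real.mul_self_sqrt (abs_nonneg _), div_mul_cancel₀ _ (abs_ne_zero.2 (hsa i))]
  have key : ∀ x y : Fin n → F, ∑ i, ε i * (c i * e (x i) * (c i * e (y i))) =
      s * e (∑ i, a i * (x i * y i)) := fun x y => by
    rw [map_sum, Finset.mul_sum]
    refine Finset.sum_congr rfl fun i _ => ?_
    rw [map_mul, map_mul]
    linear_combination (e (x i) * e (y i)) * hεc i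
  let E : (Fin n → F) ≃ₜ (Fin n → ℝ) := Homeomorph.piCongrRight fun i =>
    (homeomorphOfRingEquiv e he he').trans (Homeomorph.mulLeft₀ (c i) (hc i))
  have hE : ∀ x i, E x i = c i * e (x i) := fun x i => rfl
  refine ⟨ε, E, fun i => ?_, ⟨fun x y => ?_, fun x y => ?_, fun x => ?_⟩⟩
  · rw [div_mul_div_comm, abs_mul_abs_self, div_self (mul_self_ne_zero.2 (hsa i))]
  · ext i
    simp only [hE, Pi.add_apply, map_add, mul_add]
  · rw [hs, diagForm_apply, diagForm_apply, ← key]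
    rfl
  · rw [quadChar, quadChar, hs, diagForm_apply, diagForm_apply]
    simp only [hE, key, map_mul, map_inv₀, map_ofNat]
    congr 2
    ring

end RealCase

/-! ### Reduction of complex forms to real forms with signs. -/

section ComplexCase

variable {F : Type*} [Field F] [TopologicalSpace F]
  {e : F ≃+* ℂ} (he : Continuous e) (he' : Continuous e.symm) {ψ : AddChar F Circle}
  (hψ : Continuous ψ) (hψ1 : ψ ≠ 1)

include he' hψ hψ1 in
theorem exists_fourierChar_complex :
    ∃ s : ℂ, s ≠ 0 ∧ ∀ x, ψ x = Real.fourierChar (s * e x).re := by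
  have hχ : Continuous (charOfRingEquiv e ψ) := hψ.comp he'
  obtain ⟨s, hs⟩ := exists_eq_fourierChar
    (χ := (charOfRingEquiv e ψ).compAddMonoidHom Complex.ofRealHom.toAddMonoidHom)
    (hχ.comp Complex.continuous_ofReal)
  obtain ⟨t, ht⟩ := exists_eq_fourierChar
    (χ := (charOfRingEquiv e ψ).compAddMonoidHom
      ((AddMonoidHom.mulRight Complex.I).comp Complex.ofRealHom.toAddMonoidHom))
    (hχ.comp (Complex.continuous_ofReal.mul continuous_const))
  have h : ∀ x, ψ x = Real.fourierChar ((⟨s, -t⟩ : ℂ) * e x).re := fun x => by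
    have hs' : charOfRingEquiv e ψ ((e x).re : ℂ) = Real.fourierChar (s * (e x).re) := hs _
    have ht' : charOfRingEquiv e ψ ((e x).im * Complex.I : ℂ) =
      Real.fourierChar (t * (e x).im) := ht _
    rw [Complex.mul_re, neg_mul, sub_neg_eq_add, AddChar.map_add_eq_mul, ← hs', ← ht',
      ← AddChar.map_add_eq_mul, Complex.re_add_im, charOfRingEquiv_apply, e.symm_apply_apply]
  refine ⟨⟨s, -t⟩, fun h0 => hψ1 (DFunLike.ext _ _ fun x => ?_), h⟩
  rw [h, h0, zero_mul, Complex.zero_re, AddChar.map_zero_eq_one, AddChar.one_apply]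

include he he' hψ hψ1 in
-- With c_i² = s a_i the form becomes the sum of the z_i², whose real part is a real form of
-- signature (n, n).
theorem exists_isCharIsometry_complex [IsTopologicalRing F] {n : ℕ} {a : Fin n → F}
    (ha : ∀ i, a i ≠ 0) :
    ∃ (ε : Fin n ⊕ Fin n → ℝ) (E : (Fin n → F) ≃ₜ (Fin n ⊕ Fin n → ℝ)), (∀ i, ε i * ε i = 1) ∧
        IsCharIsometry ψ (diagForm a) Real.fourierChar (diagForm ε) E := by
  obtain ⟨s, hs0, hs⟩ := exists_fourierChar_complex he' hψ hψ1
  have hsa : ∀ i, ∃ c : ℂ, c * c = s * e (a i) := fun i => by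
    obtain ⟨c, hc⟩ := IsAlgClosed.exists_pow_nat_eq (s * e (a i)) (n := 2) (by norm_num)
    exact ⟨c, by rw [← hc, sq]⟩
  choose c hcc using hsa
  have hc : ∀ i, c i ≠ 0 := fun i h => by
    have := hcc i
    rw [h, mul_zero] at this
    exact mul_ne_zero hs0 (by simpa using ha i) this.symm
  let ε : Fin n ⊕ Fin n → ℝ := Sum.elim (fun _ => 1) fun _ => -1
  let E : (Fin n → F) ≃ₜ (Fin n ⊕ Fin n → ℝ) :=
    { toFun := fun x => Sum.elim (fun i => (c i * e (x i)).re) fun i => (c i * e (x i)).im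
      invFun := fun y i => e.symm ((c i)⁻¹ * ((y (Sum.inl i) : ℂ) + y (Sum.inr i) * Complex.I))
      left_inv := fun x => funext fun i => by
        simp only [Sum.elim_inl, Sum.elim_inr, Complex.re_add_im]
        rw [inv_mul_cancel_left₀ (hc i), e.symm_apply_apply]
      right_inv := fun y => funext fun j => by
        rcases j with i | i <;>
          simp only [Sum.elim_inl, Sum.elim_inr, e.apply_symm_apply, mul_inv_cancel_left₀ (hc i)] <;>
          simp
      continuous_toFun := by
        refine continuous_pi fun j => ?_
        rcases j with i | i
        · exact Complex.continuous_re.comp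
            (continuous_const.mul (he.comp (continuous_apply i)))
        · exact Complex.continuous_im.comp
            (continuous_const.mul (he.comp (continuous_apply i)))
      continuous_invFun := by
        refine continuous_pi fun i => he'.comp ?_
        fun_prop }
  have hE : ∀ x, E x = Sum.elim (fun i => (c i * e (x i)).re) fun i => (c i * e (x i)).im :=
    fun x => rfl
  have key : ∀ x y : Fin n → F, diagForm ε (E x) (E y) =
      (s * e (diagForm a x y)).re := fun x y => by
    rw [diagForm_apply, diagForm_apply, Fintype.sum_sum_type, hE, hE, ← Finset.sum_add_distrib,
      map_sum, Finset.mul_sum, Complex.re_sum]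
    refine Finset.sum_congr rfl fun i _ => ?_
    simp only [ε, Sum.elim_inl, Sum.elim_inr]
    have h : s * e (a i * (x i * y i)) = (c i * e (x i)) * (c i * e (y i)) := by
      rw [map_mul, map_mul]
      linear_combination -(e (x i) * e (y i)) * hcc i
    rw [h, Complex.mul_re (c i * e (x i)) (c i * e (y i))]
    ring
  refine ⟨ε, E, fun i => ?_, ⟨fun x y => ?_, fun x y => ?_, fun x => ?_⟩⟩
  · rcases i with i | i <;> simp [ε]
  · ext j
    rcases j with i | i <;> simp [hE, mul_add]
  · rw [hs, key]
  · rw [quadChar, quadChar, hs, key]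
    congr 2
    rw [map_mul, map_inv₀, map_ofNat, mul_left_comm,
      show (2 : ℂ)⁻¹ = ((2⁻¹ : ℝ) : ℂ) by push_cast; rfl, Complex.re_ofReal_mul]

end ComplexCase

/-! ### Archimedean fields. -/

section Archimedean

variable {F : Type*} [Field F] [TopologicalSpace F] [IsTopologicalRing F]
  {ψ : AddChar F Circle}

theorem exists_isWeilConstant_of_isCharIsometry {ι κ : Type*} [Fintype ι] [Fintype κ]
    [SecondCountableTopology F]
    {a : ι → F} {ε : κ → ℝ} {E : (ι → F) ≃ₜ (κ → ℝ)} (hε : ∀ i, ε i * ε i = 1)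
    (hE : IsCharIsometry ψ (diagForm a) Real.fourierChar (diagForm ε) E) :
    letI : MeasurableSpace (ι → F) := borel (ι → F)
    (∃ c, c ^ 8 = 1 ∧ IsWeilConstant ψ (diagForm a) c) ∧ HasTestFunction ψ (diagForm a) := by
  let _ : MeasurableSpace (ι → F) := borel (ι → F)
  have : BorelSpace (ι → F) := ⟨rfl⟩
  obtain ⟨c, hc8, hc⟩ := exists_isWeilConstant_real hε
  exact ⟨⟨c, hc8, hc.map hE.symm⟩, (hasTestFunction_real hε).map hE.symm⟩

theorem hasWeilTheory_real {e : F ≃+* ℝ} (he : Continuous e) (he' : Continuous e.symm)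
    [SecondCountableTopology F] (h2 : (2 : F) ≠ 0) (hψ : Continuous ψ) (hψ1 : ψ ≠ 1) :
    HasWeilTheory ψ where
  two_ne_zero := h2
  continuous := hψ
  exists_const n a ha := by
    obtain ⟨ε, E, hε, hE⟩ := exists_isCharIsometry_real he he' hψ hψ1 ha
    obtain ⟨⟨c, -, hc⟩, ht⟩ := exists_isWeilConstant_of_isCharIsometry hε hE
    exact ⟨⟨c, hc⟩, ht⟩

theorem hasWeilTheory_complex {e : F ≃+* ℂ} (he : Continuous e) (he' : Continuous e.symm)
    [SecondCountableTopology F] (h2 : (2 : F) ≠ 0) (hψ : Continuous ψ) (hψ1 : ψ ≠ 1) :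
    HasWeilTheory ψ where
  two_ne_zero := h2
  continuous := hψ
  exists_const n a ha := by
    obtain ⟨ε, E, hε, hE⟩ := exists_isCharIsometry_complex he he' hψ hψ1 ha
    obtain ⟨⟨c, -, hc⟩, ht⟩ := exists_isWeilConstant_of_isCharIsometry hε hE
    exact ⟨⟨c, hc⟩, ht⟩

variable [LocallyCompactSpace F] [SecondCountableTopology F] [T2Space F] (hW : HasWeilTheory ψ)
include hW

theorem hasNormTheory_complex (e : F ≃+* ℂ) : HasNormTheory ψ := by
  have hi : e.symm Complex.I ^ 2 = -1 := by
    rw [← map_pow, Complex.I_sq, map_neg, map_one]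
  have h := fun (a : F) (ha : a ≠ 0) => isSumTwoSq_of_neg_one hW.two_ne_zero hi ha
  refine ⟨⟨1, one_ne_zero, fun a ha => Or.inl (h a ha)⟩, ?_⟩
  have := hW.scalar_one_pow_four (h (-1) (by simp))
  rw [show 8 = 4 * 2 from rfl, pow_mul, this, one_pow]

/-- One of ±a is a square, and γ(1)⁸ = 1 is read off from the explicit Gaussian constant. -/
theorem hasNormTheory_real {e : F ≃+* ℝ} (he : Continuous e) (he' : Continuous e.symm)
    (hψ1 : ψ ≠ 1) : HasNormTheory ψ := by
  refine ⟨⟨-1, by simp, fun a ha => ?_⟩, ?_⟩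
  · have hsq : ∀ a : F, a ≠ 0 → 0 ≤ e a → IsSumTwoSq a := fun a ha h => by
      refine ⟨ha, e.symm (Real.sqrt (e a)), 0, ?_⟩
      rw [← map_pow, Real.sq_sqrt h, e.symm_apply_apply]
      ring
    rcases le_total 0 (e a) with h | h
    · exact Or.inl (hsq a ha h)
    · refine Or.inr (hsq _ (by simpa using ha) ?_)
      rw [mul_neg_one, map_neg]
      linarith
  · have h1 : ∀ _ : Fin 1, (1 : F) ≠ 0 := fun _ => one_ne_zero
    obtain ⟨ε, E, hε, hE⟩ := exists_isCharIsometry_real he he' hW.continuous hψ1 h1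
    obtain ⟨⟨c, hc8, hc⟩, -⟩ := exists_isWeilConstant_of_isCharIsometry hε hE
    have hidx : HasWeilIndex ψ ((1 : F) • LinearMap.mul F F : LinearMap.BilinForm F F) c :=
      ⟨1, LinearMap.pi fun _ => LinearMap.id, diagForm fun _ => 1,
        fun x => ⟨x 0, funext fun i => by rw [Subsingleton.elim i 0]; rfl⟩,
        diagForm_nondegenerate h1, fun x y => by simp, hc⟩
    rw [weilIndexScalar, hW.weilIndex_eq (smul_mul_isSymm _) hidx, hc8]

end Archimedean

end WeilCharacter

end

/-! ### Conclusion for the four kinds of ground field. -/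

theorem mainTheorem7 {F : Type*} [Field F] [TopologicalSpace F]
    (hF : WeilCharacter.IsFiniteOrLocalField F) (h2 : (2 : F) ≠ 0)
    (ψ : AddChar F Circle) (hψ : Continuous ψ) (hψ1 : ψ ≠ 1)
    {V : Type*} [AddCommGroup V] [Module F V] [FiniteDimensional F V]
    (ω : LinearMap.BilinForm F V) (halt : ω.IsAlt) (hω : ω.Nondegenerate) :
    (∃! f' : WeilCharacter.Mp ψ ω → WeilCharacter.Mp ψ (WeilCharacter.barSum ω),
      WeilCharacter.IsHomomorphicEmbeddingOver ψ (WeilCharacter.inr ω) f') ∧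
    ∀ f' : WeilCharacter.Mp ψ ω → WeilCharacter.Mp ψ (WeilCharacter.barSum ω),
      WeilCharacter.IsHomomorphicEmbeddingOver ψ (WeilCharacter.inr ω) f' →
      ∀ l : WeilCharacter.Gr ω,
        (∀ x : WeilCharacter.Mp ψ ω,
          WeilCharacter.ev ψ (WeilCharacter.double l) (f' x) = WeilCharacter.ev ψ l x) ∧
        WeilCharacter.theta ψ hω l =
          WeilCharacter.ev ψ (WeilCharacter.graph hω 1) ∘ f' := by
  rcases hF with ⟨_, _⟩ | ⟨e, he, he'⟩ | ⟨e, he, he'⟩ | ⟨_, _⟩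
  · classical
    have hv := WeilCharacter.isUltrametricAbs_trivial (F := F)
    have := hv.locallyCompactSpace
    have := hv.secondCountableTopology
    have hW := hv.hasWeilTheory h2 hψ hψ1
    exact hW.metaplectic_embedding hW.hasNormTheory_of_finite halt hω
  · have := WeilCharacter.isTopologicalRing_of_ringEquiv e he he'
    have h := WeilCharacter.homeomorphOfRingEquiv e he he'
    have := h.isClosedEmbedding.locallyCompactSpace
    have := h.secondCountableTopology
    have := h.symm.t2Space
    have hW := WeilCharacter.hasWeilTheory_real he he' h2 hψ hψ1
    exact hW.metaplectic_embedding (WeilCharacter.hasNormTheory_real hW he he' hψ1) halt hω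
  · have := WeilCharacter.isTopologicalRing_of_ringEquiv e he he'
    have h := WeilCharacter.homeomorphOfRingEquiv e he he'
    have := h.isClosedEmbedding.locallyCompactSpace
    have := h.secondCountableTopology
    have := h.symm.t2Space
    have hW := WeilCharacter.hasWeilTheory_complex he he' h2 hψ hψ1
    exact hW.metaplectic_embedding (WeilCharacter.hasNormTheory_complex hW e) halt hω
  · obtain ⟨v, hv, p, hp, hp1⟩ := WeilCharacter.exists_isUltrametricAbs F
    have := hv.t2Space
    have := hv.secondCountableTopology
    have hW := hv.hasWeilTheory h2 hψ hψ1
    exact hW.metaplectic_embedding (hv.hasNormTheory hW hp hp1) halt hω
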